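/- **Setting.** For $\tau$ in the upper half-plane $\mathbb H$ put $q=e^{2\pi i\tau}$, $D=q\frac{d}{dq}=\frac1{2\pi i}\frac{d}{d\tau}$, $$\vartheta(z)=\vartheta(z,q)=-i\sum_{n\in\mathbb Z}(-1)^n e^{(n+1/2)^2\pi i\tau+(2n+1)iz}=2q^{1/8}\sum_{n\ge 0}(-1)^n q^{n(n+1)/2}\sin((2n+1)z),$$ primes denoting derivatives in $z$. Let $\alpha=\pi/4$ (that is, $\gamma=-2\cos 2\alpha=0$) and $$t=\frac{\cos\alpha}{64\sin^3\alpha}\Big(-\frac{\vartheta(\alpha)\vartheta'''(\alpha)}{\vartheta'(\alpha)^2}+\frac{\vartheta''(\alpha)}{\vartheta'(\alpha)}\Big),\qquad R=\frac{\cos^2\alpha}{96\sin^4\alpha}\,\frac{\vartheta(\alpha)^2}{\vartheta'(\alpha)^2}\Big(-\frac{\vartheta'''(\alpha)}{\vartheta'(\alpha)}+\frac{\vartheta'''(0)}{\vartheta'(0)}\Big),$$ $$A=\frac{\vartheta'(\alpha)}{\vartheta(\alpha)},\qquad S=\frac{8\sin^4\alpha}{\cos^2\alpha}\,\frac{A^2}{DR},\qquad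 \frac{df}{dR}=\frac{Df}{DR},$$ viewed both as functions of $\tau\in\mathbb H$ and (for $t,R,A$; the factors $q^{1/8}$ cancel) as formal power series in $q$. Let $\eta(q)=q^{1/24}\prod_{n\ge1}(1-q^n)$ (with $q^{1/24}=e^{2\pi i\tau/24}$), $[k]=\eta(q^k)$ and $h=([4]/[1])^8$. **Theorem.** 1. For every $\tau\in\mathbb H$ the numbers $\vartheta(\alpha),\ \vartheta'(\alpha),\ \vartheta'(0),\ DR,\ h,\ 1+16h,\ R,\ 1-16R,\ \sum_{n\in\mathbb Z} q^{n^2}$ are non-zero, and $$\frac{\vartheta(\alpha)}{\sqrt2}=\frac{[1][4]}{[2]},\qquad A=1+4\sum_{n\ge1}\frac{q^n}{1+q^{2n}}=\Big(\sum_{n\in\mathbb Z}q^{n^2}\Big)^2=\frac{[2]^{10}}{[1]^4[4]^4},$$ $$R=\frac{h}{1+16h}=\frac{[1]^8[4]^{16}}{[2]^{24}}=\frac1{16}\left(\frac{\sum_{n\in\mathbb Z+1/2}q^{n^2}}{\sum_{n\in\mathbb Z}q^{n^2}}\right)^4,\qquad \frac S4=\frac{(1+16h)^2}{h}=\frac1{R(1-16R)}=\left(\frac{[2]^2}{[1][4]}\right)^{24}.$$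 Moreover $$\frac{d^2t}{dR^2}-\frac{4}{R(1-16R)}\,t=0,\qquad \frac{d^2f}{dR^2}+\frac{1-32R}{R(1-16R)}\frac{df}{dR}-\frac{4}{R(1-16R)}f=0\quad\text{for } f=A \text{ and } f=\tau A,$$ and $A$ and $\tau A$ are linearly independent over $\mathbb C$. The power series $t,R,A\in\mathbb C[[q]]$ converge for $0<|q|<1$ to the corresponding functions of $\tau$. 2. In $\mathbb C[[q]]$ one has $t=q+O(q^2)$, $R=q+O(q^2)$ and $$t=R\;{}_2F_1\big(\tfrac12,\tfrac12;2;16R\big),\qquad A={}_2F_1\big(\tfrac12,\tfrac12;1;16R\big).$$ 3. There is a unique power series $q(t)\in\mathbb C[[t]]$ with constant term $0$ that inverts $t(q)$, and the series $R(t,0):=R(q(t))$ is the unique power series $\rho\in\mathbb C[[t]]$ with constant term $0$ such that $t=\rho\;{}_2F_1(\frac12,\frac12;2;16\rho)$; equivalently, the unique one such that $$t=\sum_{n\ge0}\frac1{n+1}\binom{2n}{n}^2\rho^{\,n+1}.$$ So $R(t,0)$ is the series defined by Bousquet-Mélou and Elvey Price in their solution for planar Eulerian orientations. 4. If $\tau\in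 i\mathbb R_{>0}$ then $16R\in(0,1)$. If $U\subset\mathbb H$ is a connected set that meets $i\mathbb R_{>0}$ and $|16R|<1$ on $U$, then on $U$, as convergent series, $t=R\,{}_2F_1(\frac12,\frac12;2;16R)$ and $A={}_2F_1(\frac12,\frac12;1;16R)$. If moreover $|1-16R|<1$ on $U$, then on $U$ one has $\tau A=\frac i2\,{}_2F_1(\frac12,\frac12;1;1-16R)$, ${}_2F_1(\frac12,\frac12;1;16R)\neq0$, and Ramanujan's identity $$q=\exp\left(-\pi\,\frac{{}_2F_1(\frac12,\frac12;1;1-16R)}{{}_2F_1(\frac12,\frac12;1;16R)}\right).$$ In particular the last three assertions hold for $\tau\in i\mathbb R_{>0}$, i.e. for $0<q<1$. -/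

import Mathlib

open scoped Real

noncomputable section

namespace SixVertex

/-! ### Analytic objects: functions of `τ` in the upper half-plane, `q = exp (2πiτ)` -/

/-- The upper half-plane, as a subset of `ℂ`. -/
def upperHalf : Set ℂ := {τ | 0 < τ.im}

/-- `q = exp (2πiτ)`. -/
def nome (τ : ℂ) : ℂ := Complex.exp (2 * π * Complex.I * τ)

/-- Jacobi's theta function
`ϑ(z|τ) = -i ∑_{n ∈ ℤ} (-1)^n exp ((n + 1/2)² πiτ + (2n + 1) i z)`. -/
def theta (z τ : ℂ) : ℂ :=
  -Complex.I * ∑' n : ℤ, (-1 : ℂ) ^ n *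
    Complex.exp (((n : ℂ) + 1 / 2) ^ 2 * π * Complex.I * τ + (2 * (n : ℂ) + 1) * Complex.I * z)

/-- The `k`-th derivative of `ϑ(z|τ)` with respect to the first variable `z`. -/
def thetaD (k : ℕ) (z τ : ℂ) : ℂ := iteratedDeriv k (fun w => theta w τ) z

/-- `t` as a function of `τ`. -/
def tFun (α τ : ℂ) : ℂ :=
  Complex.cos α / (64 * Complex.sin α ^ 3) *
    (-(theta α τ * thetaD 3 α τ / thetaD 1 α τ ^ 2) + thetaD 2 α τ / thetaD 1 α τ)

/-- `R` as a function of `τ`. -/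
def RFun (α τ : ℂ) : ℂ :=
  Complex.cos α ^ 2 / (96 * Complex.sin α ^ 4) * (theta α τ ^ 2 / thetaD 1 α τ ^ 2) *
    (-(thetaD 3 α τ / thetaD 1 α τ) + thetaD 3 0 τ / thetaD 1 0 τ)

/-- `A = ϑ'(α|τ) / ϑ(α|τ)`. -/
def AFun (α τ : ℂ) : ℂ := thetaD 1 α τ / theta α τ

/-- `D = q d/dq = (2πi)⁻¹ d/dτ`. -/
def qD (f : ℂ → ℂ) (τ : ℂ) : ℂ := (2 * π * Complex.I)⁻¹ * deriv f τ

/-- `df/dR = D f / D R`, for a function `f` of `τ`. -/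
def derivR (α : ℂ) (f : ℂ → ℂ) (τ : ℂ) : ℂ := qD f τ / qD (RFun α) τ

/-- `S = (8 sin⁴ α / cos² α) A² / D R`. -/
def SFun (α τ : ℂ) : ℂ :=
  8 * Complex.sin α ^ 4 / Complex.cos α ^ 2 * (AFun α τ ^ 2 / qD (RFun α) τ)

/-- `[k] = η(q^k)`, where `η(q) = q^{1/24} ∏_{n ≥ 1} (1 - q^n)`, as a function of `τ`. -/
def etaK (k : ℕ) (τ : ℂ) : ℂ := ModularForm.eta ((k : ℂ) * τ)

/-- `h = (η(q⁴) / η(q))⁸`. -/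
def hFun (τ : ℂ) : ℂ := (etaK 4 τ / etaK 1 τ) ^ 8

/-- `∑_{n ∈ ℤ} q^{(n + s)²}`. -/
def sqSum (s τ : ℂ) : ℂ := ∑' n : ℤ, Complex.exp (2 * π * Complex.I * τ * ((n : ℂ) + s) ^ 2)

/-! ### Formal objects: power series in `q` -/

/-- The power series in `q` equal to `q^{-1/8} ∂_z^k ϑ(z, q)`, obtained term by term from
`ϑ(z, q) = q^{1/8} ∑_{n ≥ 0} 2 (-1)^n q^{n(n+1)/2} sin ((2n + 1) z)`. -/
def thetaSeries (k : ℕ) (z : ℂ) : PowerSeries ℂ :=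
  PowerSeries.mk fun m => ∑ n ∈ Finset.range (m + 1),
    if n * (n + 1) = 2 * m then
      2 * (-1) ^ n * iteratedDeriv k (fun w : ℂ => Complex.sin ((2 * (n : ℂ) + 1) * w)) z
    else 0

/-- `t` as a power series in `q` (the factors `q^{1/8}` cancel). -/
def tSeries (α : ℂ) : PowerSeries ℂ :=
  PowerSeries.C (Complex.cos α / (64 * Complex.sin α ^ 3)) *
    (-(thetaSeries 0 α * thetaSeries 3 α * ((thetaSeries 1 α)⁻¹) ^ 2) +
      thetaSeries 2 α * (thetaSeries 1 α)⁻¹)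

/-- `R` as a power series in `q`. -/
def RSeries (α : ℂ) : PowerSeries ℂ :=
  PowerSeries.C (Complex.cos α ^ 2 / (96 * Complex.sin α ^ 4)) *
    (thetaSeries 0 α ^ 2 * ((thetaSeries 1 α)⁻¹) ^ 2) *
    (-(thetaSeries 3 α * (thetaSeries 1 α)⁻¹) + thetaSeries 3 0 * (thetaSeries 1 0)⁻¹)

/-- `A` as a power series in `q`. -/
def ASeries (α : ℂ) : PowerSeries ℂ := thetaSeries 1 α * (thetaSeries 0 α)⁻¹

/-- Composition `f(g)` of formal power series (meaningful when `g` has constant term `0`). -/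
def comp (f g : PowerSeries ℂ) : PowerSeries ℂ := PowerSeries.subst g f

/-- The formal power series `₂F₁(a, b; c; X)`. -/
def hypSeries (a b c : ℂ) : PowerSeries ℂ :=
  PowerSeries.mk (ordinaryHypergeometricCoefficient a b c)

/-- `u` is the series `q(t)`: it has constant term `0` and satisfies `t = t(q(t))`. -/
def IsQOfT (α : ℂ) (u : PowerSeries ℂ) : Prop :=
  PowerSeries.constantCoeff u = 0 ∧ comp (tSeries α) u = PowerSeries.X

end SixVertex

end

open SixVertex

/-! ### Gaussian sums `∑ (n + s)^k exp (2πi (t (n + s)² + (n + s) z))` -/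

namespace SixVertex

open Complex Filter Topology

/-! Everything reduces to the theta constants θ₂, θ₃, θ₄ (sums of q^{(n+1/2)²}, q^{n²}, (-1)^n
q^{n²}) and their images under D = q d/dq. All series involved are Gaussian sums with a polynomial
weight (n + s)^k. A z-derivative raises k by one and a t-derivative by two, so third z-derivatives
of ϑ come from differentiating identities between lower ones in τ.

Two tools produce the identities. The triple product turns theta constants, ϑ(π/4) and ϑ'(0) into
eta quotients. The substitution (m, n) = (i + j, i - j) in a product of two Gaussian sums, with a
weight that behaves well under it, gives Wronskian relations such as θ₄ Dθ₂ - θ₂ Dθ₄ = θ₂ θ₄ θ₃⁴ /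
4; Jacobi's identity θ₃⁴ = θ₂⁴ + θ₄⁴ is the compatibility of three of them. The outcome is A = θ₃²,
R = θ₂⁴ / (16 θ₃⁴), 1 - 16R = θ₄⁴ / θ₃⁴ and t = Dθ₃ / (2 θ₃³) (`AFun_eq`, `RFun_eq`,
`one_sub_RFun_eq`, `tFun_eq`).

The core is the closed system DA = 4tA², DR = A²R(1 - 16R), Dt = A³R(1 - 16R). Its last equation
needs a second-order equation for θ₃. This is obtained from the one for θ₄, whose defect Δ satisfies
Δ(τ) = -4 Δ(2τ) and decays exponentially at i∞, hence vanishes (`thetaDefect_eq_zero`). Dividing by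
DR gives dt/dR = A and dA/dR = 4t / (R(1 - 16R)), and with them the differential equations.

With x = 16R, the pair x ₂F₁(1/2, 1/2; 2; x), ₂F₁(1/2, 1/2; 1; x) satisfies the same linear system
in R as 16t, A. A Wronskian argument and the values at q = 0 identify the two pairs, formally in
`ASeries_eq_and_tSeries_eq` and for functions in `AFun_tFun_eq_on_component`. Compositional
inversion then characterises R as a series in t. Finally τ ↦ -1/(4τ) exchanges 16R and 1 - 16R and
sends A to -2iτA, which yields the second solution and Ramanujan's formula for q. -/

/-- The terms of `gaussSum`. -/
noncomputable def gaussTerm (k : ℕ) (z : ℂ) (s : ℝ) (t : ℂ) (n : ℤ) : ℂ :=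
  ((n : ℂ) + s) ^ k * cexp (2 * π * I * (t * ((n : ℂ) + s) ^ 2 + ((n : ℂ) + s) * z))

/-- `∑_{n ∈ ℤ} (n + s)^k exp (2πi (t (n + s)² + (n + s) z))`. -/
noncomputable def gaussSum (k : ℕ) (z : ℂ) (s : ℝ) (t : ℂ) : ℂ := ∑' n : ℤ, gaussTerm k z s t n

lemma norm_gaussTerm (k : ℕ) (z : ℂ) (s : ℝ) (t : ℂ) (n : ℤ) :
    ‖gaussTerm k z s t n‖ =
      |(n : ℝ) + s| ^ k *
        Real.exp (-(2 * π) * (t.im * ((n : ℝ) + s) ^ 2 + ((n : ℝ) + s) * z.im)) := by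
  have h : (n : ℂ) + s = (((n : ℝ) + s : ℝ) : ℂ) := by push_cast; rfl
  rw [gaussTerm, norm_mul, norm_pow, h, norm_real, Real.norm_eq_abs, Complex.norm_exp]
  congr 2
  rw [show 2 * (π : ℂ) * I * (t * (((n : ℝ) + s : ℝ) : ℂ) ^ 2 + (((n : ℝ) + s : ℝ) : ℂ) * z)
    = ((2 * π * ((n : ℝ) + s) ^ 2 : ℝ) : ℂ) * (t * I) +
      ((2 * π * ((n : ℝ) + s) : ℝ) : ℂ) * (z * I) by push_cast; ring]
  rw [add_re, re_ofReal_mul, re_ofReal_mul, mul_I_re, mul_I_re]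
  ring

lemma summable_exp_neg_abs_int : Summable fun n : ℤ => Real.exp (-|(n : ℝ)|) := by
  have h : Summable fun n : ℕ => Real.exp (-(n : ℝ)) := Real.summable_exp_neg_nat
  apply Summable.of_nat_of_neg <;> simpa using h

/-- The constant in `norm_gaussTerm_le`. -/
noncomputable def gaussBound (k : ℕ) (M T s : ℝ) : ℝ :=
  k.factorial * Real.exp ((2 * π * M + 2) ^ 2 / (8 * π * T) + |s|)

/-- The bound is uniform in t on a half-plane and in z on a strip, so that it dominates termwise
differentiation in either variable. The quadratic exponent absorbs both the weight and the linear
term. -/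
lemma norm_gaussTerm_le (k : ℕ) {z : ℂ} (s : ℝ) {t : ℂ} {M T : ℝ} (hT : 0 < T)
    (hz : |z.im| ≤ M) (ht : T ≤ t.im) (n : ℤ) :
    ‖gaussTerm k z s t n‖ ≤ gaussBound k M T s * Real.exp (-|(n : ℝ)|) := by
  rw [norm_gaussTerm, gaussBound]
  set x : ℝ := (n : ℝ) + s with hx
  have hpi := Real.pi_pos
  have h1 : |x| ^ k ≤ k.factorial * Real.exp |x| := by
    have := Real.pow_div_factorial_le_exp |x| (abs_nonneg x) k
    rw [div_le_iff₀ (by positivity)] at this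
    linarith
  have h2 : -x * z.im ≤ |x| * M := by
    calc -x * z.im ≤ |(-x) * z.im| := le_abs_self _
      _ = |x| * |z.im| := by rw [abs_mul, abs_neg]
      _ ≤ |x| * M := by gcongr
  have h3 : T * x ^ 2 ≤ t.im * x ^ 2 := by gcongr
  -- Completing the square. Of the 2 added to 2πM, one unit pays for |x|^k ≤ k! e^{|x|} and the
  -- other leaves the decay e^{-|x|}.
  have h4 : -(2 * π) * (T * x ^ 2) + (2 * π * M + 2) * |x| ≤
      (2 * π * M + 2) ^ 2 / (8 * π * T) := by
    rw [le_div_iff₀ (by positivity), ← sq_abs x]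
    nlinarith [sq_nonneg (4 * π * T * |x| - (2 * π * M + 2))]
  have h5 : |(n : ℝ)| ≤ |x| + |s| := by
    have : (n : ℝ) = x - s := by rw [hx]; ring
    rw [this]; exact abs_sub _ _
  calc |x| ^ k * Real.exp (-(2 * π) * (t.im * x ^ 2 + x * z.im))
      ≤ (k.factorial * Real.exp |x|) * Real.exp (-(2 * π) * (t.im * x ^ 2 + x * z.im)) := by gcongr
    _ = k.factorial * Real.exp (|x| + -(2 * π) * (t.im * x ^ 2 + x * z.im)) := by
        rw [mul_assoc, ← Real.exp_add]
    _ ≤ k.factorial * Real.exp ((2 * π * M + 2) ^ 2 / (8 * π * T) + |s| + -|(n : ℝ)|) := by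
        refine mul_le_mul_of_nonneg_left (Real.exp_le_exp.mpr ?_) (by positivity)
        nlinarith
    _ = _ := by rw [Real.exp_add]; ring

lemma summable_gaussTerm_norm (k : ℕ) (z : ℂ) (s : ℝ) {t : ℂ} (ht : 0 < t.im) :
    Summable fun n => ‖gaussTerm k z s t n‖ :=
  Summable.of_nonneg_of_le (fun _ => norm_nonneg _)
    (fun n => norm_gaussTerm_le k s ht le_rfl le_rfl n) (summable_exp_neg_abs_int.mul_left _)

lemma summable_gaussTerm (k : ℕ) (z : ℂ) (s : ℝ) {t : ℂ} (ht : 0 < t.im) :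
    Summable (gaussTerm k z s t) := (summable_gaussTerm_norm k z s ht).of_norm

lemma isOpen_upperHalf : IsOpen upperHalf := isOpen_lt continuous_const continuous_im

/-- Together with the z-derivative below this is the heat equation, read off from the index k: one
derivative in t counts as two in z. -/
lemma hasDerivAt_gaussSum_snd (k : ℕ) (z : ℂ) (s : ℝ) {t : ℂ} (ht : 0 < t.im) :
    HasDerivAt (fun t => gaussSum k z s t) (2 * π * I * gaussSum (k + 2) z s t) t := by
  have hU : IsOpen {w : ℂ | t.im / 2 < w.im} := isOpen_lt continuous_const continuous_im
  have hc : IsPreconnected {w : ℂ | t.im / 2 < w.im} :=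
    (convex_halfSpace_im_gt _).isPreconnected
  have htU : t ∈ {w : ℂ | t.im / 2 < w.im} := by simpa using ht
  have := hasDerivAt_tsum_of_isPreconnected (𝕜 := ℂ)
    (g := fun n w => gaussTerm k z s w n) (g' := fun n w => 2 * π * I * gaussTerm (k + 2) z s w n)
    (u := fun n : ℤ => ‖2 * (π : ℂ) * I‖ * (gaussBound (k + 2) |z.im| (t.im / 2) s *
      Real.exp (-|(n : ℝ)|)))
    ((summable_exp_neg_abs_int.mul_left _).mul_left _) hU hc ?_ ?_ htU
    (summable_gaussTerm k z s ht) htU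
  · simpa only [gaussSum, tsum_mul_left] using this
  · intro n y _
    have h : HasDerivAt (fun w : ℂ => 2 * π * I * (w * ((n : ℂ) + s) ^ 2 + ((n : ℂ) + s) * z))
        (2 * π * I * ((n : ℂ) + s) ^ 2) y := by
      simpa using (((hasDerivAt_id y).mul_const _).add_const _).const_mul (2 * (π : ℂ) * I)
    convert! (h.cexp.const_mul (((n : ℂ) + s) ^ k)) using 1
    simp only [gaussTerm]; ring
  · intro n y hy
    rw [norm_mul]
    gcongr
    exact norm_gaussTerm_le _ s (half_pos ht) le_rfl (le_of_lt hy) n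

lemma hasDerivAt_gaussSum_fst (k : ℕ) (z : ℂ) (s : ℝ) {t : ℂ} (ht : 0 < t.im) :
    HasDerivAt (fun z => gaussSum k z s t) (2 * π * I * gaussSum (k + 1) z s t) z := by
  have hU : IsOpen {w : ℂ | |w.im| < |z.im| + 1} :=
    isOpen_lt (continuous_abs.comp continuous_im) continuous_const
  have hc : IsPreconnected {w : ℂ | |w.im| < |z.im| + 1} := by
    have : {w : ℂ | |w.im| < |z.im| + 1} =
        {w : ℂ | -(|z.im| + 1) < w.im} ∩ {w : ℂ | w.im < |z.im| + 1} := by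
      ext w; simp [abs_lt]
    rw [this]
    exact ((convex_halfSpace_im_gt _).inter (convex_halfSpace_im_lt _)).isPreconnected
  have hzU : z ∈ {w : ℂ | |w.im| < |z.im| + 1} := by simp
  have := hasDerivAt_tsum_of_isPreconnected (𝕜 := ℂ)
    (g := fun n w => gaussTerm k w s t n) (g' := fun n w => 2 * π * I * gaussTerm (k + 1) w s t n)
    (u := fun n : ℤ => ‖2 * (π : ℂ) * I‖ * (gaussBound (k + 1) (|z.im| + 1) t.im s *
      Real.exp (-|(n : ℝ)|)))
    ((summable_exp_neg_abs_int.mul_left _).mul_left _) hU hc ?_ ?_ hzU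
    (summable_gaussTerm k z s ht) hzU
  · simpa only [gaussSum, tsum_mul_left] using this
  · intro n y _
    have h : HasDerivAt (fun w : ℂ => 2 * π * I * (t * ((n : ℂ) + s) ^ 2 + ((n : ℂ) + s) * w))
        (2 * π * I * ((n : ℂ) + s)) y := by
      simpa using (((hasDerivAt_id y).const_mul ((n : ℂ) + s)).const_add _).const_mul
        (2 * (π : ℂ) * I)
    convert! (h.cexp.const_mul (((n : ℂ) + s) ^ k)) using 1
    simp only [gaussTerm]; ring
  · intro n y hy
    rw [norm_mul]
    gcongr
    exact norm_gaussTerm_le _ s ht (le_of_lt hy) le_rfl n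

/-! #### Symmetries -/

lemma gaussSum_add_one_left (k : ℕ) (z : ℂ) (s : ℝ) (t : ℂ) :
    gaussSum k (z + 1) s t = cexp (2 * π * I * s) * gaussSum k z s t := by
  rw [gaussSum, gaussSum, ← tsum_mul_left]
  refine tsum_congr fun n => ?_
  have h : cexp (2 * π * I * n) = 1 := by
    rw [mul_comm]; exact exp_int_mul_two_pi_mul_I n
  rw [gaussTerm, gaussTerm, show 2 * (π : ℂ) * I * (t * ((n : ℂ) + s) ^ 2 + ((n : ℂ) + s) * (z + 1))
    = 2 * π * I * n + (2 * π * I * s + 2 * π * I * (t * ((n : ℂ) + s) ^ 2 + ((n : ℂ) + s) * z)) by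
      ring, exp_add, exp_add, h]
  ring

lemma gaussSum_add_one_right (k : ℕ) (z : ℂ) (s : ℝ) (t : ℂ) :
    gaussSum k z (s + 1) t = gaussSum k z s t := by
  rw [gaussSum, gaussSum, ← (Equiv.addRight (1 : ℤ)).tsum_eq (gaussTerm k z s t)]
  refine tsum_congr fun n => ?_
  simp only [gaussTerm, Equiv.coe_addRight]
  push_cast
  rw [show (n : ℂ) + (s + 1) = n + 1 + s by ring]

lemma gaussSum_neg (k : ℕ) (z : ℂ) (s : ℝ) (t : ℂ) :
    gaussSum k (-z) (-s) t = (-1) ^ k * gaussSum k z s t := by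
  rw [gaussSum, gaussSum, ← tsum_mul_left, ← (Equiv.neg ℤ).tsum_eq]
  refine tsum_congr fun n => ?_
  simp only [gaussTerm, Equiv.neg_apply]
  push_cast
  rw [show -(n : ℂ) + -s = -1 * (n + s) by ring, mul_pow]
  ring_nf

/-- The decomposition of the integers into even and odd ones. -/
def intEvenOdd : ℤ ⊕ ℤ ≃ ℤ where
  toFun := Sum.elim (fun n => 2 * n) (fun n => 2 * n + 1)
  invFun m := if m % 2 = 0 then Sum.inl (m / 2) else Sum.inr (m / 2)
  left_inv := by
    rintro (n | n)
    · simp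
    · refine (if_neg (by change ¬ (2 * n + 1) % 2 = 0; omega)).trans ?_
      change Sum.inr ((2 * n + 1) / 2) = _
      congr 1; omega
  right_inv := by
    intro m
    dsimp only
    split_ifs with h
    · simp only [Sum.elim_inl]; omega
    · simp only [Sum.elim_inr]; omega

/-- Splitting of the summation over even and odd integers. -/
lemma gaussSum_split (k : ℕ) (z : ℂ) (s : ℝ) {t : ℂ} (ht : 0 < t.im) :
    gaussSum k z s t = 2 ^ k * (gaussSum k (2 * z) (s / 2) (4 * t) +
      gaussSum k (2 * z) ((s + 1) / 2) (4 * t)) := by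
  have ht4 : 0 < (4 * t).im := by simpa using ht
  have h0 : ∀ n : ℤ, gaussTerm k z s t (2 * n) = 2 ^ k * gaussTerm k (2 * z) (s / 2) (4 * t) n := by
    intro n
    simp only [gaussTerm]
    push_cast
    rw [show 2 * (n : ℂ) + s = 2 * (n + s / 2) by ring, mul_pow]
    ring_nf
  have h1 : ∀ n : ℤ, gaussTerm k z s t (2 * n + 1) =
      2 ^ k * gaussTerm k (2 * z) ((s + 1) / 2) (4 * t) n := by
    intro n
    simp only [gaussTerm]
    push_cast
    rw [show 2 * (n : ℂ) + 1 + s = 2 * (n + (s + 1) / 2) by ring, mul_pow]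
    ring_nf
  have he : HasSum (fun n : ℤ => gaussTerm k z s t (2 * n))
      (2 ^ k * gaussSum k (2 * z) (s / 2) (4 * t)) := by
    simp only [h0]; exact (summable_gaussTerm k _ _ ht4).hasSum.mul_left _
  have ho : HasSum (fun n : ℤ => gaussTerm k z s t (2 * n + 1))
      (2 ^ k * gaussSum k (2 * z) ((s + 1) / 2) (4 * t)) := by
    simp only [h1]; exact (summable_gaussTerm k _ _ ht4).hasSum.mul_left _
  rw [mul_add]
  exact (intEvenOdd.hasSum_iff.mp (HasSum.sum (f := gaussTerm k z s t ∘ intEvenOdd) he ho)).tsum_eq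

/-! #### The product formula -/

lemma hasSum_fun_congr {ι : Type*} {f g : ι → ℂ} {a : ℂ} (h : ∀ i, f i = g i) :
    HasSum f a ↔ HasSum g a := by rw [funext h]

/-- The pairs of integers `(m, n)`, written as `(i + j, i - j)` or `(i + j + 1, i - j)`. -/
def pairEquiv : (ℤ × ℤ) ⊕ (ℤ × ℤ) ≃ ℤ × ℤ where
  toFun := Sum.elim (fun p => (p.1 + p.2, p.1 - p.2)) (fun p => (p.1 + p.2 + 1, p.1 - p.2))
  invFun p := if (p.1 - p.2) % 2 = 0 then Sum.inl (p.2 + (p.1 - p.2) / 2, (p.1 - p.2) / 2)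
    else Sum.inr (p.2 + (p.1 - p.2) / 2, (p.1 - p.2) / 2)
  left_inv := by
    rintro (⟨i, j⟩ | ⟨i, j⟩)
    · refine (if_pos (by change (i + j - (i - j)) % 2 = 0; omega)).trans ?_
      refine congrArg Sum.inl (Prod.ext ?_ ?_)
      · change i - j + (i + j - (i - j)) / 2 = i; omega
      · change (i + j - (i - j)) / 2 = j; omega
    · refine (if_neg (by change ¬ (i + j + 1 - (i - j)) % 2 = 0; omega)).trans ?_
      refine congrArg Sum.inr (Prod.ext ?_ ?_)
      · change i - j + (i + j + 1 - (i - j)) / 2 = i; omega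
      · change (i + j + 1 - (i - j)) / 2 = j; omega
  right_inv := by
    rintro ⟨m, n⟩
    dsimp only
    split_ifs with h
    · simp only [Sum.elim_inl]; refine Prod.ext ?_ ?_ <;> (dsimp only; omega)
    · simp only [Sum.elim_inr]; refine Prod.ext ?_ ?_ <;> (dsimp only; omega)

/-- The weights are kept apart from the weight-zero terms so that products with different k, l
become sums over the same family and can be combined linearly. -/
lemma hasSum_gaussSum_mul (k l : ℕ) (z z' : ℂ) (s s' : ℝ) {t : ℂ} (ht : 0 < t.im) :
    HasSum (fun p : ℤ × ℤ => ((p.1 : ℂ) + s) ^ k * ((p.2 : ℂ) + s') ^ l *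
        (gaussTerm 0 z s t p.1 * gaussTerm 0 z' s' t p.2))
      (gaussSum k z s t * gaussSum l z' s' t) := by
  have h := (summable_mul_of_summable_norm (summable_gaussTerm_norm k z s ht)
    (summable_gaussTerm_norm l z' s' ht)).hasSum
  rw [← tsum_mul_tsum_of_summable_norm (summable_gaussTerm_norm k z s ht)
    (summable_gaussTerm_norm l z' s' ht)] at h
  refine (hasSum_fun_congr fun p => ?_).mpr h
  simp only [gaussTerm]; ring

/-- The parallelogram law: (x + y)² + (x - y)² = 2x² + 2y². -/
lemma gaussTerm_mul (z z' : ℂ) (s s' : ℝ) (t : ℂ) (i j : ℤ) :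
    gaussTerm 0 z s t (i + j) * gaussTerm 0 z' s' t (i - j) =
      gaussTerm 0 (z + z') ((s + s') / 2) (2 * t) i *
        gaussTerm 0 (z - z') ((s - s') / 2) (2 * t) j := by
  simp only [gaussTerm, pow_zero, one_mul, ← exp_add]
  push_cast
  ring_nf

/-- A sum over all pairs `(m, n)` as two sums over pairs `(i, j)`. -/
lemma hasSum_pair {f : ℂ → ℂ → ℂ} {z z' : ℂ} {s s' : ℝ} {t A B : ℂ}
    (h0 : HasSum (fun p : ℤ × ℤ =>
      f (((p.1 : ℂ) + ((s + s') / 2 : ℝ)) + ((p.2 : ℂ) + ((s - s') / 2 : ℝ)))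
        (((p.1 : ℂ) + ((s + s') / 2 : ℝ)) - ((p.2 : ℂ) + ((s - s') / 2 : ℝ))) *
      (gaussTerm 0 (z + z') ((s + s') / 2) (2 * t) p.1 *
        gaussTerm 0 (z - z') ((s - s') / 2) (2 * t) p.2)) A)
    (h1 : HasSum (fun p : ℤ × ℤ =>
      f (((p.1 : ℂ) + ((s + s' + 1) / 2 : ℝ)) + ((p.2 : ℂ) + ((s - s' + 1) / 2 : ℝ)))
        (((p.1 : ℂ) + ((s + s' + 1) / 2 : ℝ)) - ((p.2 : ℂ) + ((s - s' + 1) / 2 : ℝ))) *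
      (gaussTerm 0 (z + z') ((s + s' + 1) / 2) (2 * t) p.1 *
        gaussTerm 0 (z - z') ((s - s' + 1) / 2) (2 * t) p.2)) B) :
    HasSum (fun p : ℤ × ℤ => f ((p.1 : ℂ) + s) ((p.2 : ℂ) + s') *
      (gaussTerm 0 z s t p.1 * gaussTerm 0 z' s' t p.2)) (A + B) := by
  refine pairEquiv.hasSum_iff.mp (HasSum.sum ?_ ?_)
  · refine (hasSum_fun_congr fun p => ?_).mpr h0
    simp only [pairEquiv, Function.comp_apply, Equiv.coe_fn_mk, Sum.elim_inl, gaussTerm_mul]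
    push_cast
    ring_nf
  -- Pairs with m - n odd are brought to the previous case by moving the extra 1 from the index into
  -- the shift s.
  · refine (hasSum_fun_congr fun p => ?_).mpr h1
    have := gaussTerm_mul z z' (s + 1) s' t p.1 p.2
    have e : gaussTerm 0 z s t (p.1 + p.2 + 1) = gaussTerm 0 z (s + 1) t (p.1 + p.2) := by
      simp only [gaussTerm]; push_cast; ring_nf
    simp only [pairEquiv, Function.comp_apply, Equiv.coe_fn_mk, Sum.elim_inr, e, this]
    push_cast
    ring_nf

/-- The product formula with weight `1`. -/
lemma gaussSum_mul_zero_zero (z z' : ℂ) (s s' : ℝ) {t : ℂ} (ht : 0 < t.im) :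
    gaussSum 0 z s t * gaussSum 0 z' s' t =
      gaussSum 0 (z + z') ((s + s') / 2) (2 * t) * gaussSum 0 (z - z') ((s - s') / 2) (2 * t) +
      gaussSum 0 (z + z') ((s + s' + 1) / 2) (2 * t) *
        gaussSum 0 (z - z') ((s - s' + 1) / 2) (2 * t) := by
  have ht2 : 0 < (2 * t).im := by simpa using ht
  have h := hasSum_gaussSum_mul 0 0 z z' s s' ht
  refine h.unique (hasSum_pair (f := fun a b => a ^ 0 * b ^ 0) ?_ ?_)
  · exact hasSum_gaussSum_mul 0 0 _ _ _ _ ht2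
  · exact hasSum_gaussSum_mul 0 0 _ _ _ _ ht2

/-- The product formula with weight `a - b`. -/
lemma gaussSum_bracket_one (z z' : ℂ) (s s' : ℝ) {t : ℂ} (ht : 0 < t.im) :
    gaussSum 1 z s t * gaussSum 0 z' s' t - gaussSum 0 z s t * gaussSum 1 z' s' t =
      2 * (gaussSum 0 (z + z') ((s + s') / 2) (2 * t) *
        gaussSum 1 (z - z') ((s - s') / 2) (2 * t)) +
      2 * (gaussSum 0 (z + z') ((s + s' + 1) / 2) (2 * t) *
        gaussSum 1 (z - z') ((s - s' + 1) / 2) (2 * t)) := by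
  have ht2 : 0 < (2 * t).im := by simpa using ht
  have h := (hasSum_gaussSum_mul 1 0 z z' s s' ht).sub (hasSum_gaussSum_mul 0 1 z z' s s' ht)
  refine HasSum.unique (f := fun p : ℤ × ℤ => (((p.1 : ℂ) + s) - ((p.2 : ℂ) + s')) *
      (gaussTerm 0 z s t p.1 * gaussTerm 0 z' s' t p.2)) ?_
    (hasSum_pair (f := fun a b => a - b) ?_ ?_)
  · exact (hasSum_fun_congr fun p => by ring).mpr (h)
  · exact (hasSum_fun_congr fun p => by ring).mpr
      ((hasSum_gaussSum_mul 0 1 (z + z') (z - z') _ _ ht2).mul_left 2)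
  · exact (hasSum_fun_congr fun p => by ring).mpr
      ((hasSum_gaussSum_mul 0 1 (z + z') (z - z') _ _ ht2).mul_left 2)

/-- The product formula with weight `a² - b²`. -/
lemma gaussSum_bracket_two (z z' : ℂ) (s s' : ℝ) {t : ℂ} (ht : 0 < t.im) :
    gaussSum 2 z s t * gaussSum 0 z' s' t - gaussSum 0 z s t * gaussSum 2 z' s' t =
      4 * (gaussSum 1 (z + z') ((s + s') / 2) (2 * t) *
        gaussSum 1 (z - z') ((s - s') / 2) (2 * t)) +
      4 * (gaussSum 1 (z + z') ((s + s' + 1) / 2) (2 * t) *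
        gaussSum 1 (z - z') ((s - s' + 1) / 2) (2 * t)) := by
  have ht2 : 0 < (2 * t).im := by simpa using ht
  have h := (hasSum_gaussSum_mul 2 0 z z' s s' ht).sub (hasSum_gaussSum_mul 0 2 z z' s s' ht)
  refine HasSum.unique (f := fun p : ℤ × ℤ => (((p.1 : ℂ) + s) ^ 2 - ((p.2 : ℂ) + s') ^ 2) *
      (gaussTerm 0 z s t p.1 * gaussTerm 0 z' s' t p.2)) ?_
    (hasSum_pair (f := fun a b => a ^ 2 - b ^ 2) ?_ ?_)
  · exact (hasSum_fun_congr fun p => by ring).mpr (h)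
  · exact (hasSum_fun_congr fun p => by ring).mpr
      ((hasSum_gaussSum_mul 1 1 (z + z') (z - z') _ _ ht2).mul_left 4)
  · exact (hasSum_fun_congr fun p => by ring).mpr
      ((hasSum_gaussSum_mul 1 1 (z + z') (z - z') _ _ ht2).mul_left 4)

/-- The product formula with weight `a⁴ - 6 a² b² + b⁴`. -/
lemma gaussSum_bracket_four (z z' : ℂ) (s s' : ℝ) {t : ℂ} (ht : 0 < t.im) :
    gaussSum 4 z s t * gaussSum 0 z' s' t - 6 * (gaussSum 2 z s t * gaussSum 2 z' s' t) +
        gaussSum 0 z s t * gaussSum 4 z' s' t =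
      -4 * (gaussSum 4 (z + z') ((s + s') / 2) (2 * t) * gaussSum 0 (z - z') ((s - s') / 2) (2 * t)
        - 6 * (gaussSum 2 (z + z') ((s + s') / 2) (2 * t) *
          gaussSum 2 (z - z') ((s - s') / 2) (2 * t)) +
        gaussSum 0 (z + z') ((s + s') / 2) (2 * t) * gaussSum 4 (z - z') ((s - s') / 2) (2 * t)) +
      -4 * (gaussSum 4 (z + z') ((s + s' + 1) / 2) (2 * t) *
          gaussSum 0 (z - z') ((s - s' + 1) / 2) (2 * t)
        - 6 * (gaussSum 2 (z + z') ((s + s' + 1) / 2) (2 * t) *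
          gaussSum 2 (z - z') ((s - s' + 1) / 2) (2 * t)) +
        gaussSum 0 (z + z') ((s + s' + 1) / 2) (2 * t) *
          gaussSum 4 (z - z') ((s - s' + 1) / 2) (2 * t)) := by
  have ht2 : 0 < (2 * t).im := by simpa using ht
  have h (z z' : ℂ) (s s' : ℝ) {t : ℂ} (ht : 0 < t.im) :=
    ((hasSum_gaussSum_mul 4 0 z z' s s' ht).sub
      ((hasSum_gaussSum_mul 2 2 z z' s s' ht).mul_left 6)).add
        (hasSum_gaussSum_mul 0 4 z z' s s' ht)
  -- The weight is Re (a + ib)⁴. For a = x + y, b = x - y one has a + ib = (1 + i)(x - iy) and (1 +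
  -- i)⁴ = -4, so it reproduces itself up to the factor -4.
  refine HasSum.unique (f := fun p : ℤ × ℤ => (((p.1 : ℂ) + s) ^ 4 -
      6 * (((p.1 : ℂ) + s) ^ 2 * ((p.2 : ℂ) + s') ^ 2) + ((p.2 : ℂ) + s') ^ 4) *
      (gaussTerm 0 z s t p.1 * gaussTerm 0 z' s' t p.2)) ?_
    (hasSum_pair (f := fun a b => a ^ 4 - 6 * (a ^ 2 * b ^ 2) + b ^ 4) ?_ ?_)
  · exact (hasSum_fun_congr fun p => by ring).mpr (h z z' s s' ht)
  · exact (hasSum_fun_congr fun p => by ring).mpr ((h (z + z') (z - z') _ _ ht2).mul_left (-4))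
  · exact (hasSum_fun_congr fun p => by ring).mpr ((h (z + z') (z - z') _ _ ht2).mul_left (-4))

/-! ### Behaviour as Im t → ∞ -/

lemma tsum_norm_gaussTerm_le (k : ℕ) {z : ℂ} (hz : z.im = 0) (s : ℝ) {δ : ℝ}
    (hδ : ∀ n : ℤ, ((n : ℝ) + s) ^ k ≠ 0 → δ ≤ ((n : ℝ) + s) ^ 2) {t : ℂ} (ht : 1 ≤ t.im) :
    ∑' n, ‖gaussTerm k z s t n‖ ≤
      Real.exp (-(2 * π) * δ * (t.im - 1)) * ∑' n, ‖gaussTerm k z s I n‖ := by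
  have h1 := summable_gaussTerm_norm k z s (t := t) (by linarith)
  have h2 := summable_gaussTerm_norm k z s (t := I) (by simp)
  rw [← tsum_mul_left]
  refine h1.tsum_le_tsum (fun n => ?_) (h2.mul_left _)
  rw [norm_gaussTerm, norm_gaussTerm, hz]
  -- Terms of weight zero drop out, so only exponents at least δ contribute. As 0⁰ = 1, nothing
  -- drops out when k = 0.
  by_cases h : ((n : ℝ) + s) ^ k = 0
  · rw [← abs_pow, h]; simp
  · have := hδ n h
    rw [mul_left_comm, ← Real.exp_add]
    refine mul_le_mul_of_nonneg_left (Real.exp_le_exp.mpr ?_) (by positivity)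
    simp only [I_im, mul_zero, add_zero, one_mul]
    have h3 : δ * (t.im - 1) ≤ ((n : ℝ) + s) ^ 2 * (t.im - 1) :=
      mul_le_mul_of_nonneg_right this (by linarith)
    nlinarith [Real.pi_pos]

lemma isBigO_tsum_norm_gaussTerm (k : ℕ) {z : ℂ} (hz : z.im = 0) (s : ℝ) {δ : ℝ}
    (hδ : ∀ n : ℤ, ((n : ℝ) + s) ^ k ≠ 0 → δ ≤ ((n : ℝ) + s) ^ 2) :
    (fun t => ∑' n, ‖gaussTerm k z s t n‖) =O[comap im atTop]
      fun t : ℂ => Real.exp (-(2 * π) * δ * t.im) := by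
  refine Asymptotics.IsBigO.of_bound
    (Real.exp (2 * π * δ) * ∑' n, ‖gaussTerm k z s I n‖) ?_
  have : ∀ᶠ t : ℂ in comap im atTop, 1 ≤ t.im := (eventually_ge_atTop 1).comap im
  filter_upwards [this] with t ht
  have h := tsum_norm_gaussTerm_le k hz s hδ ht
  rw [Real.norm_eq_abs, abs_of_nonneg (tsum_nonneg fun n => norm_nonneg _),
    Real.norm_eq_abs, Real.abs_exp]
  refine h.trans_eq ?_
  rw [show -(2 * π) * δ * (t.im - 1) = 2 * π * δ + -(2 * π) * δ * t.im by ring, Real.exp_add]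
  ring

/-- Exponential decay of `gaussSum` when its terms with small exponent vanish. -/
lemma isBigO_gaussSum (k : ℕ) {z : ℂ} (hz : z.im = 0) (s : ℝ) {δ : ℝ}
    (hδ : ∀ n : ℤ, ((n : ℝ) + s) ^ k ≠ 0 → δ ≤ ((n : ℝ) + s) ^ 2) :
    gaussSum k z s =O[comap im atTop] fun t : ℂ => Real.exp (-(2 * π) * δ * t.im) := by
  refine Asymptotics.IsBigO.trans ?_ (isBigO_tsum_norm_gaussTerm k hz s hδ)
  refine Asymptotics.IsBigO.of_bound 1 ?_
  have : ∀ᶠ t : ℂ in comap im atTop, 1 ≤ t.im := (eventually_ge_atTop 1).comap im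
  filter_upwards [this] with t ht
  rw [one_mul, Real.norm_eq_abs, abs_of_nonneg (tsum_nonneg fun n => norm_nonneg _)]
  exact norm_tsum_le_tsum_norm (summable_gaussTerm_norm k z s (by linarith))

lemma tendsto_exp_neg_im {δ : ℝ} (hδ : 0 < δ) :
    Tendsto (fun t : ℂ => Real.exp (-(2 * π) * δ * t.im)) (comap im atTop) (𝓝 0) := by
  refine Real.tendsto_exp_atBot.comp ?_
  refine Tendsto.const_mul_atTop_of_neg ?_ tendsto_comap
  nlinarith [Real.pi_pos]

lemma one_le_sq_of_int {k : ℕ} (hk : k ≠ 0) (n : ℤ) (h : ((n : ℝ) + (0 : ℝ)) ^ k ≠ 0) :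
    (1 : ℝ) ≤ ((n : ℝ) + (0 : ℝ)) ^ 2 := by
  rw [add_zero] at h ⊢
  have hn : n ≠ 0 := by rintro rfl; simp [hk] at h
  rw [one_le_sq_iff_one_le_abs, ← Int.cast_abs]
  exact_mod_cast Int.one_le_abs hn

/-- The term n = 0 equals 1. The others are dominated by the terms of weight |n| ≥ 1, whose sum
decays exponentially. -/
lemma tendsto_gaussSum_zero_one {z : ℂ} (hz : z.im = 0) :
    Tendsto (gaussSum 0 z 0) (comap im atTop) (𝓝 1) := by
  rw [tendsto_iff_norm_sub_tendsto_zero]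
  have h0 := (isBigO_tsum_norm_gaussTerm 1 hz 0
    (one_le_sq_of_int one_ne_zero)).trans_tendsto (tendsto_exp_neg_im one_pos)
  refine squeeze_zero' (Eventually.of_forall fun _ => norm_nonneg _) ?_ h0
  have : ∀ᶠ t : ℂ in comap im atTop, 1 ≤ t.im := (eventually_ge_atTop 1).comap im
  filter_upwards [this] with t ht
  have ht0 : 0 < t.im := by linarith
  have h1 : HasSum (fun n : ℤ => if n = 0 then (1 : ℂ) else 0) 1 := hasSum_ite_eq 0 1
  have h2 := (summable_gaussTerm 0 z 0 ht0).hasSum.sub h1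
  change ‖(∑' n, gaussTerm 0 z 0 t n) - 1‖ ≤ _
  rw [← h2.tsum_eq]
  refine tsum_of_norm_bounded (summable_gaussTerm_norm 1 z 0 ht0).hasSum fun n => ?_
  by_cases hn : n = 0
  · subst hn; simp [gaussTerm]
  · rw [if_neg hn, sub_zero, norm_gaussTerm, norm_gaussTerm, pow_zero, one_mul, pow_one]
    refine le_mul_of_one_le_left (Real.exp_pos _).le ?_
    rw [add_zero, ← Int.cast_abs]
    exact_mod_cast Int.one_le_abs hn

/-- Adding 1/2 to t multiplies a term by exp(πi(n + s)²). Since n² ≡ n mod 2 this phase is affine in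
n, that is, a translation of z. -/
lemma gaussSum_add_half (k : ℕ) (z : ℂ) (s : ℝ) (t : ℂ) :
    gaussSum k z s (t + 1 / 2) =
      cexp (-(π * I * (s ^ 2 + s))) * gaussSum k (z + s + 1 / 2) s t := by
  rw [gaussSum, gaussSum, ← tsum_mul_left]
  refine tsum_congr fun n => ?_
  obtain ⟨m, hm⟩ : ∃ m : ℤ, n * (n - 1) = 2 * m := by
    obtain ⟨m, hm⟩ := Int.even_mul_pred_self n
    exact ⟨m, by rw [hm]; ring⟩
  have hm' : (n : ℂ) * (n - 1) = 2 * m := by exact_mod_cast hm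
  have h1 : cexp (m * (2 * π * I)) = 1 := exp_int_mul_two_pi_mul_I m
  rw [gaussTerm, gaussTerm, mul_left_comm, ← exp_add,
    show 2 * (π : ℂ) * I * ((t + 1 / 2) * ((n : ℂ) + s) ^ 2 + ((n : ℂ) + s) * z) =
      -(π * I * (s ^ 2 + s)) +
        2 * π * I * (t * ((n : ℂ) + s) ^ 2 + ((n : ℂ) + s) * (z + s + 1 / 2)) +
        m * (2 * π * I) by linear_combination π * I * hm', exp_add _ ((m : ℂ) * _), h1, mul_one]

end SixVertex

/-! ### The triple product -/

namespace SixVertex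

open Complex Filter Topology

/-- The infinite product `∏_{k ≥ 0} (1 - a q^k)`. -/
noncomputable def qPoch (a q : ℂ) : ℂ := ∏' k : ℕ, (1 - a * q ^ k)

lemma summable_qPoch (a : ℂ) {q : ℂ} (hq : ‖q‖ < 1) : Summable fun k : ℕ => ‖-(a * q ^ k)‖ := by
  simpa [norm_mul, norm_pow] using (summable_geometric_of_lt_one (norm_nonneg q) hq).mul_left ‖a‖

lemma multipliable_qPoch (a : ℂ) {q : ℂ} (hq : ‖q‖ < 1) :
    Multipliable fun k : ℕ => (1 - a * q ^ k) := by
  simpa [sub_eq_add_neg] using multipliable_one_add_of_summable (summable_qPoch a hq)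

lemma qPoch_ne_zero {a q : ℂ} (hq : ‖q‖ < 1) (h : ∀ k : ℕ, 1 - a * q ^ k ≠ 0) :
    qPoch a q ≠ 0 := by
  have := tprod_one_add_ne_zero_of_summable (f := fun k : ℕ => -(a * q ^ k))
    (by simpa [sub_eq_add_neg] using h) (summable_qPoch a hq)
  simpa [qPoch, sub_eq_add_neg] using this

lemma one_sub_ne_zero_of_norm_lt {x : ℂ} (h : ‖x‖ < 1) : 1 - x ≠ 0 := by
  intro h0
  rw [← sub_eq_zero.mp h0] at h
  simp at h

lemma qPoch_ne_zero_of_norm_lt {a q : ℂ} (ha : ‖a‖ < 1) (hq : ‖q‖ < 1) : qPoch a q ≠ 0 :=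
  qPoch_ne_zero hq fun k => one_sub_ne_zero_of_norm_lt <| by
    rw [norm_mul, norm_pow]
    exact lt_of_le_of_lt (mul_le_of_le_one_right (norm_nonneg a)
      (pow_le_one₀ (norm_nonneg q) hq.le)) ha

lemma qPoch_mul_qPoch_neg (a : ℂ) {q : ℂ} (hq : ‖q‖ < 1) :
    qPoch a q * qPoch (-a) q = qPoch (a ^ 2) (q ^ 2) := by
  rw [qPoch, qPoch, ← (multipliable_qPoch a hq).tprod_mul (multipliable_qPoch (-a) hq), qPoch]
  exact tprod_congr fun k => by ring

lemma norm_sq_lt_one {q : ℂ} (hq : ‖q‖ < 1) : ‖q ^ 2‖ < 1 := by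
  rw [norm_pow]; exact pow_lt_one₀ (norm_nonneg q) hq two_ne_zero

lemma qPoch_even_mul_odd (a : ℂ) {q : ℂ} (hq : ‖q‖ < 1) :
    qPoch a (q ^ 2) * qPoch (a * q) (q ^ 2) = qPoch a q := by
  have he : ∀ k : ℕ, 1 - a * (q ^ 2) ^ k = 1 - a * q ^ (2 * k) := fun k => by rw [← pow_mul]
  have ho : ∀ k : ℕ, 1 - a * q * (q ^ 2) ^ k = 1 - a * q ^ (2 * k + 1) := fun k => by
    rw [← pow_mul]; ring
  have h1 := multipliable_qPoch a (norm_sq_lt_one hq)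
  have h2 := multipliable_qPoch (a * q) (norm_sq_lt_one hq)
  rw [funext he] at h1
  rw [funext ho] at h2
  have h := tprod_even_mul_odd (f := fun k : ℕ => 1 - a * q ^ k) h1 h2
  exact (congrArg₂ (· * ·) (tprod_congr he) (tprod_congr ho)).trans h

lemma qPoch_eq_mul (a : ℂ) {q : ℂ} (hq : ‖q‖ < 1) :
    qPoch a q = (1 - a) * qPoch (a * q) q := by
  have h : ∀ k : ℕ, 1 - a * q * q ^ k = 1 - a * q ^ (k + 1) := fun k => by ring
  have hm := multipliable_qPoch (a * q) hq
  rw [funext h] at hm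
  have := tprod_eq_zero_mul' (f := fun k : ℕ => 1 - a * q ^ k) hm
  rw [pow_zero, mul_one] at this
  exact this.trans (congrArg _ (tprod_congr h).symm)

/-- `1 / ((1 - q) ⋯ (1 - q^k))`, and `0` for negative `k`. -/
noncomputable def invQFact (q : ℂ) (k : ℤ) : ℂ :=
  if k < 0 then 0 else (∏ i ∈ Finset.range k.toNat, (1 - q * q ^ i))⁻¹

lemma one_sub_mul_pow_ne_zero {q : ℂ} (hq : ‖q‖ < 1) (i : ℕ) : 1 - q * q ^ i ≠ 0 := by
  rw [← pow_succ']
  refine one_sub_ne_zero_of_norm_lt ?_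
  rw [norm_pow]; exact pow_lt_one₀ (norm_nonneg q) hq (Nat.succ_ne_zero i)

/-- The factor 1 - q^{k+1} vanishes at k = -1, so the extension by zero obeys the recursion on all
of ℤ and no boundary cases arise later. -/
lemma invQFact_eq {q : ℂ} (hq : ‖q‖ < 1) (k : ℤ) :
    invQFact q k = (1 - q ^ (k + 1)) * invQFact q (k + 1) := by
  rcases lt_trichotomy (k + 1) 0 with h | h | h
  · rw [invQFact, invQFact, if_pos (by omega), if_pos h, mul_zero]
  · rw [invQFact, if_pos (by omega), h]; simp
  · obtain ⟨n, rfl⟩ : ∃ n : ℕ, k = n := ⟨k.toNat, by omega⟩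
    have h1 : ((n : ℤ) + 1).toNat = n + 1 := by omega
    rw [invQFact, invQFact, if_neg (by omega), if_neg (by omega), h1, Int.toNat_natCast,
      Finset.prod_range_succ, mul_inv, show q ^ ((n : ℤ) + 1) = q * q ^ n by
        rw [← pow_succ']; exact_mod_cast rfl]
    have := one_sub_mul_pow_ne_zero hq n
    field_simp

lemma invQFact_zero (q : ℂ) : invQFact q 0 = 1 := by simp [invQFact]

/-- The recursion for the central q-binomial coefficients [2N, N + j] as N grows by one. It mirrors
multiplication by the new factors (1 - q^{N+1} v)(1 - v⁻¹ q^N) = 1 + q^{2N+1} - q^{N+1} v - q^N v⁻¹.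
-/
lemma invQFact_step {q : ℂ} (hq : ‖q‖ < 1) (hq0 : q ≠ 0) (N : ℕ) (j : ℤ) :
    (∏ i ∈ Finset.range (2 * (N + 1)), (1 - q * q ^ i)) *
        (invQFact q (((N + 1 : ℕ) : ℤ) + j) * invQFact q (((N + 1 : ℕ) : ℤ) - j)) =
      (∏ i ∈ Finset.range (2 * N), (1 - q * q ^ i)) *
        ((1 + q ^ (2 * N + 1)) * (invQFact q (N + j) * invQFact q (N - j)) +
          q ^ ((N : ℤ) + 1 - j) * (invQFact q (N + (j - 1)) * invQFact q (N - (j - 1))) +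
          q ^ ((N : ℤ) + 1 + j) * (invQFact q (N + (j + 1)) * invQFact q (N - (j + 1)))) := by
  have e1 : ((N + 1 : ℕ) : ℤ) + j = N + j + 1 := by push_cast; ring
  have e2 : ((N + 1 : ℕ) : ℤ) - j = N - j + 1 := by push_cast; ring
  have e3 : (N : ℤ) + (j - 1) = N + j - 1 := by ring
  have e4 : (N : ℤ) - (j - 1) = N - j + 1 := by ring
  have e5 : (N : ℤ) + (j + 1) = N + j + 1 := by ring
  have e6 : (N : ℤ) - (j + 1) = N - j - 1 := by ring
  have z1 : q ^ ((N : ℤ) + 1 - j) = q ^ ((N : ℤ) - j) * q := by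
    rw [← zpow_add_one₀ hq0, add_sub_right_comm]
  have z2 : q ^ ((N : ℤ) + 1 + j) = q ^ ((N : ℤ) + j) * q := by
    rw [← zpow_add_one₀ hq0, add_right_comm]
  have z3 : q ^ (2 * N) = q ^ ((N : ℤ) + j) * q ^ ((N : ℤ) - j) := by
    rw [← zpow_add₀ hq0, ← zpow_natCast]; congr 1; push_cast; ring
  have r1 := invQFact_eq hq (N + j)
  have r2 := invQFact_eq hq (N - j)
  have r3 := invQFact_eq hq (N + j - 1)
  have r4 := invQFact_eq hq (N - j - 1)
  rw [sub_add_cancel] at r3 r4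
  rw [zpow_add_one₀ hq0] at r1 r2
  rw [e1, e2, e3, e4, e5, e6, z1, z2, r3, r4, r1, r2,
    show 2 * (N + 1) = 2 * N + 1 + 1 by ring, Finset.prod_range_succ, Finset.prod_range_succ,
    pow_succ q (2 * N), z3]
  generalize q ^ ((N : ℤ) + j) = X
  generalize q ^ ((N : ℤ) - j) = Y
  ring

/-- The finite form of the triple product. -/
lemma hasSum_finite_triple {q v : ℂ} (hq : ‖q‖ < 1) (hq0 : q ≠ 0) (hv : v ≠ 0) {E : ℤ → ℂ}
    (hE : ∀ j, E (j + 1) = -(q ^ (j + 1) * v) * E j) (N : ℕ) :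
    HasSum (fun j : ℤ => E j * ((∏ i ∈ Finset.range (2 * N), (1 - q * q ^ i)) *
        (invQFact q (N + j) * invQFact q (N - j))))
      (E 0 * ∏ k ∈ Finset.range N, ((1 - q * v * q ^ k) * (1 - v⁻¹ * q ^ k))) := by
  induction N with
  | zero =>
    -- For N = 0 one of the two reciprocal factorials has a negative argument unless j = 0.
    have := hasSum_single (f := fun j : ℤ =>
      E j * ((∏ i ∈ Finset.range (2 * 0), (1 - q * q ^ i)) *
        (invQFact q ((0 : ℕ) + j) * invQFact q ((0 : ℕ) - j)))) 0 (fun j hj => by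
        rcases lt_or_gt_of_ne hj with h | h
        · rw [invQFact, if_pos (by simpa using h)]; simp
        · rw [mul_comm (invQFact _ _), invQFact, if_pos (by simpa using h)]; simp)
    simpa [invQFact_zero] using this
  | succ N ih =>
    -- The factors v and v⁻¹ shift the summation index by one; `hE` turns the shifted E back into a
    -- power of q times E j.
    have h1 := ((Equiv.addRight (-1 : ℤ)).hasSum_iff).mpr ih
    have h2 := ((Equiv.addRight (1 : ℤ)).hasSum_iff).mpr ih
    have h := ((ih.mul_left (1 + q ^ (2 * N + 1))).add (h1.mul_left (-(q ^ (N + 1) * v)))).add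
      (h2.mul_left (-(q ^ N * v⁻¹)))
    have hrhs : E 0 * ∏ k ∈ Finset.range (N + 1), ((1 - q * v * q ^ k) * (1 - v⁻¹ * q ^ k)) =
      (1 + q ^ (2 * N + 1)) *
        (E 0 * ∏ k ∈ Finset.range N, ((1 - q * v * q ^ k) * (1 - v⁻¹ * q ^ k)))
      + -(q ^ (N + 1) * v) *
        (E 0 * ∏ k ∈ Finset.range N, ((1 - q * v * q ^ k) * (1 - v⁻¹ * q ^ k))) +
      -(q ^ N * v⁻¹) *
        (E 0 * ∏ k ∈ Finset.range N, ((1 - q * v * q ^ k) * (1 - v⁻¹ * q ^ k))) := by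
      rw [Finset.prod_range_succ]
      have hvv : v * v⁻¹ = 1 := mul_inv_cancel₀ hv
      linear_combination (E 0 * (∏ k ∈ Finset.range N, ((1 - q * v * q ^ k) * (1 - v⁻¹ * q ^ k))) *
        q ^ (2 * N + 1)) * hvv
    rw [hrhs]
    refine (hasSum_fun_congr fun j => ?_).mpr h
    simp only [Function.comp_apply, Equiv.coe_addRight]
    have hm : E j = -(q ^ j * v) * E (j - 1) := by simpa using hE (j - 1)
    have hmm : q ^ (N + 1) * v * E (j - 1) = -(q ^ ((N : ℤ) + 1 - j)) * E j := by
      rw [hm, zpow_sub₀ hq0]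
      have : q ^ j ≠ 0 := zpow_ne_zero _ hq0
      have h2 : q ^ ((N : ℤ) + 1) = q ^ (N + 1) := by exact_mod_cast rfl
      rw [h2]
      field_simp
    have hpp : q ^ N * v⁻¹ * E (j + 1) = -(q ^ ((N : ℤ) + 1 + j)) * E j := by
      rw [hE, show (N : ℤ) + 1 + j = N + (j + 1) by ring, zpow_add₀ hq0 (N : ℤ), zpow_natCast]
      field_simp
    have hstep := invQFact_step hq hq0 N j
    rw [← sub_eq_add_neg]
    generalize (∏ i ∈ Finset.range (2 * N), (1 - q * q ^ i)) = Pn at *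
    rw [hstep]
    linear_combination (Pn * (invQFact q (↑N + (j - 1)) * invQFact q (↑N - (j - 1)))) * hmm +
      (Pn * (invQFact q (↑N + (j + 1)) * invQFact q (↑N - (j + 1)))) * hpp

/-- The triple product. -/
lemma tsum_eq_triple_product {q v : ℂ} (hq : ‖q‖ < 1) (hq0 : q ≠ 0) (hv : v ≠ 0) {E : ℤ → ℂ}
    (hE : ∀ j, E (j + 1) = -(q ^ (j + 1) * v) * E j) (hs : Summable fun j => ‖E j‖) :
    ∑' j, E j = E 0 * (qPoch q q * (qPoch (q * v) q * qPoch v⁻¹ q)) := by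
  have hL : qPoch q q ≠ 0 := qPoch_ne_zero_of_norm_lt hq hq
  have hP : Tendsto (fun n => ∏ i ∈ Finset.range n, (1 - q * q ^ i)) atTop (𝓝 (qPoch q q)) :=
    (multipliable_qPoch q hq).tendsto_prod_tprod_nat
  have hPi := hP.inv₀ hL
  obtain ⟨K, hK⟩ := hP.norm.bddAbove_range
  obtain ⟨K', hK'⟩ := hPi.norm.bddAbove_range
  have hK0 : 0 ≤ K := (norm_nonneg _).trans (hK ⟨0, rfl⟩)
  have hK'0 : 0 ≤ K' := (norm_nonneg _).trans (hK' ⟨0, rfl⟩)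
  have hr : ∀ k, ‖invQFact q k‖ ≤ K' := by
    intro k
    rw [invQFact]
    split_ifs
    · simpa using hK'0
    · exact hK' ⟨k.toNat, rfl⟩
  have hrl : ∀ u : ℕ → ℤ, Tendsto u atTop atTop →
      Tendsto (fun N => invQFact q (u N)) atTop (𝓝 (qPoch q q)⁻¹) := by
    intro u hu
    have h1 : Tendsto (fun N => (u N).toNat) atTop atTop := by
      refine tendsto_atTop.mpr fun b => ?_
      filter_upwards [hu.eventually_ge_atTop (b : ℤ)] with N hN
      omega
    refine (hPi.comp h1).congr' ?_
    filter_upwards [hu.eventually_ge_atTop 0] with N hN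
    rw [invQFact, if_neg (by omega)]; rfl
  -- Tannery's theorem: each q-binomial coefficient tends to 1 / ∏ (1 - q^k) and is bounded by K
  -- K'², uniformly in j and N.
  have hlhs : Tendsto (fun N : ℕ => ∑' j : ℤ, E j *
      ((∏ i ∈ Finset.range (2 * N), (1 - q * q ^ i)) *
        (invQFact q (N + j) * invQFact q (N - j)))) atTop
      (𝓝 (∑' j, E j * (qPoch q q * ((qPoch q q)⁻¹ * (qPoch q q)⁻¹)))) := by
    refine tendsto_tsum_of_dominated_convergence (bound := fun j => ‖E j‖ * (K * (K' * K')))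
      (hs.mul_right _) (fun j => ?_) (Eventually.of_forall fun N j => ?_)
    · refine (Tendsto.mul ?_ (Tendsto.mul (hrl _ ?_) (hrl _ ?_))).const_mul _
      · exact hP.comp (tendsto_id.const_mul_atTop' two_pos)
      · exact tendsto_atTop_add_const_right _ _ tendsto_natCast_atTop_atTop
      · exact tendsto_atTop_add_const_right _ (-j) tendsto_natCast_atTop_atTop
    · rw [norm_mul, norm_mul, norm_mul]
      have := hK ⟨2 * N, rfl⟩
      have h1 := hr (N + j)
      have h2 := hr (N - j)
      gcongr
  have hrhs : Tendsto (fun N : ℕ => E 0 * ∏ k ∈ Finset.range N,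
      ((1 - q * v * q ^ k) * (1 - v⁻¹ * q ^ k))) atTop
      (𝓝 (E 0 * (qPoch (q * v) q * qPoch v⁻¹ q))) := by
    simp only [Finset.prod_mul_distrib]
    exact ((multipliable_qPoch _ hq).tendsto_prod_tprod_nat.mul
      (multipliable_qPoch _ hq).tendsto_prod_tprod_nat).const_mul _
  have h := tendsto_nhds_unique (hlhs.congr fun N =>
    (hasSum_finite_triple hq hq0 hv hE N).tsum_eq) hrhs
  rw [tsum_mul_right] at h
  have e : qPoch q q * ((qPoch q q)⁻¹ * (qPoch q q)⁻¹) = (qPoch q q)⁻¹ := by field_simp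
  rw [e, ← div_eq_mul_inv, div_eq_iff hL] at h
  rw [h]; ring

/-- `gaussSum` as an infinite product. -/
lemma gaussSum_eq_product (z : ℂ) (s : ℝ) {t v q : ℂ} (ht : 0 < t.im)
    (hv : v = -cexp (2 * π * I * (2 * t * s + z - t))) (hqt : q = cexp (2 * π * I * (2 * t))) :
    gaussSum 0 z s t = cexp (2 * π * I * (t * s ^ 2 + s * z)) *
      (qPoch q q * (qPoch (q * v) q * qPoch v⁻¹ q)) := by
  have hq : ‖q‖ < 1 := by
    rw [hqt, Complex.norm_exp, show 2 * (π : ℂ) * I * (2 * t) = ((4 * π : ℝ) : ℂ) * (t * I) by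
      push_cast; ring, re_ofReal_mul, mul_I_re]
    rw [Real.exp_lt_one_iff]
    have := Real.pi_pos
    nlinarith [mul_pos this ht]
  have h0 : gaussTerm 0 z s t 0 = cexp (2 * π * I * (t * s ^ 2 + s * z)) := by
    simp [gaussTerm]
  rw [gaussSum, tsum_eq_triple_product hq (v := v) (by rw [hqt]; exact exp_ne_zero _)
    (by rw [hv]; exact neg_ne_zero.mpr (exp_ne_zero _)) ?_ (summable_gaussTerm_norm 0 z s ht), h0]
  -- The ratio of consecutive Gaussian terms is exp(2πi(t(2j + 2s + 1) + z)) = -q^{j+1} v, which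
  -- explains the choice of v.
  intro j
  simp only [gaussTerm, pow_zero, one_mul]
  rw [hqt, hv, ← exp_int_mul, mul_neg, neg_neg, ← exp_add, ← exp_add]
  congr 1
  push_cast
  ring

end SixVertex

/-! ### Theta constants as eta quotients -/

namespace SixVertex

open Complex Filter Topology

/-- `∑ (n + 1/2)^k q^{(n + 1/2)²}`. -/
noncomputable def thetaTwo (k : ℕ) (τ : ℂ) : ℂ := gaussSum k 0 (1 / 2) τ

/-- `∑ n^k q^{n²}`. -/
noncomputable def thetaThree (k : ℕ) (τ : ℂ) : ℂ := gaussSum k 0 0 τ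

/-- `∑ (-1)^n n^k q^{n²}`. -/
noncomputable def thetaFour (k : ℕ) (τ : ℂ) : ℂ := gaussSum k (1 / 2) 0 τ

/-- The theta function and its derivatives at `π / 4`, up to constant factors. -/
noncomputable def thetaQuarter (k : ℕ) (τ : ℂ) : ℂ := gaussSum k (3 / 4) (1 / 2) (τ / 2)

/-- The theta function and its derivatives at `0`, up to constant factors. -/
noncomputable def thetaOrigin (k : ℕ) (τ : ℂ) : ℂ := gaussSum k (1 / 2) (1 / 2) (τ / 2)

lemma nome_ne_zero (τ : ℂ) : nome τ ≠ 0 := exp_ne_zero _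

lemma norm_nome (τ : ℂ) : ‖nome τ‖ = Real.exp (-(2 * π * τ.im)) := by
  rw [nome, Complex.norm_exp, show 2 * (π : ℂ) * I * τ = ((2 * π : ℝ) : ℂ) * (τ * I) by
    push_cast; ring, re_ofReal_mul, mul_I_re, mul_neg]

lemma norm_nome_lt_one {τ : ℂ} (hτ : 0 < τ.im) : ‖nome τ‖ < 1 := by
  rw [norm_nome, Real.exp_lt_one_iff]
  have := mul_pos Real.pi_pos hτ
  linarith

lemma etaK_eq (k : ℕ) (τ : ℂ) :
    etaK k τ = cexp (2 * π * I * τ / 24) ^ k * qPoch (nome τ ^ k) (nome τ ^ k) := by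
  rw [etaK, ModularForm.eta, qPoch]
  congr 1
  · rw [Function.Periodic.qParam, ← exp_nat_mul]
    congr 1; push_cast; ring
  · refine tprod_congr fun n => ?_
    have hk : cexp (2 * π * I * (k * τ)) = nome τ ^ k := by
      rw [nome, ← exp_nat_mul]; congr 1; ring
    rw [ModularForm.eta_q_eq_pow, hk, pow_succ']

lemma etaK_ne_zero {k : ℕ} (hk : k ≠ 0) {τ : ℂ} (hτ : 0 < τ.im) : etaK k τ ≠ 0 := by
  refine ModularForm.eta_ne_zero ?_
  change 0 < ((k : ℂ) * τ).im
  rw [← ofReal_natCast, im_ofReal_mul]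
  have : (0 : ℝ) < k := by exact_mod_cast Nat.pos_of_ne_zero hk
  positivity

section Products

variable {x : ℂ}

lemma qPoch_rel_two (hx : ‖x‖ < 1) :
    qPoch (-x ^ 2) (x ^ 2) * qPoch (x ^ 2) (x ^ 2) = qPoch (x ^ 4) (x ^ 4) := by
  have := qPoch_mul_qPoch_neg (x ^ 2) (norm_sq_lt_one hx)
  rw [← pow_mul] at this
  rw [← this, mul_comm]

lemma qPoch_rel_odd (hx : ‖x‖ < 1) :
    qPoch x (x ^ 2) * qPoch (x ^ 2) (x ^ 2) = qPoch x x := by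
  have := qPoch_even_mul_odd x hx
  rwa [← pow_two] at this

lemma qPoch_rel_neg_odd (hx : ‖x‖ < 1) :
    qPoch x (x ^ 2) * qPoch (-x) (x ^ 2) * qPoch (x ^ 4) (x ^ 4) = qPoch (x ^ 2) (x ^ 2) := by
  have h := qPoch_rel_odd (norm_sq_lt_one hx)
  rw [← pow_mul] at h
  have := qPoch_mul_qPoch_neg x (norm_sq_lt_one hx)
  rw [← pow_mul] at this
  rw [this]; exact h

lemma norm_pow_lt_one (hx : ‖x‖ < 1) {k : ℕ} (hk : k ≠ 0) : ‖x ^ k‖ < 1 := by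
  rw [norm_pow]; exact pow_lt_one₀ (norm_nonneg x) hx hk

lemma qPoch_self_ne_zero (hx : ‖x‖ < 1) {k : ℕ} (hk : k ≠ 0) : qPoch (x ^ k) (x ^ k) ≠ 0 :=
  qPoch_ne_zero_of_norm_lt (norm_pow_lt_one hx hk) (norm_pow_lt_one hx hk)

end Products

variable {τ : ℂ}

/-- The triple product with base q² and v = -1/q is (q²; q²)(-q; q²)². Writing f_k = ∏ (1 - q^{kn}),
the even-odd relations give (-q; q²) = f₂² / (f₁ f₄). -/
lemma thetaThree_eq (hτ : 0 < τ.im) :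
    thetaThree 0 τ = etaK 2 τ ^ 5 / (etaK 1 τ ^ 2 * etaK 4 τ ^ 2) := by
  have hx := norm_nome_lt_one hτ
  have hx0 := nome_ne_zero τ
  have hv : -(nome τ)⁻¹ = -cexp (2 * π * I * (2 * τ * (0 : ℝ) + 0 - τ)) := by
    rw [nome, ← exp_neg]; congr 2; push_cast; ring
  have hq : nome τ ^ 2 = cexp (2 * π * I * (2 * τ)) := by
    rw [nome, ← exp_nat_mul]; congr 1; push_cast; ring
  rw [thetaThree, gaussSum_eq_product 0 0 hτ hv hq]
  simp only [etaK_eq, pow_one]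
  have e1 : nome τ ^ 2 * -(nome τ)⁻¹ = -nome τ := by field_simp
  have e2 : (-(nome τ)⁻¹)⁻¹ = -nome τ := by rw [inv_neg, inv_inv]
  rw [e1, e2]
  have h1 := qPoch_rel_odd hx
  have h2 := qPoch_rel_neg_odd hx
  have n1 := qPoch_ne_zero_of_norm_lt hx hx
  have n2 := qPoch_self_ne_zero hx two_ne_zero
  have n4 := qPoch_self_ne_zero hx four_ne_zero
  have ne := exp_ne_zero (2 * π * I * τ / 24)
  generalize nome τ = x at *
  generalize cexp (2 * π * I * τ / 24) = e at *
  have e0 : cexp (2 * π * I * (τ * ((0 : ℝ) : ℂ) ^ 2 + ((0 : ℝ) : ℂ) * 0)) = 1 := by simp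
  rw [e0, one_mul]
  generalize qPoch x (x ^ 2) = a at *
  generalize qPoch (-x) (x ^ 2) = b at *
  generalize qPoch x x = f1 at *
  generalize qPoch (x ^ 2) (x ^ 2) = f2 at *
  generalize qPoch (x ^ 4) (x ^ 4) = f4 at *
  rw [eq_div_iff (mul_ne_zero (pow_ne_zero _ (mul_ne_zero ne n1))
    (pow_ne_zero _ (mul_ne_zero (pow_ne_zero _ ne) n4)))]
  have : f1 * b * f4 = f2 ^ 2 := by rw [← h1]; linear_combination f2 * h2
  linear_combination e ^ 10 * f2 * (f1 * b * f4 + f2 ^ 2) * this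

lemma thetaFour_eq (hτ : 0 < τ.im) :
    thetaFour 0 τ = etaK 1 τ ^ 2 / etaK 2 τ := by
  have hx := norm_nome_lt_one hτ
  have hx0 := nome_ne_zero τ
  have hv : (nome τ)⁻¹ = -cexp (2 * π * I * (2 * τ * (0 : ℝ) + 1 / 2 - τ)) := by
    rw [nome, ← exp_neg, show 2 * (π : ℂ) * I * (2 * τ * (0 : ℝ) + 1 / 2 - τ) =
      π * I + -(2 * π * I * τ) by push_cast; ring, exp_add, exp_pi_mul_I]; ring
  have hq : nome τ ^ 2 = cexp (2 * π * I * (2 * τ)) := by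
    rw [nome, ← exp_nat_mul]; congr 1; push_cast; ring
  rw [thetaFour, gaussSum_eq_product _ 0 hτ hv hq]
  simp only [etaK_eq, pow_one]
  have e1 : nome τ ^ 2 * (nome τ)⁻¹ = nome τ := by field_simp
  rw [e1, inv_inv]
  have h1 := qPoch_rel_odd hx
  have n2 := qPoch_self_ne_zero hx two_ne_zero
  have ne := exp_ne_zero (2 * π * I * τ / 24)
  generalize nome τ = x at *
  generalize cexp (2 * π * I * τ / 24) = e at *
  have e0 : cexp (2 * π * I * (τ * ((0 : ℝ) : ℂ) ^ 2 + ((0 : ℝ) : ℂ) * (1 / 2))) = 1 := by simp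
  rw [e0, one_mul, ← h1]
  generalize qPoch x (x ^ 2) = a at *
  generalize qPoch (x ^ 2) (x ^ 2) = f2 at *
  field_simp

lemma thetaTwo_eq (hτ : 0 < τ.im) :
    thetaTwo 0 τ = 2 * etaK 4 τ ^ 2 / etaK 2 τ := by
  have hx := norm_nome_lt_one hτ
  have hv : (-1 : ℂ) = -cexp (2 * π * I * (2 * τ * (1 / 2 : ℝ) + 0 - τ)) := by
    rw [show 2 * (π : ℂ) * I * (2 * τ * (1 / 2 : ℝ) + 0 - τ) = 0 by push_cast; ring, exp_zero]
  have hq : nome τ ^ 2 = cexp (2 * π * I * (2 * τ)) := by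
    rw [nome, ← exp_nat_mul]; congr 1; push_cast; ring
  rw [thetaTwo, gaussSum_eq_product 0 _ hτ hv hq]
  simp only [etaK_eq]
  have h1 := qPoch_rel_two hx
  -- The first factor 1 - (-1) is the source of the coefficient 2.
  have h2 := qPoch_eq_mul (-1) (norm_sq_lt_one hx)
  rw [neg_one_mul] at h2
  have n2 := qPoch_self_ne_zero hx two_ne_zero
  have ne := exp_ne_zero (2 * π * I * τ / 24)
  have e0 : cexp (2 * π * I * (τ * ((1 / 2 : ℝ) : ℂ) ^ 2 + ((1 / 2 : ℝ) : ℂ) * 0)) =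
      cexp (2 * π * I * τ / 24) ^ 6 := by
    rw [← exp_nat_mul]; congr 1; push_cast; ring
  rw [e0, inv_neg, inv_one, mul_neg_one, h2, ← h1]
  generalize nome τ = x at *
  generalize cexp (2 * π * I * τ / 24) = e at *
  generalize qPoch (-x ^ 2) (x ^ 2) = a at *
  generalize qPoch (x ^ 2) (x ^ 2) = f2 at *
  field_simp
  ring

lemma thetaQuarter_product (z : ℂ) (hτ : 0 < τ.im) :
    gaussSum 0 z (1 / 2) (τ / 2) = cexp (2 * π * I * τ / 24) ^ 3 * cexp (π * I * z) *
      (qPoch (nome τ) (nome τ) * (qPoch (nome τ * -cexp (2 * π * I * z)) (nome τ) *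
        qPoch (-cexp (-(2 * π * I * z))) (nome τ))) := by
  have hτ2 : 0 < (τ / 2).im := by simpa using hτ
  have hv : -cexp (2 * π * I * z) =
      -cexp (2 * π * I * (2 * (τ / 2) * (1 / 2 : ℝ) + z - τ / 2)) := by
    congr 2; push_cast; ring
  have hq : nome τ = cexp (2 * π * I * (2 * (τ / 2))) := by
    rw [nome]; congr 1; ring
  rw [gaussSum_eq_product z _ hτ2 hv hq, inv_neg, ← exp_neg, ← exp_nat_mul, ← exp_add]
  congr 2
  push_cast; ring

lemma exp_three_pi_div_two : cexp (2 * π * I * (3 / 4)) = -I := by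
  rw [show 2 * (π : ℂ) * I * (3 / 4) = π * I + π / 2 * I by ring, exp_add, exp_pi_mul_I,
    exp_pi_div_two_mul_I]
  ring

lemma exp_three_pi_div_four_mul : cexp (π * I * (3 / 4)) * (1 + I) = -(Real.sqrt 2 : ℂ) := by
  have h : cexp (π * I * (3 / 4)) = -(Real.sqrt 2 : ℂ) / 2 + (Real.sqrt 2 : ℂ) / 2 * I := by
    rw [show (π : ℂ) * I * (3 / 4) = ((3 * π / 4 : ℝ) : ℂ) * I by push_cast; ring, exp_mul_I,
      ← ofReal_cos, ← ofReal_sin]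
    rw [show 3 * π / 4 = π - π / 4 by ring, Real.cos_pi_sub, Real.sin_pi_sub,
      Real.cos_pi_div_four, Real.sin_pi_div_four]
    push_cast; ring
  rw [h]
  linear_combination ((Real.sqrt 2 : ℂ) / 2) * I_sq

/-- At z = 3/4 the factors of the triple product occur in pairs (1 - i q^k)(1 + i q^k) = 1 + q^{2k},
apart from the initial 1 + i, which combines with the exponential prefactor into -√2. -/
lemma thetaQuarter_eq (hτ : 0 < τ.im) :
    thetaQuarter 0 τ = -(Real.sqrt 2 : ℂ) * (etaK 1 τ * etaK 4 τ / etaK 2 τ) := by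
  have hx := norm_nome_lt_one hτ
  have e1 : cexp (-(2 * π * I * (3 / 4))) = I := by
    rw [exp_neg, exp_three_pi_div_two, inv_neg, inv_I, neg_neg]
  rw [thetaQuarter, thetaQuarter_product _ hτ, exp_three_pi_div_two, e1, neg_neg,
    qPoch_eq_mul (-I) hx, neg_mul, mul_comm I]
  simp only [etaK_eq, pow_one]
  have h1 := qPoch_rel_two hx
  have h2 := qPoch_mul_qPoch_neg (nome τ * I) hx
  have h3 := exp_three_pi_div_four_mul
  rw [mul_pow, I_sq, mul_neg_one] at h2
  have n2 := qPoch_self_ne_zero hx two_ne_zero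
  have ne := exp_ne_zero (2 * π * I * τ / 24)
  rw [← h1, ← h2, ← h3]
  generalize nome τ = x at *
  generalize cexp (2 * π * I * τ / 24) = e at *
  generalize cexp (π * I * (3 / 4)) = e' at *
  generalize qPoch (x * I) x = a at *
  generalize qPoch (-(x * I)) x = b at *
  generalize qPoch (x ^ 2) (x ^ 2) = f2 at *
  field_simp
  ring

/-! ### The infinite product as a holomorphic function of a -/

lemma hasProdLocallyUniformlyOn_qPoch {q : ℂ} (hq : ‖q‖ < 1) (r : ℝ) :
    HasProdLocallyUniformlyOn (fun (k : ℕ) a => 1 - a * q ^ k) (fun a => qPoch a q)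
      (Metric.ball (0 : ℂ) r) := by
  have hu : Summable fun k : ℕ => r * ‖q‖ ^ k :=
    (summable_geometric_of_lt_one (norm_nonneg q) hq).mul_left _
  have hm := hu.hasProdLocallyUniformlyOn_one_add (K := Metric.ball (0 : ℂ) r)
    (f := fun k b => -(b * q ^ k)) Metric.isOpen_ball
    (Eventually.of_forall fun k b hb => by
      rw [norm_neg, norm_mul, norm_pow]
      gcongr
      exact (mem_ball_zero_iff.mp hb).le) (fun k => by fun_prop)
  simp only [qPoch, sub_eq_add_neg]
  exact hm

lemma differentiable_qPoch {q : ℂ} (hq : ‖q‖ < 1) : Differentiable ℂ fun a => qPoch a q := by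
  intro a
  have hd := (hasProdLocallyUniformlyOn_qPoch hq (‖a‖ + 1)).differentiableOn
    (Eventually.of_forall fun s => by
      simpa [Finset.prod_fn] using DifferentiableOn.finsetProd (fun _ _ => by fun_prop))
    Metric.isOpen_ball
  exact hd.differentiableAt (Metric.isOpen_ball.mem_nhds (by simp))

lemma summable_logDeriv_qPoch (a : ℂ) {q : ℂ} (hq : ‖q‖ < 1) :
    Summable fun k : ℕ => q ^ k / (1 - a * q ^ k) := by
  refine Summable.of_norm_bounded_eventually_nat
    ((summable_geometric_of_lt_one (norm_nonneg q) hq).mul_left 2) ?_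
  have h0 : Tendsto (fun k : ℕ => ‖a * q ^ k‖) atTop (𝓝 0) := by
    simpa using (summable_qPoch a hq).tendsto_atTop_zero
  filter_upwards [h0.eventually_le_const (show (0 : ℝ) < 1 / 2 by norm_num)] with k hk
  have h1 : 1 / 2 ≤ ‖1 - a * q ^ k‖ := by
    have := norm_sub_norm_le (1 : ℂ) (a * q ^ k)
    rw [norm_one] at this
    linarith
  rw [norm_div, norm_pow, div_le_iff₀ (by linarith)]
  nlinarith [pow_nonneg (norm_nonneg q) k]

lemma logDeriv_qPoch {a q : ℂ} (hq : ‖q‖ < 1) (h : ∀ k : ℕ, 1 - a * q ^ k ≠ 0) :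
    logDeriv (fun a => qPoch a q) a = -∑' k : ℕ, q ^ k / (1 - a * q ^ k) := by
  have hl : ∀ k : ℕ, logDeriv (fun b : ℂ => 1 - b * q ^ k) a = -(q ^ k / (1 - a * q ^ k)) := by
    intro k
    have hd : HasDerivAt (fun b : ℂ => 1 - b * q ^ k) (-(q ^ k)) a := by
      simpa using ((hasDerivAt_id a).mul_const (q ^ k)).const_sub 1
    rw [logDeriv_apply, hd.deriv, neg_div]
  have := logDeriv_tprod_eq_tsum (f := fun (k : ℕ) (b : ℂ) => 1 - b * q ^ k)
    (s := Metric.ball (0 : ℂ) (‖a‖ + 1)) (x := a)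
    Metric.isOpen_ball (by simp) h (fun k => by fun_prop)
    (by simp only [hl]; exact (summable_logDeriv_qPoch a hq).neg)
    ⟨_, hasProdLocallyUniformlyOn_qPoch hq _⟩ (qPoch_ne_zero hq h)
  rw [← tsum_neg]
  exact this.trans (tsum_congr hl)

/-- Jacobi's derivative formula. The factor 1 + e^{-2πiz} of the product carries the simple zero at
z = 1/2, so the derivative there is the derivative of this factor times the remaining product, in
which three copies of ∏ (1 - q^n) survive. -/
lemma thetaOrigin_eq (hτ : 0 < τ.im) : thetaOrigin 1 τ = I * etaK 1 τ ^ 3 := by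
  have hx := norm_nome_lt_one hτ
  have hτ2 : 0 < (τ / 2).im := by simpa using hτ
  set H : ℂ → ℂ := fun z => cexp (2 * π * I * τ / 24) ^ 3 * cexp (π * I * z) *
      (qPoch (nome τ) (nome τ) * (qPoch (nome τ * -cexp (2 * π * I * z)) (nome τ) *
        qPoch (-cexp (-(2 * π * I * z)) * nome τ) (nome τ))) with hH
  have hdH : DifferentiableAt ℂ H (1 / 2) := by
    have := differentiable_qPoch hx
    have h1 : DifferentiableAt ℂ (fun z : ℂ => qPoch (nome τ * -cexp (2 * π * I * z)) (nome τ))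
      (1 / 2) := (this _).comp (1 / 2 : ℂ) (by fun_prop)
    have h2 : DifferentiableAt ℂ (fun z : ℂ => qPoch (-cexp (-(2 * π * I * z)) * nome τ) (nome τ))
      (1 / 2) := (this _).comp (1 / 2 : ℂ) (by fun_prop)
    exact DifferentiableAt.mul (by fun_prop) ((differentiableAt_const _).mul (h1.mul h2))
  have heq : (fun z => gaussSum 0 z (1 / 2) (τ / 2)) =
      fun z => (1 + cexp (-(2 * π * I * z))) * H z := by
    ext z
    rw [thetaQuarter_product z hτ, qPoch_eq_mul (-cexp (-(2 * π * I * z))) hx, hH]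
    ring
  have hu : HasDerivAt (fun z : ℂ => 1 + cexp (-(2 * π * I * z)))
      (cexp (-(2 * π * I * (1 / 2))) * -(2 * π * I)) (1 / 2) := by
    have h : HasDerivAt (fun z : ℂ => -(2 * π * I * z)) (-(2 * π * I)) (1 / 2) := by
      simpa using ((hasDerivAt_id (1 / 2 : ℂ)).const_mul (2 * (π : ℂ) * I)).fun_neg
    exact h.cexp.const_add 1
  have e1 : cexp (-(2 * π * I * (1 / 2))) = -1 := by
    rw [show -(2 * (π : ℂ) * I * (1 / 2)) = -(π * I) by ring, exp_neg, exp_pi_mul_I]; norm_num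
  have e2 : cexp (2 * π * I * (1 / 2)) = -1 := by
    rw [show (2 * (π : ℂ) * I * (1 / 2)) = π * I by ring, exp_pi_mul_I]
  have e3 : cexp (π * I * (1 / 2)) = I := by
    rw [show (π : ℂ) * I * (1 / 2) = π / 2 * I by ring, exp_pi_div_two_mul_I]
  have hd := hasDerivAt_gaussSum_fst 0 (1 / 2) (1 / 2) hτ2
  rw [heq] at hd
  have h := hd.unique (hu.mul hdH.hasDerivAt)
  rw [e1] at h
  have hpi : (2 * (π : ℂ) * I) ≠ 0 := two_pi_I_ne_zero
  have h2 : thetaOrigin 1 τ = H (1 / 2) := by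
    apply mul_left_cancel₀ hpi
    rw [thetaOrigin, h]; ring
  rw [h2, hH]
  simp only [etaK_eq, e1, e2, e3, neg_neg, mul_one, one_mul, pow_one]
  ring

/-- The Lambert series of the logarithmic derivative of the theta function at `π / 4`. -/
lemma thetaQuarter_one_eq (hτ : 0 < τ.im) :
    2 * I * thetaQuarter 1 τ = thetaQuarter 0 τ *
      (1 + 4 * ∑' n : ℕ, nome τ ^ (n + 1) / (1 + nome τ ^ (2 * (n + 1)))) := by
  have hx := norm_nome_lt_one hτ
  have hτ2 : 0 < (τ / 2).im := by simpa using hτ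
  have hne : ∀ c : ℂ, ‖c‖ = 1 → ∀ k : ℕ, 1 - nome τ * c * nome τ ^ k ≠ 0 := fun c hc k =>
    one_sub_ne_zero_of_norm_lt <| by
      rw [norm_mul, norm_mul, hc, mul_one, norm_pow]
      exact lt_of_le_of_lt (mul_le_of_le_one_right (norm_nonneg _)
        (pow_le_one₀ (norm_nonneg _) hx.le)) hx
  have hq1 := (differentiable_qPoch hx (nome τ * I)).hasDerivAt
  have hq2 := (differentiable_qPoch hx (nome τ * -I)).hasDerivAt
  have hn1 := qPoch_ne_zero hx (hne I norm_I)
  have hn2 := qPoch_ne_zero hx (hne (-I) (by rw [norm_neg, norm_I]))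
  have hl1 := logDeriv_qPoch hx (hne I norm_I)
  have hl2 := logDeriv_qPoch hx (hne (-I) (by rw [norm_neg, norm_I]))
  rw [logDeriv_apply, div_eq_iff hn1] at hl1
  rw [logDeriv_apply, div_eq_iff hn2] at hl2
  rw [hl1] at hq1
  rw [hl2] at hq2
  have hw : HasDerivAt (fun z : ℂ => 2 * π * I * z) (2 * π * I) (3 / 4) := by
    simpa using (hasDerivAt_id (3 / 4 : ℂ)).const_mul (2 * (π : ℂ) * I)
  have hw2 : HasDerivAt (fun z : ℂ => π * I * z) (π * I) (3 / 4) := by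
    simpa using (hasDerivAt_id (3 / 4 : ℂ)).const_mul ((π : ℂ) * I)
  have e1 := exp_three_pi_div_two
  have e2 : cexp (-(2 * π * I * (3 / 4))) = I := by
    rw [exp_neg, exp_three_pi_div_two, inv_neg, inv_I, neg_neg]
  have hv1 : HasDerivAt (fun z : ℂ => nome τ * -cexp (2 * π * I * z))
      (nome τ * -(-I * (2 * π * I))) (3 / 4) := by
    have := (hw.cexp.fun_neg).const_mul (nome τ)
    rwa [e1] at this
  have hv2 : HasDerivAt (fun z : ℂ => nome τ * -cexp (-(2 * π * I * z)))
      (nome τ * -(I * -(2 * π * I))) (3 / 4) := by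
    have := (hw.fun_neg.cexp.fun_neg).const_mul (nome τ)
    rwa [e2] at this
  have hv3 : HasDerivAt (fun z : ℂ => 1 + cexp (-(2 * π * I * z)))
      (I * -(2 * π * I)) (3 / 4) := by
    have := hw.fun_neg.cexp.const_add 1
    rwa [e2] at this
  have c1 : HasDerivAt (fun z : ℂ => qPoch (nome τ * -cexp (2 * π * I * z)) (nome τ)) _ (3 / 4) :=
    HasDerivAt.comp (h₂ := fun a => qPoch a (nome τ)) (3 / 4 : ℂ)
      (by rw [e1, neg_neg]; exact hq1) hv1
  have c2 : HasDerivAt (fun z : ℂ => qPoch (nome τ * -cexp (-(2 * π * I * z))) (nome τ)) _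
      (3 / 4) :=
    HasDerivAt.comp (h₂ := fun a => qPoch a (nome τ)) (3 / 4 : ℂ)
      (by rw [e2]; exact hq2) hv2
  -- The prefactor e^{πiz}(1 + e^{-2πiz}) has logarithmic derivative π at z = 3/4. It yields the
  -- constant term 1, and the two infinite products yield the Lambert series.
  have hprod := (((hw2.cexp.const_mul (cexp (2 * π * I * τ / 24) ^ 3)).fun_mul hv3).fun_mul
    ((c1.fun_mul c2).const_mul (qPoch (nome τ) (nome τ))))
  have heq : (fun z => gaussSum 0 z (1 / 2) (τ / 2)) =
      fun z => (cexp (2 * π * I * τ / 24) ^ 3 * cexp (π * I * z)) *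
        (1 + cexp (-(2 * π * I * z))) * (qPoch (nome τ) (nome τ) *
        (qPoch (nome τ * -cexp (2 * π * I * z)) (nome τ) *
        qPoch (nome τ * -cexp (-(2 * π * I * z))) (nome τ))) := by
    ext z
    rw [thetaQuarter_product z hτ, qPoch_eq_mul (-cexp (-(2 * π * I * z))) hx,
      mul_comm (-cexp (-(2 * π * I * z))) (nome τ)]
    ring
  have hd := hasDerivAt_gaussSum_fst 0 (3 / 4) (1 / 2) hτ2
  rw [heq] at hd
  have h := hd.unique hprod
  have h0 : thetaQuarter 0 τ = (cexp (2 * π * I * τ / 24) ^ 3 * cexp (π * I * (3 / 4))) *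
        (1 + I) * (qPoch (nome τ) (nome τ) *
        (qPoch (nome τ * I) (nome τ) * qPoch (nome τ * -I) (nome τ))) := by
    have := congrFun heq (3 / 4)
    simp only [e1, e2, neg_neg] at this
    exact this
  have hsum : ∑' n : ℕ, nome τ ^ (n + 1) / (1 + nome τ ^ (2 * (n + 1))) =
      nome τ / 2 * (∑' k : ℕ, nome τ ^ k / (1 - nome τ * I * nome τ ^ k) +
        ∑' k : ℕ, nome τ ^ k / (1 - nome τ * -I * nome τ ^ k)) := by
    rw [← (summable_logDeriv_qPoch _ hx).tsum_add (summable_logDeriv_qPoch _ hx), ← tsum_mul_left]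
    refine tsum_congr fun k => ?_
    have h1 := hne I norm_I k
    have h2 := hne (-I) (by rw [norm_neg, norm_I]) k
    -- The partial fractions for the conjugate factors 1 ∓ i q^{k+1} combine into one Lambert term.
    have h3 : 1 + nome τ ^ (2 * (k + 1)) =
        (1 - nome τ * I * nome τ ^ k) * (1 - nome τ * -I * nome τ ^ k) := by
      rw [show nome τ ^ (2 * (k + 1)) = (nome τ * nome τ ^ k) ^ 2 by ring]
      linear_combination (nome τ * nome τ ^ k) ^ 2 * I_sq
    rw [h3, div_add_div _ _ h1 h2, mul_div_assoc']
    congr 1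
    ring
  rw [hsum]
  have hpi : (π : ℂ) ≠ 0 := ofReal_ne_zero.mpr Real.pi_ne_zero
  apply mul_left_cancel₀ hpi
  rw [show (π : ℂ) * (2 * I * thetaQuarter 1 τ) = 2 * π * I * thetaQuarter 1 τ by ring]
  refine (show 2 * π * I * thetaQuarter 1 τ = _ from h).trans ?_
  rw [h0, e1, e2, neg_neg]
  generalize (∑' k : ℕ, nome τ ^ k / (1 - nome τ * I * nome τ ^ k)) = S1
  generalize (∑' k : ℕ, nome τ ^ k / (1 - nome τ * -I * nome τ ^ k)) = S2
  generalize qPoch (nome τ * I) (nome τ) = Q1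
  generalize qPoch (nome τ * -I) (nome τ) = Q2
  generalize qPoch (nome τ) (nome τ) = Q
  generalize cexp (2 * π * I * τ / 24) ^ 3 = e
  generalize cexp (π * I * (3 / 4)) = e'
  linear_combination (-(e * e' * π * Q * Q1 * Q2) * (1 + (1 + I) * 2 * nome τ * (S1 + S2))) * I_sq

end SixVertex

/-! ### Relations between theta constants and their derivatives -/

namespace SixVertex

open Complex Filter Topology

variable {τ : ℂ}

/-! ### Derivatives in τ -/

lemma hasDerivAt_thetaTwo (k : ℕ) (hτ : 0 < τ.im) :
    HasDerivAt (thetaTwo k) (2 * π * I * thetaTwo (k + 2) τ) τ :=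
  hasDerivAt_gaussSum_snd k _ _ hτ

lemma hasDerivAt_thetaThree (k : ℕ) (hτ : 0 < τ.im) :
    HasDerivAt (thetaThree k) (2 * π * I * thetaThree (k + 2) τ) τ :=
  hasDerivAt_gaussSum_snd k _ _ hτ

lemma hasDerivAt_thetaFour (k : ℕ) (hτ : 0 < τ.im) :
    HasDerivAt (thetaFour k) (2 * π * I * thetaFour (k + 2) τ) τ :=
  hasDerivAt_gaussSum_snd k _ _ hτ

lemma hasDerivAt_gaussSum_half (k : ℕ) (z : ℂ) (s : ℝ) (hτ : 0 < τ.im) :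
    HasDerivAt (fun τ => gaussSum k z s (τ / 2)) (π * I * gaussSum (k + 2) z s (τ / 2)) τ := by
  have hτ2 : 0 < (τ / 2).im := by simpa using hτ
  have h := HasDerivAt.comp τ (hasDerivAt_gaussSum_snd k z s hτ2) ((hasDerivAt_id τ).div_const 2)
  convert! h using 1
  simp only [id]
  ring

lemma hasDerivAt_thetaQuarter (k : ℕ) (hτ : 0 < τ.im) :
    HasDerivAt (thetaQuarter k) (π * I * thetaQuarter (k + 2) τ) τ :=
  hasDerivAt_gaussSum_half k _ _ hτ

lemma hasDerivAt_thetaOrigin (k : ℕ) (hτ : 0 < τ.im) :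
    HasDerivAt (thetaOrigin k) (π * I * thetaOrigin (k + 2) τ) τ :=
  hasDerivAt_gaussSum_half k _ _ hτ

/-! ### Parity and reflection at the points z = 1/4, 1/2, 3/4 -/

lemma exp_two_pi_I_mul_half : cexp (2 * π * I * ((1 / 2 : ℝ) : ℂ)) = -1 := by
  rw [show 2 * (π : ℂ) * I * ((1 / 2 : ℝ) : ℂ) = π * I by push_cast; ring, exp_pi_mul_I]

lemma exp_two_pi_I_mul_quarter : cexp (2 * π * I * ((1 / 4 : ℝ) : ℂ)) = I := by
  rw [show 2 * (π : ℂ) * I * ((1 / 4 : ℝ) : ℂ) = π / 2 * I by push_cast; ring,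
    exp_pi_div_two_mul_I]

lemma gaussSum_neg_half_zero (k : ℕ) (t : ℂ) :
    gaussSum k (-(1 / 2)) 0 t = gaussSum k (1 / 2) 0 t := by
  have h := gaussSum_add_one_left k (-(1 / 2)) 0 t
  rw [show -(1 / 2 : ℂ) + 1 = 1 / 2 by norm_num] at h
  rw [h]; simp

lemma gaussSum_half_zero_of_odd {k : ℕ} (hk : Odd k) (t : ℂ) : gaussSum k (1 / 2) 0 t = 0 := by
  have h := gaussSum_neg k (1 / 2) 0 t
  rw [hk.neg_one_pow, neg_zero, gaussSum_neg_half_zero] at h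
  linear_combination h / 2

lemma gaussSum_neg_half_half (k : ℕ) (t : ℂ) :
    gaussSum k (-(1 / 2)) (1 / 2) t = -gaussSum k (1 / 2) (1 / 2) t := by
  have h := gaussSum_add_one_left k (-(1 / 2)) (1 / 2) t
  rw [show -(1 / 2 : ℂ) + 1 = 1 / 2 by norm_num, exp_two_pi_I_mul_half] at h
  rw [h]; ring

/-- The phase exp(πi(n + 1/2)) changes sign under n + 1/2 ↦ -(n + 1/2), whereas an even weight does
not, so terms cancel in pairs. -/
lemma gaussSum_half_half_of_even {k : ℕ} (hk : Even k) (t : ℂ) :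
    gaussSum k (1 / 2) (1 / 2) t = 0 := by
  have h := gaussSum_neg k (1 / 2) (1 / 2) t
  have h2 := gaussSum_add_one_right k (-(1 / 2)) (-(1 / 2)) t
  rw [show -(1 / 2 : ℝ) + 1 = 1 / 2 by norm_num] at h2
  rw [hk.neg_one_pow, ← h2, gaussSum_neg_half_half] at h
  linear_combination -h / 2

lemma gaussSum_quarter_half (k : ℕ) (t : ℂ) :
    gaussSum k (1 / 4) (1 / 2) t = -((-1) ^ k * gaussSum k (3 / 4) (1 / 2) t) := by
  have h := gaussSum_neg k (3 / 4) (1 / 2) t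
  have h1 := gaussSum_add_one_left k (-(3 / 4)) (1 / 2) t
  have h2 := gaussSum_add_one_right k (-(3 / 4)) (-(1 / 2)) t
  rw [show -(3 / 4 : ℂ) + 1 = 1 / 4 by norm_num, exp_two_pi_I_mul_half] at h1
  rw [show -(1 / 2 : ℝ) + 1 = 1 / 2 by norm_num] at h2
  rw [h1, h2, h]; ring

lemma etaK_mul (k m : ℕ) (τ : ℂ) : etaK k (m * τ) = etaK (k * m) τ := by
  rw [etaK, etaK, ← mul_assoc]; push_cast; rfl

lemma im_ofNat_mul {m : ℕ} (hm : m ≠ 0) (hτ : 0 < τ.im) : 0 < ((m : ℂ) * τ).im := by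
  rw [← ofReal_natCast, im_ofReal_mul]
  have : (0 : ℝ) < m := by exact_mod_cast Nat.pos_of_ne_zero hm
  positivity

lemma gaussSum_one_half_half_two (hτ : 0 < τ.im) :
    gaussSum 1 (1 / 2) (1 / 2) τ = I * etaK 2 τ ^ 3 := by
  have h := thetaOrigin_eq (im_ofNat_mul two_ne_zero hτ)
  rw [etaK_mul, thetaOrigin] at h
  rw [← h]; congr 1; push_cast; ring

lemma gaussSum_one_half_half_four (hτ : 0 < τ.im) :
    gaussSum 1 (1 / 2) (1 / 2) (2 * τ) = I * etaK 4 τ ^ 3 := by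
  have := gaussSum_one_half_half_two (im_ofNat_mul two_ne_zero hτ)
  rw [etaK_mul] at this
  exact_mod_cast this

lemma sqrt_two_sq : ((Real.sqrt 2 : ℝ) : ℂ) ^ 2 = 2 := by
  rw [← ofReal_pow, Real.sq_sqrt (by norm_num)]; norm_num

lemma thetaQuarter_ne_zero (hτ : 0 < τ.im) : thetaQuarter 0 τ ≠ 0 := by
  rw [thetaQuarter_eq hτ]
  refine mul_ne_zero (neg_ne_zero.mpr (ofReal_ne_zero.mpr (by positivity))) ?_
  exact div_ne_zero (mul_ne_zero (etaK_ne_zero one_ne_zero hτ) (etaK_ne_zero four_ne_zero hτ))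
    (etaK_ne_zero two_ne_zero hτ)

lemma thetaTwo_ne_zero (hτ : 0 < τ.im) : thetaTwo 0 τ ≠ 0 := by
  rw [thetaTwo_eq hτ]
  exact div_ne_zero (mul_ne_zero two_ne_zero (pow_ne_zero _ (etaK_ne_zero four_ne_zero hτ)))
    (etaK_ne_zero two_ne_zero hτ)

lemma thetaThree_ne_zero (hτ : 0 < τ.im) : thetaThree 0 τ ≠ 0 := by
  rw [thetaThree_eq hτ]
  exact div_ne_zero (pow_ne_zero _ (etaK_ne_zero two_ne_zero hτ))
    (mul_ne_zero (pow_ne_zero _ (etaK_ne_zero one_ne_zero hτ))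
      (pow_ne_zero _ (etaK_ne_zero four_ne_zero hτ)))

lemma thetaFour_ne_zero (hτ : 0 < τ.im) : thetaFour 0 τ ≠ 0 := by
  rw [thetaFour_eq hτ]
  exact div_ne_zero (pow_ne_zero _ (etaK_ne_zero one_ne_zero hτ)) (etaK_ne_zero two_ne_zero hτ)

/-- The bracket of weight a - b at z = 3/4 and z' = 1/4. By reflection the left side is a multiple
of a single product. On the right one residue class vanishes by parity and the other is θ₃ times
Jacobi's derivative formula at 2τ. -/
lemma thetaQuarter_mul (hτ : 0 < τ.im) :
    thetaQuarter 0 τ * thetaQuarter 1 τ = -(thetaThree 0 τ * (I * etaK 2 τ ^ 3)) := by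
  have hτ2 : 0 < (τ / 2).im := by simpa using hτ
  have h := gaussSum_bracket_one (3 / 4) (1 / 4) (1 / 2) (1 / 2) hτ2
  rw [show (3 / 4 : ℂ) + 1 / 4 = 0 + 1 by norm_num, show (3 / 4 : ℂ) - 1 / 4 = 1 / 2 by norm_num,
    show ((1 / 2 : ℝ) - 1 / 2) / 2 = 0 by norm_num,
    show ((1 / 2 : ℝ) + 1 / 2 + 1) / 2 = 0 + 1 by norm_num,
    show ((1 / 2 : ℝ) - 1 / 2 + 1) / 2 = 1 / 2 by norm_num,
    show 2 * (τ / 2) = τ by ring, gaussSum_half_zero_of_odd odd_one, gaussSum_add_one_right,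
    gaussSum_add_one_left 0 0 0, gaussSum_quarter_half, gaussSum_quarter_half,
    gaussSum_one_half_half_two hτ] at h
  simp only [ofReal_zero, mul_zero, exp_zero, one_mul, pow_zero, pow_one, zero_add] at h
  rw [thetaQuarter, thetaQuarter, thetaThree]
  linear_combination -h / 2

/-- `ϑ' / ϑ` at `π / 4` is the square of `∑ q^{n²}`. -/
lemma thetaQuarter_one_eq_sq (hτ : 0 < τ.im) :
    2 * I * thetaQuarter 1 τ = thetaThree 0 τ ^ 2 * thetaQuarter 0 τ := by
  apply mul_left_cancel₀ (thetaQuarter_ne_zero hτ)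
  have h := thetaQuarter_mul hτ
  have h3 := thetaThree_eq hτ
  have hq : thetaQuarter 0 τ ^ 2 = 2 * (etaK 1 τ * etaK 4 τ / etaK 2 τ) ^ 2 := by
    rw [thetaQuarter_eq hτ, mul_pow, neg_sq, sqrt_two_sq]
  have e1 := etaK_ne_zero one_ne_zero hτ
  have e2 := etaK_ne_zero two_ne_zero hτ
  have e4 := etaK_ne_zero four_ne_zero hτ
  -- As eta quotients, θ₃ ϑ(π/4)² and η(q²)³ are proportional, which eliminates η from
  -- `thetaQuarter_mul`.
  have h4 : thetaThree 0 τ * thetaQuarter 0 τ ^ 2 = 2 * etaK 2 τ ^ 3 := by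
    rw [hq, h3]; field_simp
  linear_combination 2 * I * h - thetaThree 0 τ * h4 - 2 * thetaThree 0 τ * etaK 2 τ ^ 3 * I_sq

lemma thetaQuarter_sq (hτ : 0 < τ.im) :
    thetaQuarter 0 τ ^ 2 = thetaTwo 0 τ * thetaFour 0 τ := by
  have e1 := etaK_ne_zero one_ne_zero hτ
  have e2 := etaK_ne_zero two_ne_zero hτ
  have e4 := etaK_ne_zero four_ne_zero hτ
  rw [thetaQuarter_eq hτ, mul_pow, neg_sq, sqrt_two_sq, thetaTwo_eq hτ, thetaFour_eq hτ]
  field_simp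

/-- This and `thetaOrigin_sq` write the squares of ϑ'(π/4) and ϑ'(0), up to constants, as monomials
in θ₂, θ₃, θ₄. Logarithmic differentiation in τ then produces the quotients ϑ'''/ϑ' that occur in R.
-/
lemma thetaQuarter_one_sq (hτ : 0 < τ.im) :
    4 * thetaQuarter 1 τ ^ 2 = -(thetaTwo 0 τ * thetaThree 0 τ ^ 4 * thetaFour 0 τ) := by
  have h := thetaQuarter_one_eq_sq hτ
  have h2 := thetaQuarter_sq hτ
  have h3 : (2 * I * thetaQuarter 1 τ) ^ 2 = (thetaThree 0 τ ^ 2 * thetaQuarter 0 τ) ^ 2 := by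
    rw [h]
  linear_combination -h3 + 4 * thetaQuarter 1 τ ^ 2 * I_sq - thetaThree 0 τ ^ 4 * h2

lemma thetaOrigin_sq (hτ : 0 < τ.im) :
    2 * thetaOrigin 1 τ ^ 2 = -(thetaTwo 0 τ * thetaThree 0 τ * thetaFour 0 τ ^ 4) := by
  have e1 := etaK_ne_zero one_ne_zero hτ
  have e2 := etaK_ne_zero two_ne_zero hτ
  have e4 := etaK_ne_zero four_ne_zero hτ
  rw [thetaOrigin_eq hτ, mul_pow, I_sq, thetaTwo_eq hτ, thetaThree_eq hτ, thetaFour_eq hτ]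
  field_simp

/-- `θ₄ Dθ₂ - θ₂ Dθ₄ = θ₂ θ₄ θ₃⁴ / 4`. -/
lemma theta_two_four (hτ : 0 < τ.im) :
    thetaFour 0 τ * thetaTwo 2 τ - thetaTwo 0 τ * thetaFour 2 τ =
      thetaTwo 0 τ * thetaFour 0 τ * thetaThree 0 τ ^ 4 / 4 := by
  have hτ2 : 0 < (τ / 2).im := by simpa using hτ
  have h := gaussSum_bracket_two 0 (1 / 2) (1 / 2) 0 hτ
  -- Reflection and periodicity express the weight-one sums in `h` through one quantity `u`.
  -- Splitting ϑ'(π/4) over even and odd indices expresses it through the same `u`, so the bracket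
  -- is a multiple of ϑ'(π/4)².
  have hs := gaussSum_split 1 (3 / 4) (1 / 2) hτ2
  rw [show (0 : ℂ) + 1 / 2 = -(1 / 2) + 1 by norm_num, show (0 : ℂ) - 1 / 2 = -(1 / 2) by norm_num,
    add_zero, sub_zero, show (1 / 2 : ℝ) / 2 = 1 / 4 by norm_num,
    show (1 / 2 + 1 : ℝ) / 2 = -(1 / 4) + 1 by norm_num, gaussSum_add_one_right,
    gaussSum_add_one_right, gaussSum_add_one_left, gaussSum_add_one_left] at h
  rw [show (1 / 2 : ℝ) / 2 = 1 / 4 by norm_num,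
    show (1 / 2 + 1 : ℝ) / 2 = -(1 / 4) + 1 by norm_num, gaussSum_add_one_right,
    show 2 * (3 / 4 : ℂ) = -(1 / 2) + 1 + 1 by norm_num, gaussSum_add_one_left,
    gaussSum_add_one_left, gaussSum_add_one_left, gaussSum_add_one_left,
    show 4 * (τ / 2) = 2 * τ by ring] at hs
  have e2 : cexp (2 * π * I * ((-(1 / 4) : ℝ) : ℂ)) = -I := by
    rw [ofReal_neg, mul_neg, exp_neg, exp_two_pi_I_mul_quarter, inv_I]
  have hu := gaussSum_neg 1 (1 / 2) (1 / 4) (2 * τ)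
  rw [show (1 / 2 : ℂ) = -(1 / 2) + 1 by norm_num, gaussSum_add_one_left,
    show -(-(1 / 2) + 1 : ℂ) = -(1 / 2) by norm_num, exp_two_pi_I_mul_quarter] at hu
  rw [exp_two_pi_I_mul_quarter, e2, hu] at h hs
  have hg := thetaQuarter_one_sq hτ
  rw [thetaQuarter, hs] at hg
  change thetaTwo 2 τ * thetaFour 0 τ - thetaTwo 0 τ * thetaFour 2 τ = _ at h
  generalize gaussSum 1 (-(1 / 2)) (1 / 4) (2 * τ) = u at *
  linear_combination h - hg / 4 + u ^ 2 * (4 * I ^ 4 - 8 * I ^ 3 + 4 * I) * I_sq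

/-- `θ₄ Dθ₃ - θ₃ Dθ₄ = θ₃ θ₄ θ₂⁴ / 4`. -/
lemma theta_three_four (hτ : 0 < τ.im) :
    thetaFour 0 τ * thetaThree 2 τ - thetaThree 0 τ * thetaFour 2 τ =
      thetaThree 0 τ * thetaFour 0 τ * thetaTwo 0 τ ^ 4 / 4 := by
  -- One residue class vanishes by parity; the other is the square of Jacobi's derivative formula,
  -- hence 4 η(q⁴)⁶.
  have h := gaussSum_bracket_two 0 (1 / 2) 0 0 hτ
  rw [show (0 : ℂ) + 1 / 2 = 1 / 2 by norm_num, show (0 : ℂ) - 1 / 2 = -(1 / 2) by norm_num,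
    show ((0 : ℝ) + 0) / 2 = 0 by norm_num, show ((0 : ℝ) + 0 + 1) / 2 = 1 / 2 by norm_num,
    show ((0 : ℝ) - 0 + 1) / 2 = 1 / 2 by norm_num,
    gaussSum_half_zero_of_odd odd_one, gaussSum_neg_half_half,
    gaussSum_one_half_half_four hτ] at h
  have e1 := etaK_ne_zero one_ne_zero hτ
  have e2 := etaK_ne_zero two_ne_zero hτ
  have e4 := etaK_ne_zero four_ne_zero hτ
  have hr : thetaThree 0 τ * thetaFour 0 τ * thetaTwo 0 τ ^ 4 / 4 = 4 * etaK 4 τ ^ 6 := by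
    rw [thetaTwo_eq hτ, thetaThree_eq hτ, thetaFour_eq hτ]
    field_simp
    norm_num
  rw [hr, thetaFour, thetaThree, thetaThree, thetaFour]
  linear_combination h - 4 * etaK 4 τ ^ 6 * I_sq

/-- The translation τ ↦ τ + 1/2, that is q ↦ -q, exchanges θ₃ and θ₄ and multiplies θ₂ by an eighth
root of unity. It transfers relations between theta constants without a new computation. -/
lemma thetaThree_add_half (k : ℕ) (τ : ℂ) : thetaThree k (τ + 1 / 2) = thetaFour k τ := by
  rw [thetaThree, gaussSum_add_half, thetaFour]; simp

lemma thetaFour_add_half (k : ℕ) (τ : ℂ) : thetaFour k (τ + 1 / 2) = thetaThree k τ := by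
  rw [thetaFour, gaussSum_add_half, thetaThree,
    show (1 / 2 + ((0 : ℝ) : ℂ) + 1 / 2 : ℂ) = 0 + 1 by push_cast; norm_num,
    gaussSum_add_one_left]
  simp

lemma thetaTwo_add_half (k : ℕ) (τ : ℂ) :
    thetaTwo k (τ + 1 / 2) = cexp (π * I / 4) * thetaTwo k τ := by
  rw [thetaTwo, gaussSum_add_half, thetaTwo,
    show (0 + ((1 / 2 : ℝ) : ℂ) + 1 / 2 : ℂ) = 0 + 1 by push_cast; norm_num,
    gaussSum_add_one_left, ← mul_assoc, ← exp_add]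
  congr 2
  push_cast; ring

lemma im_add_half (hτ : 0 < τ.im) : 0 < (τ + 1 / 2).im := by simpa using hτ

lemma exp_pi_div_four_pow : cexp (π * I / 4) ^ 4 = -1 := by
  rw [← exp_nat_mul, show ((4 : ℕ) : ℂ) * (π * I / 4) = π * I by push_cast; ring, exp_pi_mul_I]

/-- `θ₃ Dθ₂ - θ₂ Dθ₃ = θ₂ θ₃ θ₄⁴ / 4`. -/
lemma theta_two_three (hτ : 0 < τ.im) :
    thetaThree 0 τ * thetaTwo 2 τ - thetaTwo 0 τ * thetaThree 2 τ =
      thetaTwo 0 τ * thetaThree 0 τ * thetaFour 0 τ ^ 4 / 4 := by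
  -- Both sides are linear in θ₂ and its derivative, so the root of unity cancels.
  have h := theta_two_four (im_add_half hτ)
  rw [thetaFour_add_half, thetaFour_add_half, thetaTwo_add_half, thetaTwo_add_half,
    thetaThree_add_half] at h
  apply mul_left_cancel₀ (exp_ne_zero (π * I / 4))
  linear_combination h

/-- Jacobi's identity. -/
lemma theta_jacobi (hτ : 0 < τ.im) :
    thetaThree 0 τ ^ 4 = thetaTwo 0 τ ^ 4 + thetaFour 0 τ ^ 4 := by
  have h1 := theta_two_four hτ
  have h2 := theta_two_three hτ
  have h3 := theta_three_four hτ
  have n2 := thetaTwo_ne_zero hτ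
  have n3 := thetaThree_ne_zero hτ
  have n4 := thetaFour_ne_zero hτ
  -- With ℓ_k = Dθ_k / θ_k the identity is ℓ₂ - ℓ₄ = (ℓ₂ - ℓ₃) + (ℓ₃ - ℓ₄).
  apply mul_left_cancel₀ (mul_ne_zero (mul_ne_zero n2 n3) n4)
  linear_combination -4 * thetaThree 0 τ * h1 + 4 * thetaFour 0 τ * h2 +
    4 * thetaTwo 0 τ * h3

end SixVertex

/-! ### The second order differential equation of `∑ q^{n²}` -/

namespace SixVertex

open Complex Filter Topology Asymptotics

variable {τ : ℂ}

lemma thetaFour_two_mul_sq (hτ : 0 < τ.im) :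
    thetaFour 0 (2 * τ) ^ 2 = thetaThree 0 τ * thetaFour 0 τ := by
  have h := gaussSum_mul_zero_zero 0 (1 / 2) 0 0 hτ
  rw [show (0 : ℂ) + 1 / 2 = 1 / 2 by norm_num, show (0 : ℂ) - 1 / 2 = -(1 / 2) by norm_num,
    show ((0 : ℝ) + 0) / 2 = 0 by norm_num, show ((0 : ℝ) - 0) / 2 = 0 by norm_num,
    show ((0 : ℝ) + 0 + 1) / 2 = 1 / 2 by norm_num,
    gaussSum_half_half_of_even Even.zero, gaussSum_neg_half_zero] at h
  rw [thetaFour, thetaThree, thetaFour]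
  linear_combination -h

lemma thetaTwo_mul_thetaThree_two_mul (hτ : 0 < τ.im) :
    2 * (thetaTwo 0 (2 * τ) * thetaThree 0 (2 * τ)) = thetaTwo 0 τ ^ 2 := by
  have h := gaussSum_mul_zero_zero 0 0 (1 / 2) (1 / 2) hτ
  rw [show (0 : ℂ) + 0 = 0 by norm_num, show (0 : ℂ) - 0 = 0 by norm_num,
    show ((1 / 2 : ℝ) + 1 / 2) / 2 = 1 / 2 by norm_num,
    show ((1 / 2 : ℝ) - 1 / 2) / 2 = 0 by norm_num,
    show ((1 / 2 : ℝ) + 1 / 2 + 1) / 2 = 0 + 1 by norm_num,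
    show ((1 / 2 : ℝ) - 1 / 2 + 1) / 2 = 1 / 2 by norm_num, gaussSum_add_one_right] at h
  rw [thetaTwo, thetaThree, thetaTwo]
  linear_combination -h

/-- For the arguments 0 and 1/2 the second residue class vanishes by parity, so the quartic bracket
of θ₃ and θ₄ at τ becomes one of θ₄ with itself at 2τ. -/
lemma theta_bracket_four (hτ : 0 < τ.im) :
    thetaFour 0 τ * thetaThree 4 τ - 6 * (thetaThree 2 τ * thetaFour 2 τ) +
        thetaThree 0 τ * thetaFour 4 τ =
      -8 * (thetaFour 0 (2 * τ) * thetaFour 4 (2 * τ) - 3 * thetaFour 2 (2 * τ) ^ 2) := by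
  have h := gaussSum_bracket_four 0 (1 / 2) 0 0 hτ
  rw [show (0 : ℂ) + 1 / 2 = 1 / 2 by norm_num, show (0 : ℂ) - 1 / 2 = -(1 / 2) by norm_num,
    show ((0 : ℝ) + 0) / 2 = 0 by norm_num, show ((0 : ℝ) - 0) / 2 = 0 by norm_num,
    show ((0 : ℝ) + 0 + 1) / 2 = 1 / 2 by norm_num,
    gaussSum_half_half_of_even Even.zero, gaussSum_half_half_of_even even_two,
    gaussSum_half_half_of_even (k := 4) (by decide),
    gaussSum_neg_half_zero, gaussSum_neg_half_zero, gaussSum_neg_half_zero] at h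
  simp only [thetaFour, thetaThree]
  linear_combination h

/-- The difference of the two sides of `thetaFour_ode`, up to a factor. -/
noncomputable def thetaDefect (τ : ℂ) : ℂ :=
  2 * (thetaFour 0 τ * thetaFour 4 τ - 3 * thetaFour 2 τ ^ 2) / thetaFour 0 τ ^ 2 +
    thetaTwo 0 τ ^ 4 * thetaThree 0 τ ^ 4 / 4

/-- The duplication formulas express the defect at 2τ by theta constants at τ. The Wronskian
relations and the derivative of one of them then remove Dθ₂, Dθ₃ and D²θ₃, and what remains is the
defect at τ. -/
lemma thetaDefect_eq (hτ : 0 < τ.im) : thetaDefect τ = -4 * thetaDefect (2 * τ) := by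
  have hτ2 : 0 < (2 * τ).im := by simpa using hτ
  have n3 := thetaThree_ne_zero hτ
  have n4 := thetaFour_ne_zero hτ
  have hb := theta_bracket_four hτ
  have h34 := theta_three_four hτ
  have h24 := theta_two_four hτ
  have hd : thetaFour 0 τ * thetaThree 4 τ - thetaThree 0 τ * thetaFour 4 τ =
      (thetaThree 2 τ * thetaFour 0 τ * thetaTwo 0 τ ^ 4 +
        thetaThree 0 τ * thetaFour 2 τ * thetaTwo 0 τ ^ 4 +
        4 * thetaThree 0 τ * thetaFour 0 τ * thetaTwo 0 τ ^ 3 * thetaTwo 2 τ) / 4 := by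
    have e : (fun σ => thetaFour 0 σ * thetaThree 2 σ - thetaThree 0 σ * thetaFour 2 σ) =ᶠ[𝓝 τ]
        fun σ => thetaThree 0 σ * thetaFour 0 σ * thetaTwo 0 σ ^ 4 / 4 := by
      filter_upwards [isOpen_upperHalf.mem_nhds hτ] with σ hσ using theta_three_four hσ
    have h1 := ((hasDerivAt_thetaFour 0 hτ).fun_mul (hasDerivAt_thetaThree 2 hτ)).fun_sub
      ((hasDerivAt_thetaThree 0 hτ).fun_mul (hasDerivAt_thetaFour 2 hτ))
    have h2 := (((hasDerivAt_thetaThree 0 hτ).fun_mul (hasDerivAt_thetaFour 0 hτ)).fun_mul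
      ((hasDerivAt_thetaTwo 0 hτ).fun_pow 4)).div_const 4
    have h := (h1.congr_of_eventuallyEq e.symm).unique h2
    apply mul_left_cancel₀ two_pi_I_ne_zero
    norm_num at h
    linear_combination h
  have hsq := thetaFour_two_mul_sq hτ
  have h23 := thetaTwo_mul_thetaThree_two_mul hτ
  have h23' : 16 * (thetaTwo 0 (2 * τ) ^ 4 * thetaThree 0 (2 * τ) ^ 4) = thetaTwo 0 τ ^ 8 := by
    rw [← mul_pow]
    rw [show thetaTwo 0 τ ^ 8 = (thetaTwo 0 τ ^ 2) ^ 4 by ring, ← h23]; ring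
  have e1 : thetaDefect (2 * τ) = -(thetaFour 0 τ * thetaThree 4 τ -
      6 * (thetaThree 2 τ * thetaFour 2 τ) + thetaThree 0 τ * thetaFour 4 τ) /
      (4 * (thetaThree 0 τ * thetaFour 0 τ)) + thetaTwo 0 τ ^ 8 / 64 := by
    rw [thetaDefect, hsq, hb, ← h23']
    field_simp
    ring
  rw [e1, thetaDefect]
  have b2 : thetaThree 2 τ = (thetaThree 0 τ * thetaFour 2 τ +
      thetaThree 0 τ * thetaFour 0 τ * thetaTwo 0 τ ^ 4 / 4) / thetaFour 0 τ := by
    rw [eq_div_iff n4]; linear_combination h34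
  have a2 : thetaTwo 2 τ = (thetaTwo 0 τ * thetaFour 2 τ +
      thetaTwo 0 τ * thetaFour 0 τ * thetaThree 0 τ ^ 4 / 4) / thetaFour 0 τ := by
    rw [eq_div_iff n4]; linear_combination h24
  have b4 : thetaThree 4 τ = (thetaThree 0 τ * thetaFour 4 τ +
      (thetaThree 2 τ * thetaFour 0 τ * thetaTwo 0 τ ^ 4 +
        thetaThree 0 τ * thetaFour 2 τ * thetaTwo 0 τ ^ 4 +
        4 * thetaThree 0 τ * thetaFour 0 τ * thetaTwo 0 τ ^ 3 * thetaTwo 2 τ) / 4) /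
          thetaFour 0 τ := by
    rw [eq_div_iff n4]; linear_combination hd
  rw [b4, a2, b2]
  field_simp
  ring

lemma one_quarter_le_sq (n : ℤ) : (1 / 4 : ℝ) ≤ ((n : ℝ) + (1 / 2 : ℝ)) ^ 2 := by
  have h : (0 : ℤ) ≤ n * (n + 1) := by
    rcases le_or_gt 0 n with h | h
    · positivity
    · nlinarith
  have h' : (0 : ℝ) ≤ (n : ℝ) * (n + 1) := by exact_mod_cast h
  nlinarith

lemma isBigO_thetaTwo (k : ℕ) : thetaTwo k =O[comap im atTop]
    fun t : ℂ => Real.exp (-(2 * π) * (1 / 4) * t.im) :=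
  isBigO_gaussSum k (by simp) _ fun n _ => one_quarter_le_sq n

lemma tendsto_thetaTwo (k : ℕ) : Tendsto (thetaTwo k) (comap im atTop) (𝓝 0) :=
  (isBigO_thetaTwo k).trans_tendsto (tendsto_exp_neg_im (by norm_num))

lemma isBigO_thetaFour {k : ℕ} (hk : k ≠ 0) : thetaFour k =O[comap im atTop]
    fun t : ℂ => Real.exp (-(2 * π) * 1 * t.im) :=
  isBigO_gaussSum k (by norm_num) _ (one_le_sq_of_int hk)

lemma tendsto_thetaThree_zero : Tendsto (thetaThree 0) (comap im atTop) (𝓝 1) :=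
  tendsto_gaussSum_zero_one (by simp)

lemma tendsto_thetaThree {k : ℕ} (hk : k ≠ 0) :
    Tendsto (thetaThree k) (comap im atTop) (𝓝 0) :=
  (isBigO_gaussSum k (by simp) _ (one_le_sq_of_int hk)).trans_tendsto
    (tendsto_exp_neg_im one_pos)

lemma tendsto_thetaFour_zero : Tendsto (thetaFour 0) (comap im atTop) (𝓝 1) :=
  tendsto_gaussSum_zero_one (by norm_num)

/-- Each summand contains Dθ₄, D²θ₄ or θ₂⁴, all of which are O(q); the remaining factors are
bounded. -/
lemma isBigO_thetaDefect : thetaDefect =O[comap im atTop]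
    fun t : ℂ => Real.exp (-(2 * π) * 1 * t.im) := by
  have h0 : thetaFour 0 =O[comap im atTop] (fun _ => (1 : ℝ)) :=
    tendsto_thetaFour_zero.isBigO_one ℝ
  have h0' : (fun t => ((thetaFour 0 t) ^ 2)⁻¹) =O[comap im atTop] (fun _ => (1 : ℝ)) :=
    ((tendsto_thetaFour_zero.pow 2).inv₀ (by norm_num)).isBigO_one ℝ
  have h3 : (fun t => thetaThree 0 t ^ 4) =O[comap im atTop] (fun _ => (1 : ℝ)) :=
    (tendsto_thetaThree_zero.pow 4).isBigO_one ℝ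
  have h4 := isBigO_thetaFour (k := 4) (by norm_num)
  have h2 := isBigO_thetaFour (k := 2) (by norm_num)
  have h2' : thetaFour 2 =O[comap im atTop] (fun _ => (1 : ℝ)) :=
    (h2.trans_tendsto (tendsto_exp_neg_im one_pos)).isBigO_one ℝ
  have ha : (fun t => thetaTwo 0 t ^ 4) =O[comap im atTop]
      fun t : ℂ => Real.exp (-(2 * π) * 1 * t.im) := by
    refine ((isBigO_thetaTwo 0).pow 4).congr_right fun t => ?_
    rw [← Real.exp_nat_mul]; congr 1; push_cast; ring
  have e1 := h0.mul h4
  have e2 := (h2'.mul h2).const_mul_left 3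
  have e3 := ((e1.sub e2).const_mul_left 2).mul h0'
  have e4 := (ha.mul h3).const_mul_left (1 / 4)
  refine IsBigO.congr (f₁ := fun t => 2 * (thetaFour 0 t * thetaFour 4 t -
      3 * (thetaFour 2 t * thetaFour 2 t)) * ((thetaFour 0 t) ^ 2)⁻¹ +
      1 / 4 * (thetaTwo 0 t ^ 4 * thetaThree 0 t ^ 4)) ?_ (fun t => ?_) (fun _ => rfl)
  · refine IsBigO.add ?_ ?_
    · simpa using e3
    · simpa using e4
  · rw [thetaDefect]; ring

/-- Iterating the functional equation gives Δ(τ) = (-4)^k Δ(2^k τ), and the decay in 2^k Im τ beats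
the factor 4^k. -/
lemma thetaDefect_eq_zero (hτ : 0 < τ.im) : thetaDefect τ = 0 := by
  have hk : ∀ k : ℕ, thetaDefect τ = (-4) ^ k * thetaDefect (2 ^ k * τ) := by
    intro k
    induction k with
    | zero => simp
    | succ k ih =>
      have : 0 < (2 ^ k * τ).im := by
        have := im_ofNat_mul (m := 2 ^ k) (by positivity) hτ
        simpa using this
      rw [ih, thetaDefect_eq this]; ring_nf
  have hl : Tendsto (fun k : ℕ => (2 ^ k * τ : ℂ)) atTop (comap im atTop) := by
    rw [tendsto_comap_iff]
    have e : (im ∘ fun k : ℕ => (2 ^ k * τ : ℂ)) = fun k : ℕ => (2 : ℝ) ^ k * τ.im := by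
      ext k
      have : (2 ^ k * τ : ℂ) = (((2 : ℝ) ^ k : ℝ) : ℂ) * τ := by push_cast; rfl
      rw [Function.comp_apply, this, im_ofReal_mul]
    rw [e]
    exact (tendsto_pow_atTop_atTop_of_one_lt one_lt_two).atTop_mul_const hτ
  have hO := isBigO_thetaDefect.comp_tendsto hl
  have hO2 := (isBigO_refl (fun k : ℕ => (-4 : ℂ) ^ k) atTop).norm_right.mul hO
  -- As 4^k = (2^k)², this is x² e^{-x} up to a constant, with x = 2^k · 2π Im τ.
  have hlim : Tendsto (fun k : ℕ => ‖(-4 : ℂ) ^ k‖ * Real.exp (-(2 * π) * 1 * (2 ^ k * τ : ℂ).im))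
      atTop (𝓝 0) := by
    have h1 : Tendsto (fun k : ℕ => (2 : ℝ) ^ k) atTop atTop :=
      tendsto_pow_atTop_atTop_of_one_lt one_lt_two
    have hc : 0 < 2 * π * τ.im := by have := Real.pi_pos; positivity
    have h2 := ((Real.tendsto_pow_mul_exp_neg_atTop_nhds_zero 2).comp
      (h1.atTop_mul_const hc)).mul_const ((2 * π * τ.im) ^ 2)⁻¹
    rw [zero_mul] at h2
    refine h2.congr fun k => ?_
    have : (2 ^ k * τ : ℂ) = (((2 : ℝ) ^ k : ℝ) : ℂ) * τ := by push_cast; rfl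
    rw [Function.comp_apply, this, im_ofReal_mul, norm_pow, norm_neg,
      show ‖(4 : ℂ)‖ = 2 ^ 2 by norm_num, ← pow_mul, mul_comm 2 k, pow_mul,
      show -(2 * π) * 1 * (2 ^ k * τ.im) = -(2 ^ k * (2 * π * τ.im)) by ring, mul_pow]
    field_simp
  have hz : Tendsto (fun k : ℕ => (-4 : ℂ) ^ k * thetaDefect (2 ^ k * τ)) atTop (𝓝 0) :=
    hO2.trans_tendsto hlim
  exact tendsto_nhds_unique (tendsto_const_nhds.congr hk) hz

/-- `θ₄ D²θ₄ - 3 (Dθ₄)² = -θ₄² θ₂⁴ θ₃⁴ / 8`. -/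
lemma thetaFour_ode (hτ : 0 < τ.im) :
    thetaFour 0 τ * thetaFour 4 τ - 3 * thetaFour 2 τ ^ 2 =
      -(thetaFour 0 τ ^ 2 * thetaTwo 0 τ ^ 4 * thetaThree 0 τ ^ 4) / 8 := by
  have h := thetaDefect_eq_zero hτ
  have n4 := thetaFour_ne_zero hτ
  rw [thetaDefect] at h
  field_simp at h
  linear_combination h / 8

/-- `θ₃ D²θ₃ - 3 (Dθ₃)² = θ₃² θ₂⁴ θ₄⁴ / 8`. -/
lemma thetaThree_ode (hτ : 0 < τ.im) :
    thetaThree 0 τ * thetaThree 4 τ - 3 * thetaThree 2 τ ^ 2 =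
      thetaThree 0 τ ^ 2 * thetaTwo 0 τ ^ 4 * thetaFour 0 τ ^ 4 / 8 := by
  -- Under τ ↦ τ + 1/2 the factor θ₂⁴ changes sign, whence the opposite sign on the right.
  have h := thetaFour_ode (im_add_half hτ)
  simp only [thetaFour_add_half, thetaThree_add_half, thetaTwo_add_half, mul_pow,
    exp_pi_div_four_pow] at h
  linear_combination h

end SixVertex

/-! ### The functions `A`, `R` and `t` in terms of theta constants -/

namespace SixVertex

open Complex Filter Topology

variable {τ : ℂ}

/-- The shift of z by 1/2 contributes the phase exp(πi(n + 1/2)) = (-1)^n i, which absorbs the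
alternating sign and the factor -i. -/
lemma theta_eq_gaussSum (z τ : ℂ) :
    theta z τ = -gaussSum 0 (z / π + 1 / 2) (1 / 2) (τ / 2) := by
  rw [theta, gaussSum, ← tsum_mul_left, ← tsum_neg]
  refine tsum_congr fun n => ?_
  have hpi : (π : ℂ) ≠ 0 := ofReal_ne_zero.mpr Real.pi_ne_zero
  have h1 : cexp (π * I) ^ n = cexp (n * (π * I)) := (exp_int_mul _ n).symm
  rw [exp_pi_mul_I] at h1
  have h2 : cexp (π / 2 * I) = I := exp_pi_div_two_mul_I
  rw [gaussTerm, pow_zero, one_mul,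
    show 2 * (π : ℂ) * I * (τ / 2 * ((n : ℂ) + ((1 / 2 : ℝ) : ℂ)) ^ 2 +
      ((n : ℂ) + ((1 / 2 : ℝ) : ℂ)) * (z / π + 1 / 2)) =
      (((n : ℂ) + 1 / 2) ^ 2 * π * I * τ + (2 * (n : ℂ) + 1) * I * z) +
        (n * (π * I) + π / 2 * I) by push_cast; field_simp; ring,
    exp_add _ (_ + _), exp_add (n * _),
    ← h1, h2]
  ring

lemma thetaD_eq_gaussSum (k : ℕ) (z : ℂ) (hτ : 0 < τ.im) :
    thetaD k z τ = -((2 * I) ^ k * gaussSum k (z / π + 1 / 2) (1 / 2) (τ / 2)) := by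
  have hτ2 : 0 < (τ / 2).im := by simpa using hτ
  have hpi : (π : ℂ) ≠ 0 := ofReal_ne_zero.mpr Real.pi_ne_zero
  induction k generalizing z with
  | zero => simp [thetaD, theta_eq_gaussSum]
  | succ k ih =>
    have e : iteratedDeriv k (fun w => theta w τ) =
        fun z => -((2 * I) ^ k * gaussSum k (z / π + 1 / 2) (1 / 2) (τ / 2)) :=
      funext fun z => ih z
    rw [thetaD, iteratedDeriv_succ, e]
    have h1 : HasDerivAt (fun z : ℂ => z / π + 1 / 2) (1 / π) z :=
      ((hasDerivAt_id z).div_const _).add_const _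
    have h := ((HasDerivAt.comp z (hasDerivAt_gaussSum_fst k _ (1 / 2) hτ2) h1).const_mul
      ((2 * I) ^ k)).fun_neg
    refine h.deriv.trans ?_
    field_simp
    ring

lemma pi_div_four_div_pi : (π : ℂ) / 4 / π + 1 / 2 = 3 / 4 := by
  have hpi : (π : ℂ) ≠ 0 := ofReal_ne_zero.mpr Real.pi_ne_zero
  field_simp; norm_num

lemma theta_quarter (τ : ℂ) : theta (π / 4) τ = -thetaQuarter 0 τ := by
  rw [theta_eq_gaussSum, pi_div_four_div_pi, thetaQuarter]

lemma thetaD_quarter (k : ℕ) (hτ : 0 < τ.im) :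
    thetaD k (π / 4) τ = -((2 * I) ^ k * thetaQuarter k τ) := by
  rw [thetaD_eq_gaussSum k _ hτ, pi_div_four_div_pi, thetaQuarter]

lemma thetaD_origin (k : ℕ) (hτ : 0 < τ.im) :
    thetaD k 0 τ = -((2 * I) ^ k * thetaOrigin k τ) := by
  rw [thetaD_eq_gaussSum k _ hτ, zero_div, zero_add, thetaOrigin]

lemma cos_pi_div_four_complex : Complex.cos (π / 4) = (Real.sqrt 2 : ℂ) / 2 := by
  rw [show (π : ℂ) / 4 = ((π / 4 : ℝ) : ℂ) by push_cast; rfl, ← ofReal_cos, Real.cos_pi_div_four]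
  push_cast; rfl

lemma sin_pi_div_four_complex : Complex.sin (π / 4) = (Real.sqrt 2 : ℂ) / 2 := by
  rw [show (π : ℂ) / 4 = ((π / 4 : ℝ) : ℂ) by push_cast; rfl, ← ofReal_sin, Real.sin_pi_div_four]
  push_cast; rfl

lemma sqrt_two_ne_zero : (Real.sqrt 2 : ℂ) ≠ 0 := ofReal_ne_zero.mpr (by positivity)

lemma coeff_t : Complex.cos (π / 4) / (64 * Complex.sin (π / 4) ^ 3) = 1 / 32 := by
  have h := sqrt_two_sq
  have h0 := sqrt_two_ne_zero
  rw [cos_pi_div_four_complex, sin_pi_div_four_complex]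
  field_simp
  linear_combination -64 * h

lemma coeff_R : Complex.cos (π / 4) ^ 2 / (96 * Complex.sin (π / 4) ^ 4) = 1 / 48 := by
  have h := sqrt_two_sq
  have h0 := sqrt_two_ne_zero
  rw [cos_pi_div_four_complex, sin_pi_div_four_complex]
  field_simp
  linear_combination -96 * h

lemma coeff_S : 8 * Complex.sin (π / 4) ^ 4 / Complex.cos (π / 4) ^ 2 = 4 := by
  have h := sqrt_two_sq
  have h0 := sqrt_two_ne_zero
  rw [cos_pi_div_four_complex, sin_pi_div_four_complex]
  field_simp
  linear_combination 8 * h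

lemma thetaQuarter_one_ne_zero (hτ : 0 < τ.im) : thetaQuarter 1 τ ≠ 0 := by
  intro h
  have := thetaQuarter_one_eq_sq hτ
  rw [h, mul_zero] at this
  exact mul_ne_zero (pow_ne_zero _ (thetaThree_ne_zero hτ)) (thetaQuarter_ne_zero hτ) this.symm

lemma thetaOrigin_one_ne_zero (hτ : 0 < τ.im) : thetaOrigin 1 τ ≠ 0 := by
  rw [thetaOrigin_eq hτ]
  exact mul_ne_zero I_ne_zero (pow_ne_zero _ (etaK_ne_zero one_ne_zero hτ))

lemma AFun_eq (hτ : 0 < τ.im) : AFun (π / 4) τ = thetaThree 0 τ ^ 2 := by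
  have n := thetaQuarter_ne_zero hτ
  have h := thetaQuarter_one_eq_sq hτ
  rw [AFun, theta_quarter, thetaD_quarter 1 hτ, neg_div_neg_eq, div_eq_iff n, pow_one, h]

lemma tFun_eq (hτ : 0 < τ.im) : tFun (π / 4) τ = thetaThree 2 τ / (2 * thetaThree 0 τ ^ 3) := by
  have n0 := thetaQuarter_ne_zero hτ
  have n3 := thetaThree_ne_zero hτ
  have h := thetaQuarter_one_eq_sq hτ
  -- The identity 2i ϑ'(π/4) ∼ θ₃² ϑ(π/4) between weights one and zero, differentiated in τ, gives
  -- one between weights three and two. The derivative of θ₃ carries 2πi and that of `thetaQuarter`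
  -- only πi, hence the 4.
  have hd : 2 * I * thetaQuarter 3 τ = 4 * thetaThree 0 τ * thetaThree 2 τ * thetaQuarter 0 τ +
      thetaThree 0 τ ^ 2 * thetaQuarter 2 τ := by
    have e : (fun σ => 2 * I * thetaQuarter 1 σ) =ᶠ[𝓝 τ]
        fun σ => thetaThree 0 σ ^ 2 * thetaQuarter 0 σ := by
      filter_upwards [isOpen_upperHalf.mem_nhds hτ] with σ hσ using thetaQuarter_one_eq_sq hσ
    have h1 := (hasDerivAt_thetaQuarter 1 hτ).const_mul (2 * I)
    have h2 := ((hasDerivAt_thetaThree 0 hτ).fun_pow 2).fun_mul (hasDerivAt_thetaQuarter 0 hτ)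
    have h := (h1.congr_of_eventuallyEq e.symm).unique h2
    have hpi : (π : ℂ) * I ≠ 0 := mul_ne_zero (ofReal_ne_zero.mpr Real.pi_ne_zero) I_ne_zero
    apply mul_left_cancel₀ hpi
    norm_num at h
    linear_combination h
  have e1 : thetaQuarter 1 τ = thetaThree 0 τ ^ 2 * thetaQuarter 0 τ / (2 * I) := by
    rw [eq_div_iff (by simp)]; linear_combination h
  have e3 : thetaQuarter 3 τ = (4 * thetaThree 0 τ * thetaThree 2 τ * thetaQuarter 0 τ +
      thetaThree 0 τ ^ 2 * thetaQuarter 2 τ) / (2 * I) := by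
    rw [eq_div_iff (by simp)]; linear_combination hd
  rw [tFun, coeff_t, theta_quarter, thetaD_quarter 1 hτ, thetaD_quarter 2 hτ, thetaD_quarter 3 hτ,
    e1, e3]
  have hI : I ≠ 0 := I_ne_zero
  field_simp
  ring_nf
  rw [I_sq]
  ring

/-- The quotients ϑ'''/ϑ' at π/4 and at 0 are logarithmic τ-derivatives of monomials in θ₂, θ₃, θ₄.
In their difference θ₂ cancels and 3(Dθ₃/θ₃ - Dθ₄/θ₄) = 3θ₂⁴/4 is left. -/
lemma RFun_eq (hτ : 0 < τ.im) :
    RFun (π / 4) τ = thetaTwo 0 τ ^ 4 / (16 * thetaThree 0 τ ^ 4) := by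
  have n2 := thetaTwo_ne_zero hτ
  have n3 := thetaThree_ne_zero hτ
  have n4 := thetaFour_ne_zero hτ
  have g0 := thetaQuarter_ne_zero hτ
  have g1 := thetaQuarter_one_ne_zero hτ
  have k1 := thetaOrigin_one_ne_zero hτ
  have hpi : (π : ℂ) * I ≠ 0 := mul_ne_zero (ofReal_ne_zero.mpr Real.pi_ne_zero) I_ne_zero
  have hg := thetaQuarter_one_sq hτ
  have hk := thetaOrigin_sq hτ
  have dg : 4 * (thetaQuarter 1 τ * thetaQuarter 3 τ) =
      -(thetaTwo 2 τ * thetaThree 0 τ ^ 4 * thetaFour 0 τ +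
        4 * thetaTwo 0 τ * thetaThree 0 τ ^ 3 * thetaThree 2 τ * thetaFour 0 τ +
        thetaTwo 0 τ * thetaThree 0 τ ^ 4 * thetaFour 2 τ) := by
    have e : (fun σ => 4 * thetaQuarter 1 σ ^ 2) =ᶠ[𝓝 τ]
        fun σ => -(thetaTwo 0 σ * thetaThree 0 σ ^ 4 * thetaFour 0 σ) := by
      filter_upwards [isOpen_upperHalf.mem_nhds hτ] with σ hσ using thetaQuarter_one_sq hσ
    have h1 := ((hasDerivAt_thetaQuarter 1 hτ).fun_pow 2).const_mul 4
    have h2 := (((hasDerivAt_thetaTwo 0 hτ).fun_mul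
      ((hasDerivAt_thetaThree 0 hτ).fun_pow 4)).fun_mul
      (hasDerivAt_thetaFour 0 hτ)).fun_neg
    have h := (h1.congr_of_eventuallyEq e.symm).unique h2
    apply mul_left_cancel₀ hpi
    norm_num at h
    linear_combination h / 2
  have dk : 2 * (thetaOrigin 1 τ * thetaOrigin 3 τ) =
      -(thetaTwo 2 τ * thetaThree 0 τ * thetaFour 0 τ ^ 4 +
        thetaTwo 0 τ * thetaThree 2 τ * thetaFour 0 τ ^ 4 +
        4 * thetaTwo 0 τ * thetaThree 0 τ * thetaFour 0 τ ^ 3 * thetaFour 2 τ) := by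
    have e : (fun σ => 2 * thetaOrigin 1 σ ^ 2) =ᶠ[𝓝 τ]
        fun σ => -(thetaTwo 0 σ * thetaThree 0 σ * thetaFour 0 σ ^ 4) := by
      filter_upwards [isOpen_upperHalf.mem_nhds hτ] with σ hσ using thetaOrigin_sq hσ
    have h1 := ((hasDerivAt_thetaOrigin 1 hτ).fun_pow 2).const_mul 2
    have h2 := (((hasDerivAt_thetaTwo 0 hτ).fun_mul (hasDerivAt_thetaThree 0 hτ)).fun_mul
      ((hasDerivAt_thetaFour 0 hτ).fun_pow 4)).fun_neg
    have h := (h1.congr_of_eventuallyEq e.symm).unique h2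
    apply mul_left_cancel₀ hpi
    norm_num at h
    linear_combination h / 2
  have rg : thetaQuarter 3 τ / thetaQuarter 1 τ = thetaTwo 2 τ / thetaTwo 0 τ +
      4 * (thetaThree 2 τ / thetaThree 0 τ) + thetaFour 2 τ / thetaFour 0 τ := by
    have : thetaQuarter 3 τ / thetaQuarter 1 τ =
        4 * (thetaQuarter 1 τ * thetaQuarter 3 τ) / (4 * thetaQuarter 1 τ ^ 2) := by field_simp
    rw [this, dg, hg]
    field_simp
  have rk : thetaOrigin 3 τ / thetaOrigin 1 τ = thetaTwo 2 τ / thetaTwo 0 τ +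
      thetaThree 2 τ / thetaThree 0 τ + 4 * (thetaFour 2 τ / thetaFour 0 τ) := by
    have : thetaOrigin 3 τ / thetaOrigin 1 τ =
        2 * (thetaOrigin 1 τ * thetaOrigin 3 τ) / (2 * thetaOrigin 1 τ ^ 2) := by field_simp
    rw [this, dk, hk]
    field_simp
  have ratio (u v : ℂ) : -((2 * I) ^ 3 * u) / -((2 * I) ^ 1 * v) = -4 * (u / v) := by
    rw [neg_div_neg_eq, mul_div_mul_comm]
    congr 1
    rw [pow_one, pow_succ, mul_div_assoc, div_self (by simp), mul_one, mul_pow, I_sq]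
    norm_num
  have hA : theta (π / 4) τ ^ 2 / thetaD 1 (π / 4) τ ^ 2 = 1 / thetaThree 0 τ ^ 4 := by
    have h := AFun_eq hτ
    rw [AFun] at h
    rw [← div_pow, ← inv_div, h]
    field_simp
  rw [RFun, coeff_R, hA, thetaD_quarter 1 hτ, thetaD_quarter 3 hτ, thetaD_origin 1 hτ,
    thetaD_origin 3 hτ, ratio, ratio, rg, rk]
  have h34 := theta_three_four hτ
  have b2 : thetaThree 2 τ = (thetaThree 0 τ * thetaFour 2 τ +
      thetaThree 0 τ * thetaFour 0 τ * thetaTwo 0 τ ^ 4 / 4) / thetaFour 0 τ := by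
    rw [eq_div_iff n4]; linear_combination h34
  rw [b2]
  field_simp
  ring

lemma one_sub_RFun_eq (hτ : 0 < τ.im) :
    1 - 16 * RFun (π / 4) τ = thetaFour 0 τ ^ 4 / thetaThree 0 τ ^ 4 := by
  have n3 := thetaThree_ne_zero hτ
  rw [RFun_eq hτ]
  field_simp
  linear_combination theta_jacobi hτ

lemma AFun_ne_zero (hτ : 0 < τ.im) : AFun (π / 4) τ ≠ 0 := by
  rw [AFun_eq hτ]; exact pow_ne_zero _ (thetaThree_ne_zero hτ)

lemma RFun_ne_zero (hτ : 0 < τ.im) : RFun (π / 4) τ ≠ 0 := by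
  rw [RFun_eq hτ]
  exact div_ne_zero (pow_ne_zero _ (thetaTwo_ne_zero hτ))
    (mul_ne_zero (by norm_num) (pow_ne_zero _ (thetaThree_ne_zero hτ)))

lemma one_sub_RFun_ne_zero (hτ : 0 < τ.im) : 1 - 16 * RFun (π / 4) τ ≠ 0 := by
  rw [one_sub_RFun_eq hτ]
  exact div_ne_zero (pow_ne_zero _ (thetaFour_ne_zero hτ)) (pow_ne_zero _ (thetaThree_ne_zero hτ))

lemma eventuallyEq_of_upperHalf {f g : ℂ → ℂ} (h : ∀ σ : ℂ, 0 < σ.im → f σ = g σ)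
    (hτ : 0 < τ.im) : f =ᶠ[𝓝 τ] g := by
  filter_upwards [isOpen_upperHalf.mem_nhds hτ] with σ hσ using h σ hσ

/-- First of the three equations of the closed system for A, R, t, from which the differential
equations and the hypergeometric formulas follow. -/
lemma hasDerivAt_AFun (hτ : 0 < τ.im) : HasDerivAt (AFun (π / 4))
    (2 * π * I * (4 * tFun (π / 4) τ * AFun (π / 4) τ ^ 2)) τ := by
  have h := ((hasDerivAt_thetaThree 0 hτ).fun_pow 2).congr_of_eventuallyEq
    (eventuallyEq_of_upperHalf (fun σ hσ => AFun_eq hσ) hτ)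
  have n3 := thetaThree_ne_zero hτ
  convert! h using 1
  rw [tFun_eq hτ, AFun_eq hτ]
  norm_num
  field_simp
  ring

lemma hasDerivAt_RFun (hτ : 0 < τ.im) : HasDerivAt (RFun (π / 4))
    (2 * π * I * (AFun (π / 4) τ ^ 2 * RFun (π / 4) τ * (1 - 16 * RFun (π / 4) τ))) τ := by
  have n2 := thetaTwo_ne_zero hτ
  have n3 := thetaThree_ne_zero hτ
  have h := (((hasDerivAt_thetaTwo 0 hτ).fun_pow 4).fun_div
    (((hasDerivAt_thetaThree 0 hτ).fun_pow 4).const_mul 16)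
    (mul_ne_zero (by norm_num) (pow_ne_zero _ n3))).congr_of_eventuallyEq
    (eventuallyEq_of_upperHalf (fun σ hσ => RFun_eq hσ) hτ)
  have h23 := theta_two_three hτ
  convert! h using 1
  rw [one_sub_RFun_eq hτ, AFun_eq hτ, RFun_eq hτ]
  norm_num
  have a2 : thetaTwo 2 τ = (thetaTwo 0 τ * thetaThree 2 τ +
      thetaTwo 0 τ * thetaThree 0 τ * thetaFour 0 τ ^ 4 / 4) / thetaThree 0 τ := by
    rw [eq_div_iff n3]; linear_combination h23
  rw [a2]
  field_simp
  ring

/-- The numerator of D(Dθ₃ / θ₃³) is governed by θ₃ D²θ₃ - 3(Dθ₃)², so this is the second-order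
equation of θ₃ in other variables. -/
lemma hasDerivAt_tFun (hτ : 0 < τ.im) : HasDerivAt (tFun (π / 4))
    (2 * π * I * (AFun (π / 4) τ ^ 3 * RFun (π / 4) τ * (1 - 16 * RFun (π / 4) τ))) τ := by
  have n3 := thetaThree_ne_zero hτ
  have h := ((hasDerivAt_thetaThree 2 hτ).fun_div
    (((hasDerivAt_thetaThree 0 hτ).fun_pow 3).const_mul 2)
    (mul_ne_zero (by norm_num) (pow_ne_zero _ n3))).congr_of_eventuallyEq
    (eventuallyEq_of_upperHalf (fun σ hσ => tFun_eq hσ) hτ)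
  have hb := thetaThree_ode hτ
  convert! h using 1
  rw [one_sub_RFun_eq hτ, AFun_eq hτ, RFun_eq hτ]
  norm_num
  have b4 : thetaThree 4 τ = (3 * thetaThree 2 τ ^ 2 +
      thetaThree 0 τ ^ 2 * thetaTwo 0 τ ^ 4 * thetaFour 0 τ ^ 4 / 8) / thetaThree 0 τ := by
    rw [eq_div_iff n3]; linear_combination hb
  rw [b4]
  field_simp
  ring

end SixVertex

/-! ### Identities between functions of `τ` -/

namespace SixVertex

open Complex Filter Topology

variable {τ : ℂ}

lemma qD_eq_of_hasDerivAt {f : ℂ → ℂ} {c : ℂ} (h : HasDerivAt f (2 * π * I * c) τ) :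
    qD f τ = c := by
  rw [qD, h.deriv, inv_mul_cancel_left₀ two_pi_I_ne_zero]

lemma qD_RFun (hτ : 0 < τ.im) : qD (RFun (π / 4)) τ =
    AFun (π / 4) τ ^ 2 * RFun (π / 4) τ * (1 - 16 * RFun (π / 4) τ) :=
  qD_eq_of_hasDerivAt (hasDerivAt_RFun hτ)

lemma qD_RFun_ne_zero (hτ : 0 < τ.im) : qD (RFun (π / 4)) τ ≠ 0 := by
  rw [qD_RFun hτ]
  exact mul_ne_zero (mul_ne_zero (pow_ne_zero _ (AFun_ne_zero hτ)) (RFun_ne_zero hτ))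
    (one_sub_RFun_ne_zero hτ)

lemma derivR_congr {f g : ℂ → ℂ} (h : ∀ σ : ℂ, 0 < σ.im → f σ = g σ) (hτ : 0 < τ.im) :
    derivR (π / 4) f τ = derivR (π / 4) g τ := by
  rw [derivR, derivR, qD, qD, qD, (eventuallyEq_of_upperHalf h hτ).deriv_eq]

lemma derivR_tFun (hτ : 0 < τ.im) : derivR (π / 4) (tFun (π / 4)) τ = AFun (π / 4) τ := by
  have hA := AFun_ne_zero hτ
  have hR := RFun_ne_zero hτ
  have hR1 := one_sub_RFun_ne_zero hτ
  rw [derivR, qD_eq_of_hasDerivAt (hasDerivAt_tFun hτ), qD_RFun hτ,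
    div_eq_iff (mul_ne_zero (mul_ne_zero (pow_ne_zero _ hA) hR) hR1)]
  ring

lemma derivR_AFun (hτ : 0 < τ.im) : derivR (π / 4) (AFun (π / 4)) τ =
    4 * tFun (π / 4) τ / (RFun (π / 4) τ * (1 - 16 * RFun (π / 4) τ)) := by
  have hA := AFun_ne_zero hτ
  have hR := RFun_ne_zero hτ
  have hR1 := one_sub_RFun_ne_zero hτ
  rw [derivR, qD_eq_of_hasDerivAt (hasDerivAt_AFun hτ), qD_RFun hτ]
  field_simp

lemma tFun_ode (hτ : 0 < τ.im) : derivR (π / 4) (derivR (π / 4) (tFun (π / 4))) τ -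
    4 / (RFun (π / 4) τ * (1 - 16 * RFun (π / 4) τ)) * tFun (π / 4) τ = 0 := by
  rw [derivR_congr (fun σ hσ => derivR_tFun hσ) hτ, derivR_AFun hτ]
  ring

lemma hasDerivAt_R_mul (hτ : 0 < τ.im) :
    HasDerivAt (fun σ => RFun (π / 4) σ * (1 - 16 * RFun (π / 4) σ))
      (2 * π * I * ((1 - 32 * RFun (π / 4) τ) *
        (AFun (π / 4) τ ^ 2 * RFun (π / 4) τ * (1 - 16 * RFun (π / 4) τ)))) τ := by
  have h := (hasDerivAt_RFun hτ).fun_mul (((hasDerivAt_RFun hτ).const_mul 16).const_sub 1)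
  exact h.congr_deriv (by ring)

lemma AFun_ode (hτ : 0 < τ.im) : derivR (π / 4) (derivR (π / 4) (AFun (π / 4))) τ +
    (1 - 32 * RFun (π / 4) τ) / (RFun (π / 4) τ * (1 - 16 * RFun (π / 4) τ)) *
      derivR (π / 4) (AFun (π / 4)) τ -
    4 / (RFun (π / 4) τ * (1 - 16 * RFun (π / 4) τ)) * AFun (π / 4) τ = 0 := by
  have hA := AFun_ne_zero hτ
  have hR := RFun_ne_zero hτ
  have hR1 := one_sub_RFun_ne_zero hτ
  have h := (((hasDerivAt_tFun hτ).const_mul 4).fun_div (hasDerivAt_R_mul hτ)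
    (mul_ne_zero hR hR1)).deriv
  rw [derivR_congr (fun σ hσ => derivR_AFun hσ) hτ, derivR_AFun hτ, derivR, qD_RFun hτ, qD, h]
  have hpi := two_pi_I_ne_zero
  generalize AFun (π / 4) τ = A at *
  generalize RFun (π / 4) τ = R at *
  generalize tFun (π / 4) τ = t at *
  generalize (2 * π * I : ℂ) = c at *
  field_simp
  ring

lemma hasDerivAt_mul_AFun (hτ : 0 < τ.im) : HasDerivAt (fun σ => σ * AFun (π / 4) σ)
    (AFun (π / 4) τ + τ * (2 * π * I * (4 * tFun (π / 4) τ * AFun (π / 4) τ ^ 2))) τ :=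
  ((hasDerivAt_id τ).fun_mul (hasDerivAt_AFun hτ)).congr_deriv (by simp)

/-- Compared with τ dA/dR there is the extra term A / (2πi DR), proportional to 1 / (A R(1 - 16R)),
as in reduction of order. -/
lemma derivR_mul_AFun (hτ : 0 < τ.im) : derivR (π / 4) (fun σ => σ * AFun (π / 4) σ) τ =
    ((2 * π * I)⁻¹ * (AFun (π / 4) τ)⁻¹ + τ * (4 * tFun (π / 4) τ)) /
      (RFun (π / 4) τ * (1 - 16 * RFun (π / 4) τ)) := by
  have hA := AFun_ne_zero hτ
  have hR := RFun_ne_zero hτ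
  have hR1 := one_sub_RFun_ne_zero hτ
  rw [derivR, qD_RFun hτ, qD, (hasDerivAt_mul_AFun hτ).deriv]
  have hpi := two_pi_I_ne_zero
  generalize (2 * π * I : ℂ) = c at *
  field_simp

lemma mul_AFun_ode (hτ : 0 < τ.im) :
    derivR (π / 4) (derivR (π / 4) (fun σ => σ * AFun (π / 4) σ)) τ +
    (1 - 32 * RFun (π / 4) τ) / (RFun (π / 4) τ * (1 - 16 * RFun (π / 4) τ)) *
      derivR (π / 4) (fun σ => σ * AFun (π / 4) σ) τ -
    4 / (RFun (π / 4) τ * (1 - 16 * RFun (π / 4) τ)) * (τ * AFun (π / 4) τ) = 0 := by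
  have hA := AFun_ne_zero hτ
  have hR := RFun_ne_zero hτ
  have hR1 := one_sub_RFun_ne_zero hτ
  have h := (((((hasDerivAt_AFun hτ).fun_inv hA).const_mul (2 * π * I)⁻¹).fun_add
    ((hasDerivAt_id τ).fun_mul ((hasDerivAt_tFun hτ).const_mul 4))).fun_div (hasDerivAt_R_mul hτ)
    (mul_ne_zero hR hR1)).deriv
  simp only [id] at h
  rw [derivR_congr (fun σ hσ => derivR_mul_AFun hσ) hτ, derivR_mul_AFun hτ, derivR, qD_RFun hτ,
    qD, h]
  have hpi := two_pi_I_ne_zero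
  generalize AFun (π / 4) τ = A at *
  generalize RFun (π / 4) τ = R at *
  generalize tFun (π / 4) τ = t at *
  generalize (2 * π * I : ℂ) = c at *
  field_simp
  ring

lemma sqSum_zero (τ : ℂ) : sqSum 0 τ = thetaThree 0 τ := by
  rw [sqSum, thetaThree, gaussSum]
  refine tsum_congr fun n => ?_
  rw [gaussTerm, pow_zero, one_mul]
  congr 1; push_cast; ring

lemma sqSum_half (τ : ℂ) : sqSum (1 / 2) τ = thetaTwo 0 τ := by
  rw [sqSum, thetaTwo, gaussSum]
  refine tsum_congr fun n => ?_
  rw [gaussTerm, pow_zero, one_mul]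
  congr 1; push_cast; ring

lemma hFun_eq (hτ : 0 < τ.im) : hFun τ = thetaTwo 0 τ ^ 4 / (16 * thetaFour 0 τ ^ 4) := by
  have e1 := etaK_ne_zero one_ne_zero hτ
  have e2 := etaK_ne_zero two_ne_zero hτ
  rw [hFun, thetaTwo_eq hτ, thetaFour_eq hτ]
  field_simp
  norm_num

lemma one_add_hFun_eq (hτ : 0 < τ.im) :
    1 + 16 * hFun τ = thetaThree 0 τ ^ 4 / thetaFour 0 τ ^ 4 := by
  have n4 := thetaFour_ne_zero hτ
  rw [hFun_eq hτ]
  field_simp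
  linear_combination -theta_jacobi hτ

lemma hFun_ne_zero (hτ : 0 < τ.im) : hFun τ ≠ 0 :=
  pow_ne_zero _ (div_ne_zero (etaK_ne_zero four_ne_zero hτ) (etaK_ne_zero one_ne_zero hτ))

lemma one_add_hFun_ne_zero (hτ : 0 < τ.im) : 1 + 16 * hFun τ ≠ 0 := by
  rw [one_add_hFun_eq hτ]
  exact div_ne_zero (pow_ne_zero _ (thetaThree_ne_zero hτ)) (pow_ne_zero _ (thetaFour_ne_zero hτ))

lemma theta_quarter_ne_zero (hτ : 0 < τ.im) : theta (π / 4) τ ≠ 0 := by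
  rw [theta_quarter]; exact neg_ne_zero.mpr (thetaQuarter_ne_zero hτ)

lemma thetaD_one_quarter_ne_zero (hτ : 0 < τ.im) : thetaD 1 (π / 4) τ ≠ 0 := by
  rw [thetaD_quarter 1 hτ]
  exact neg_ne_zero.mpr (mul_ne_zero (by simp) (thetaQuarter_one_ne_zero hτ))

lemma thetaD_one_origin_ne_zero (hτ : 0 < τ.im) : thetaD 1 0 τ ≠ 0 := by
  rw [thetaD_origin 1 hτ]
  exact neg_ne_zero.mpr (mul_ne_zero (by simp) (thetaOrigin_one_ne_zero hτ))

lemma theta_quarter_eq_eta (hτ : 0 < τ.im) :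
    theta (π / 4) τ / (Real.sqrt 2 : ℂ) = etaK 1 τ * etaK 4 τ / etaK 2 τ := by
  have h := sqrt_two_ne_zero
  rw [theta_quarter, thetaQuarter_eq hτ]
  field_simp

lemma AFun_eq_lambert (hτ : 0 < τ.im) :
    AFun (π / 4) τ = 1 + 4 * ∑' n : ℕ, nome τ ^ (n + 1) / (1 + nome τ ^ (2 * (n + 1))) := by
  have n := thetaQuarter_ne_zero hτ
  rw [AFun, theta_quarter, thetaD_quarter 1 hτ, neg_div_neg_eq, div_eq_iff n, pow_one,
    thetaQuarter_one_eq hτ, mul_comm]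

lemma AFun_eq_eta (hτ : 0 < τ.im) :
    AFun (π / 4) τ = etaK 2 τ ^ 10 / (etaK 1 τ ^ 4 * etaK 4 τ ^ 4) := by
  rw [AFun_eq hτ, thetaThree_eq hτ]
  ring

lemma RFun_eq_hFun (hτ : 0 < τ.im) : RFun (π / 4) τ = hFun τ / (1 + 16 * hFun τ) := by
  have n3 := thetaThree_ne_zero hτ
  have n4 := thetaFour_ne_zero hτ
  rw [one_add_hFun_eq hτ, hFun_eq hτ, RFun_eq hτ]
  field_simp

lemma RFun_eq_eta (hτ : 0 < τ.im) :
    RFun (π / 4) τ = etaK 1 τ ^ 8 * etaK 4 τ ^ 16 / etaK 2 τ ^ 24 := by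
  have e1 := etaK_ne_zero one_ne_zero hτ
  have e2 := etaK_ne_zero two_ne_zero hτ
  have e4 := etaK_ne_zero four_ne_zero hτ
  rw [RFun_eq hτ, thetaTwo_eq hτ, thetaThree_eq hτ]
  field_simp
  norm_num

lemma SFun_div_four_eq (hτ : 0 < τ.im) :
    SFun (π / 4) τ / 4 = 1 / (RFun (π / 4) τ * (1 - 16 * RFun (π / 4) τ)) := by
  have hA := AFun_ne_zero hτ
  have hR := RFun_ne_zero hτ
  have hR1 := one_sub_RFun_ne_zero hτ
  rw [SFun, coeff_S, qD_RFun hτ]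
  field_simp

lemma SFun_div_four_eq_hFun (hτ : 0 < τ.im) :
    SFun (π / 4) τ / 4 = (1 + 16 * hFun τ) ^ 2 / hFun τ := by
  have n2 := thetaTwo_ne_zero hτ
  have n3 := thetaThree_ne_zero hτ
  have n4 := thetaFour_ne_zero hτ
  rw [SFun_div_four_eq hτ, one_sub_RFun_eq hτ, RFun_eq hτ, one_add_hFun_eq hτ, hFun_eq hτ]
  field_simp

lemma SFun_div_four_eq_eta (hτ : 0 < τ.im) :
    SFun (π / 4) τ / 4 = (etaK 2 τ ^ 2 / (etaK 1 τ * etaK 4 τ)) ^ 24 := by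
  have e1 := etaK_ne_zero one_ne_zero hτ
  have e2 := etaK_ne_zero two_ne_zero hτ
  have e4 := etaK_ne_zero four_ne_zero hτ
  rw [SFun_div_four_eq hτ, one_sub_RFun_eq hτ, RFun_eq_eta hτ, thetaThree_eq hτ, thetaFour_eq hτ]
  field_simp

lemma AFun_mul_AFun_linearIndependent {c d : ℂ}
    (h : ∀ τ ∈ upperHalf, c * AFun (π / 4) τ + d * (τ * AFun (π / 4) τ) = 0) : c = 0 ∧ d = 0 := by
  have key : ∀ τ : ℂ, 0 < τ.im → c + d * τ = 0 := fun τ hτ =>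
    mul_right_cancel₀ (AFun_ne_zero hτ) (by linear_combination h τ hτ)
  have h1 := key I (by simp)
  have h2 := key (2 * I) (by simp)
  have hd : d = 0 := mul_right_cancel₀ I_ne_zero (by linear_combination h2 - h1)
  exact ⟨by simpa [hd] using h1, hd⟩

end SixVertex

/-! ### Power series convergent in the unit disc and `q`-expansions -/

namespace SixVertex

open Complex Filter Topology PowerSeries

/-- The series `p` converges in the unit disc, with sum `F`. -/
def IsDiscSum (p : PowerSeries ℂ) (F : ℂ → ℂ) : Prop :=
  ∀ q : ℂ, ‖q‖ < 1 → HasSum (fun n : ℕ => coeff n p * q ^ n) (F q)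

variable {p p' : PowerSeries ℂ} {F F' : ℂ → ℂ}

lemma IsDiscSum.hasFPowerSeriesOnBall (h : IsDiscSum p F) :
    HasFPowerSeriesOnBall F (FormalMultilinearSeries.ofScalars ℂ fun n => coeff n p) 0 1 where
  r_le := by
    refine ENNReal.le_of_forall_nnreal_lt fun r hr => ?_
    have hr1 : (r : ℝ) < 1 := by exact_mod_cast hr
    have h0 := (h r (by simpa using hr1)).summable.tendsto_atTop_zero.norm
    rw [norm_zero] at h0
    refine FormalMultilinearSeries.le_radius_of_tendsto _ (l := 0) ?_
    refine h0.congr fun n => ?_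
    rw [FormalMultilinearSeries.ofScalars_norm]
    simp
  r_pos := one_pos
  hasSum := by
    intro y hy
    have hy : ‖y‖ < 1 := by
      rwa [← ENNReal.ofReal_one, Metric.eball_ofReal, mem_ball_zero_iff] at hy
    simpa [FormalMultilinearSeries.ofScalars_apply_eq, zero_add, mul_comm] using h y hy

lemma IsDiscSum.differentiableOn (h : IsDiscSum p F) :
    DifferentiableOn ℂ F (Metric.ball 0 1) := by
  have := h.hasFPowerSeriesOnBall.differentiableOn
  rwa [← ENNReal.ofReal_one, Metric.eball_ofReal] at this

lemma IsDiscSum.continuousAt_zero (h : IsDiscSum p F) : ContinuousAt F 0 :=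
  h.hasFPowerSeriesOnBall.hasFPowerSeriesAt.continuousAt

lemma isDiscSum_taylor (h : DifferentiableOn ℂ F (Metric.ball 0 1)) :
    IsDiscSum (PowerSeries.mk fun n => (n.factorial : ℂ)⁻¹ * iteratedDeriv n F 0) F := by
  intro q hq
  have := hasSum_taylorSeries_on_ball h (z := q) (by simpa using hq)
  refine (hasSum_fun_congr fun n => ?_).mp this
  rw [coeff_mk, smul_eq_mul, smul_eq_mul, sub_zero]
  ring

lemma IsDiscSum.unique (h : IsDiscSum p F) (h' : IsDiscSum p' F) : p = p' := by
  have := h.hasFPowerSeriesOnBall.hasFPowerSeriesAt.eq_formalMultilinearSeries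
    h'.hasFPowerSeriesOnBall.hasFPowerSeriesAt
  ext n
  exact congr_fun ((FormalMultilinearSeries.ofScalars_series_eq_iff ..).mp this) n

lemma IsDiscSum.congr (h : IsDiscSum p F) (he : ∀ q, ‖q‖ < 1 → F q = F' q) : IsDiscSum p F' :=
  fun q hq => he q hq ▸ h q hq

lemma IsDiscSum.apply_zero (h : IsDiscSum p F) : F 0 = constantCoeff p := by
  have h0 := h 0 (by simp)
  have h1 := hasSum_single (f := fun n : ℕ => coeff n p * (0 : ℂ) ^ n) 0
    (fun n hn => by simp [hn])
  simpa using h0.unique h1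

lemma IsDiscSum.mul (h : IsDiscSum p F) (h' : IsDiscSum p' F') :
    IsDiscSum (p * p') fun q => F q * F' q := by
  intro q hq
  have n1 := (h q hq).summable.norm
  have n2 := (h' q hq).summable.norm
  have hs := (summable_norm_sum_mul_antidiagonal_of_summable_norm n1 n2).of_norm.hasSum
  rw [← tsum_mul_tsum_eq_tsum_sum_antidiagonal_of_summable_norm n1 n2, (h q hq).tsum_eq,
    (h' q hq).tsum_eq] at hs
  refine (hasSum_fun_congr fun n => ?_).mpr hs
  rw [coeff_mul, Finset.sum_mul]
  refine Finset.sum_congr rfl fun x hx => ?_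
  rw [← Finset.HasAntidiagonal.mem_antidiagonal.mp hx, pow_add]
  ring

lemma isDiscSum_C (c : ℂ) : IsDiscSum (C c) fun _ => c := by
  intro q _
  have h1 := hasSum_single (f := fun n : ℕ => coeff n (C c) * q ^ n) 0
    (fun n hn => by simp [coeff_C, hn])
  simpa using h1

lemma isDiscSum_X : IsDiscSum X fun q => q := by
  intro q _
  have h1 := hasSum_single (f := fun n : ℕ => coeff n (X : PowerSeries ℂ) * q ^ n) 1
    (fun n hn => by simp [coeff_X, hn])
  simpa using h1

/-- The function 1/F is holomorphic in the disc, so its Taylor series converges there; the product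
of this series with p is 1 by uniqueness of expansions. -/
lemma IsDiscSum.inv (h : IsDiscSum p F) (h0 : ∀ q, ‖q‖ < 1 → F q ≠ 0) :
    IsDiscSum p⁻¹ fun q => (F q)⁻¹ := by
  have hd : DifferentiableOn ℂ (fun q => (F q)⁻¹) (Metric.ball 0 1) :=
    h.differentiableOn.inv fun q hq => h0 q (by simpa using hq)
  have ht := isDiscSum_taylor hd
  have hm : PowerSeries.mk (fun n => (n.factorial : ℂ)⁻¹ * iteratedDeriv n (fun q => (F q)⁻¹) 0) *
      p = 1 :=
    (ht.mul h).unique (((isDiscSum_C 1).congr fun q hq =>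
      (inv_mul_cancel₀ (h0 q hq)).symm))
  have hc : constantCoeff p ≠ 0 := h.apply_zero ▸ h0 0 (by simp)
  rwa [(PowerSeries.eq_inv_iff_mul_eq_one hc).mpr hm] at ht

lemma IsDiscSum.deriv (h : IsDiscSum p F) : IsDiscSum (d⁄dX ℂ p) (deriv F) := by
  have hp := h.unique (isDiscSum_taylor h.differentiableOn)
  have ht := isDiscSum_taylor (h.differentiableOn.deriv Metric.isOpen_ball)
  convert ht using 1
  ext n
  rw [coeff_derivative, hp, coeff_mk, coeff_mk, ← iteratedDeriv_succ', Nat.factorial_succ]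
  have := Nat.cast_add_one_ne_zero (R := ℂ) n
  push_cast
  field_simp

/-! ### q-expansions of functions of τ -/

/-- The function `f` on the upper half-plane has the `q`-expansion `p`. -/
def HasQExp (p : PowerSeries ℂ) (f : ℂ → ℂ) : Prop :=
  ∀ τ : ℂ, 0 < τ.im → HasSum (fun n : ℕ => coeff n p * nome τ ^ n) (f τ)

lemma exists_nome_eq {q : ℂ} (hq : ‖q‖ < 1) (h0 : q ≠ 0) : ∃ τ : ℂ, 0 < τ.im ∧ nome τ = q := by
  refine ⟨Function.Periodic.invQParam 1 q, ?_, ?_⟩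
  · rw [Function.Periodic.im_invQParam]
    have h1 : Real.log ‖q‖ < 0 := Real.log_neg (norm_pos_iff.mpr h0) hq
    have := Real.pi_pos
    rw [neg_div, neg_mul, neg_pos]
    exact mul_neg_of_pos_of_neg (by positivity) h1
  · have h := Function.Periodic.qParam_right_inv one_ne_zero h0
    rwa [Function.Periodic.qParam, ofReal_one, div_one] at h

variable {f f' : ℂ → ℂ}

lemma HasQExp.exists_isDiscSum (h : HasQExp p f) :
    ∃ F, IsDiscSum p F ∧ ∀ τ : ℂ, 0 < τ.im → f τ = F (nome τ) := by
  have hs : IsDiscSum p fun q => ∑' n : ℕ, coeff n p * q ^ n := by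
    intro q hq
    refine Summable.hasSum ?_
    rcases eq_or_ne q 0 with rfl | h0
    · exact (hasSum_single (f := fun n : ℕ => coeff n p * (0 : ℂ) ^ n) 0
        (fun n hn => by simp [hn])).summable
    · obtain ⟨τ, hτ, rfl⟩ := exists_nome_eq hq h0
      exact (h τ hτ).summable
  exact ⟨_, hs, fun τ hτ => (h τ hτ).tsum_eq.symm⟩

lemma IsDiscSum.hasQExp (h : IsDiscSum p F) (hf : ∀ τ : ℂ, 0 < τ.im → f τ = F (nome τ)) :
    HasQExp p f := fun τ hτ => by
  rw [hf τ hτ]; exact h _ (norm_nome_lt_one hτ)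

/-- Every q with 0 < |q| < 1 is a value of the nome, so the two sums agree off the origin, and at
the origin by continuity. -/
lemma HasQExp.unique (h : HasQExp p f) (h' : HasQExp p' f) : p = p' := by
  obtain ⟨F, hF, e⟩ := h.exists_isDiscSum
  obtain ⟨F', hF', e'⟩ := h'.exists_isDiscSum
  have he : ∀ q : ℂ, ‖q‖ < 1 → q ≠ 0 → F q = F' q := by
    intro q hq h0
    obtain ⟨τ, hτ, rfl⟩ := exists_nome_eq hq h0
    rw [← e τ hτ, e' τ hτ]
  have h1 := hF.continuousAt_zero.continuousWithinAt (s := {0}ᶜ)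
  have h2 := hF'.continuousAt_zero.continuousWithinAt (s := {0}ᶜ)
  have hev : F =ᶠ[𝓝[≠] 0] F' := by
    filter_upwards [nhdsWithin_le_nhds (Metric.ball_mem_nhds (0 : ℂ) one_pos),
      self_mem_nhdsWithin] with q hq h0
    exact he q (by simpa using hq) h0
  have h0 : F 0 = F' 0 := tendsto_nhds_unique (h1.tendsto.congr' hev) h2.tendsto
  refine hF.unique (hF'.congr fun q hq => ?_)
  rcases eq_or_ne q 0 with rfl | hq0
  · exact h0.symm
  · exact (he q hq hq0).symm

lemma HasQExp.congr (h : HasQExp p f) (he : ∀ τ : ℂ, 0 < τ.im → f τ = f' τ) : HasQExp p f' :=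
  fun τ hτ => he τ hτ ▸ h τ hτ

lemma hasQExp_C (c : ℂ) : HasQExp (C c) fun _ => c := (isDiscSum_C c).hasQExp fun _ _ => rfl

lemma HasQExp.add (h : HasQExp p f) (h' : HasQExp p' f') : HasQExp (p + p') fun τ => f τ + f' τ :=
  fun τ hτ => (hasSum_fun_congr fun n => by rw [map_add, add_mul]).mpr ((h τ hτ).add (h' τ hτ))

lemma HasQExp.neg (h : HasQExp p f) : HasQExp (-p) fun τ => -f τ :=
  fun τ hτ => (hasSum_fun_congr fun n => by rw [map_neg, neg_mul]).mpr ((h τ hτ).neg)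

lemma HasQExp.sub (h : HasQExp p f) (h' : HasQExp p' f') : HasQExp (p - p') fun τ => f τ - f' τ :=
  fun τ hτ => (hasSum_fun_congr fun n => by rw [map_sub, sub_mul]).mpr ((h τ hτ).sub (h' τ hτ))

lemma HasQExp.mul (h : HasQExp p f) (h' : HasQExp p' f') :
    HasQExp (p * p') fun τ => f τ * f' τ := by
  obtain ⟨F, hF, e⟩ := h.exists_isDiscSum
  obtain ⟨F', hF', e'⟩ := h'.exists_isDiscSum
  exact (hF.mul hF').hasQExp fun τ hτ => by rw [e τ hτ, e' τ hτ]

lemma HasQExp.pow (h : HasQExp p f) (k : ℕ) : HasQExp (p ^ k) fun τ => f τ ^ k := by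
  induction k with
  | zero => simpa using hasQExp_C 1
  | succ k ih => simpa only [pow_succ] using ih.mul h

lemma HasQExp.inv (h : HasQExp p f) (hc : constantCoeff p ≠ 0)
    (h0 : ∀ τ : ℂ, 0 < τ.im → f τ ≠ 0) : HasQExp p⁻¹ fun τ => (f τ)⁻¹ := by
  obtain ⟨F, hF, e⟩ := h.exists_isDiscSum
  have hi : ∀ q : ℂ, ‖q‖ < 1 → F q ≠ 0 := by
    intro q hq
    -- The point q = 0 corresponds to no τ; there the hypothesis on the constant coefficient is
    -- used.
    rcases eq_or_ne q 0 with rfl | hq0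
    · rwa [hF.apply_zero]
    · obtain ⟨τ, hτ, rfl⟩ := exists_nome_eq hq hq0
      rw [← e τ hτ]; exact h0 τ hτ
  exact (hF.inv hi).hasQExp fun τ hτ => by rw [e τ hτ]

lemma hasDerivAt_nome (τ : ℂ) : HasDerivAt nome (2 * π * I * nome τ) τ := by
  have h := ((hasDerivAt_id τ).const_mul (2 * π * I)).cexp
  exact h.congr_deriv (by rw [id, mul_one, mul_comm, nome])

lemma HasQExp.qD (h : HasQExp p f) : HasQExp (X * d⁄dX ℂ p) (qD f) := by
  obtain ⟨F, hF, e⟩ := h.exists_isDiscSum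
  refine (isDiscSum_X.mul hF.deriv).hasQExp fun τ hτ => ?_
  have hd : HasDerivAt F (deriv F (nome τ)) (nome τ) :=
    (hF.differentiableOn.differentiableAt (Metric.isOpen_ball.mem_nhds
      (by simpa using norm_nome_lt_one hτ))).hasDerivAt
  refine qD_eq_of_hasDerivAt ?_
  refine (HasDerivAt.congr_deriv (HasDerivAt.comp τ hd (hasDerivAt_nome τ))
    (by ring)).congr_of_eventuallyEq (eventuallyEq_of_upperHalf (fun σ hσ => e σ hσ) hτ)

end SixVertex

/-! ### The `q`-expansions of `ϑ`, `t`, `R` and `A` -/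

namespace SixVertex

open Complex Filter Topology PowerSeries

lemma iteratedDeriv_sin_mul (k : ℕ) (c z : ℂ) :
    iteratedDeriv k (fun w => Complex.sin (c * w)) z =
      I / 2 * ((-(c * I)) ^ k * cexp (-(c * z * I)) - (c * I) ^ k * cexp (c * z * I)) := by
  induction k generalizing z with
  | zero =>
    rw [iteratedDeriv_zero, Complex.sin, neg_mul]
    ring
  | succ k ih =>
    rw [iteratedDeriv_succ, funext ih]
    have h0 := (((hasDerivAt_id z).const_mul c).mul_const I).cexp
    have h1 := (((hasDerivAt_id z).const_mul c).mul_const I).fun_neg.cexp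
    have h := ((h1.const_mul ((-(c * I)) ^ k)).fun_sub (h0.const_mul ((c * I) ^ k))).const_mul
      (I / 2)
    refine h.deriv.trans ?_
    simp only [id]
    ring

/-- The coefficient of `q ^ (n (n + 1) / 2)` in `q ^ (-1 / 8)` times the `k`-th derivative
of `ϑ(z, q)`. -/
noncomputable def thetaCoeff (k : ℕ) (z : ℂ) (n : ℕ) : ℂ :=
  2 * (-1) ^ n * iteratedDeriv k (fun w : ℂ => Complex.sin ((2 * (n : ℂ) + 1) * w)) z

lemma two_mul_triangle (n : ℕ) : 2 * (n * (n + 1) / 2) = n * (n + 1) :=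
  Nat.mul_div_cancel' (Nat.even_mul_succ_self n).two_dvd

lemma mul_succ_injective {m n : ℕ} (h : m * (m + 1) = n * (n + 1)) : m = n := by
  rcases lt_trichotomy m n with h1 | h1 | h1
  · nlinarith
  · exact h1
  · nlinarith

lemma coeff_thetaSeries_triangle (k : ℕ) (z : ℂ) (n : ℕ) :
    coeff (n * (n + 1) / 2) (thetaSeries k z) = thetaCoeff k z n := by
  have h2 := two_mul_triangle n
  rw [thetaSeries, coeff_mk, Finset.sum_eq_single n]
  · rw [if_pos h2.symm, thetaCoeff]
  · intro m _ hm
    exact if_neg fun h => hm (mul_succ_injective (h.trans h2))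
  · intro h
    refine absurd ?_ h
    rw [Finset.mem_range]
    rcases Nat.eq_zero_or_pos n with rfl | hn
    · simp
    · nlinarith

lemma coeff_thetaSeries_eq_zero (k : ℕ) (z : ℂ) {m : ℕ} (hm : ∀ n, n * (n + 1) / 2 ≠ m) :
    coeff m (thetaSeries k z) = 0 := by
  rw [thetaSeries, coeff_mk]
  refine Finset.sum_eq_zero fun n _ => if_neg fun h => hm n ?_
  have := two_mul_triangle n
  omega

lemma exp_mul_nome_pow (τ : ℂ) (n : ℕ) : cexp (π * I * τ / 4) * nome τ ^ (n * (n + 1) / 2) =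
    cexp (π * I * τ * ((n : ℂ) + 1 / 2) ^ 2) := by
  have h : (2 : ℂ) * ((n * (n + 1) / 2 : ℕ) : ℂ) = n * (n + 1) := by
    exact_mod_cast congrArg (Nat.cast (R := ℂ)) (two_mul_triangle n)
  rw [nome, ← exp_nat_mul, ← exp_add]
  congr 1
  linear_combination π * I * τ * h

/-- The indices n and -(n + 1) share the exponent (n + 1/2)², and their exponentials in z combine
into a derivative of sin((2n + 1)z). -/
lemma thetaCoeff_term (k : ℕ) (z τ : ℂ) (n : ℕ) :
    -((2 * I) ^ k * (gaussTerm k (z / π + 1 / 2) (1 / 2) (τ / 2) n +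
      gaussTerm k (z / π + 1 / 2) (1 / 2) (τ / 2) (-((n : ℤ) + 1)))) =
      cexp (π * I * τ / 4) * (thetaCoeff k z n * nome τ ^ (n * (n + 1) / 2)) := by
  have hpi : (π : ℂ) ≠ 0 := ofReal_ne_zero.mpr Real.pi_ne_zero
  have hn : cexp (n * (π * I)) = (-1) ^ n := by rw [exp_nat_mul, exp_pi_mul_I]
  have hn' : cexp (-(n * (π * I))) = (-1) ^ n := by
    rw [exp_neg, hn, ← inv_pow, inv_neg, inv_one]
  have h2 : cexp (π / 2 * I) = I := exp_pi_div_two_mul_I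
  have h3 : cexp (-(π / 2 * I)) = -I := by rw [exp_neg, h2, inv_I]
  have e1 : gaussTerm k (z / π + 1 / 2) (1 / 2) (τ / 2) n = ((n : ℂ) + 1 / 2) ^ k *
      (cexp (π * I * τ * ((n : ℂ) + 1 / 2) ^ 2) * (cexp ((2 * n + 1) * z * I) *
        ((-1) ^ n * I))) := by
    rw [show ((-1) ^ n * I : ℂ) = cexp (n * (π * I)) * cexp (π / 2 * I) by rw [hn, h2],
      ← exp_add, ← exp_add, ← exp_add, gaussTerm]
    push_cast
    congr 2
    field_simp
  have e2 : gaussTerm k (z / π + 1 / 2) (1 / 2) (τ / 2) (-((n : ℤ) + 1)) =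
      (-((n : ℂ) + 1 / 2)) ^ k * (cexp (π * I * τ * ((n : ℂ) + 1 / 2) ^ 2) *
        (cexp (-((2 * n + 1) * z * I)) * ((-1) ^ n * -I))) := by
    rw [show ((-1) ^ n * -I : ℂ) = cexp (-(n * (π * I))) * cexp (-(π / 2 * I)) by rw [hn', h3],
      ← exp_add, ← exp_add, ← exp_add, gaussTerm]
    push_cast
    congr 2
    · ring
    · field_simp
      ring
  rw [e1, e2, mul_left_comm (cexp (π * I * τ / 4)), exp_mul_nome_pow, thetaCoeff,
    iteratedDeriv_sin_mul,
    show (2 * (n : ℂ) + 1) * I = (2 * I) * ((n : ℂ) + 1 / 2) by ring,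
    show -(2 * I * ((n : ℂ) + 1 / 2)) = 2 * I * -((n : ℂ) + 1 / 2) by ring, mul_pow (2 * I),
    mul_pow (2 * I)]
  ring

/-- The prefactor is q^{-1/8}. The terms n and -(n + 1) are summed in pairs, and since n ↦ n(n +
1)/2 is injective the sum can be reindexed by the exponent of q. -/
lemma hasQExp_thetaSeries (k : ℕ) (z : ℂ) :
    HasQExp (thetaSeries k z) fun τ => cexp (-(π * I * τ / 4)) * thetaD k z τ := by
  intro τ hτ
  have hτ2 : 0 < (τ / 2).im := by simpa using hτ
  have h := (summable_gaussTerm k (z / π + 1 / 2) (1 / 2) hτ2).hasSum.nat_add_neg_add_one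
  have hs := (h.mul_left ((2 * I) ^ k)).neg.mul_left (cexp (-(π * I * τ / 4)))
  have hinj : Function.Injective fun n : ℕ => n * (n + 1) / 2 := fun m n h => by
    have h' : m * (m + 1) / 2 = n * (n + 1) / 2 := h
    refine mul_succ_injective ?_
    rw [← two_mul_triangle m, ← two_mul_triangle n, h']
  rw [← hinj.hasSum_iff]
  · change HasSum _ (cexp (-(π * I * τ / 4)) * thetaD k z τ)
    rw [thetaD_eq_gaussSum k z hτ, gaussSum]
    refine (hasSum_fun_congr fun n => ?_).mp hs
    rw [thetaCoeff_term, ← mul_assoc, ← exp_add, neg_add_cancel, exp_zero, one_mul,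
      Function.comp_apply, coeff_thetaSeries_triangle]
  · intro m hm
    rw [coeff_thetaSeries_eq_zero k z fun n hn => hm ⟨n, hn⟩, zero_mul]

lemma constantCoeff_thetaSeries (k : ℕ) (z : ℂ) :
    constantCoeff (thetaSeries k z) = 2 * iteratedDeriv k Complex.sin z := by
  have h := coeff_thetaSeries_triangle k z 0
  simpa [thetaCoeff] using h

lemma coeff_one_thetaSeries (k : ℕ) (z : ℂ) :
    coeff 1 (thetaSeries k z) = -(2 * iteratedDeriv k (fun w => Complex.sin (3 * w)) z) := by
  have h := coeff_thetaSeries_triangle k z 1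
  rw [thetaCoeff] at h
  norm_num at h
  exact h

/-! ### The coefficients of 1 and q -/

lemma iteratedDeriv_one_sin_mul (c z : ℂ) :
    iteratedDeriv 1 (fun w => Complex.sin (c * w)) z =
      c * Complex.cos (c * z) := by
  rw [iteratedDeriv_one]
  refine (((hasDerivAt_id z).const_mul c).csin).deriv.trans ?_
  simp only [id]; ring

lemma iteratedDeriv_two_sin_mul (c z : ℂ) :
    iteratedDeriv 2 (fun w => Complex.sin (c * w)) z =
      -c ^ 2 * Complex.sin (c * z) := by
  rw [iteratedDeriv_succ, funext (iteratedDeriv_one_sin_mul c)]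
  refine ((((hasDerivAt_id z).const_mul c).ccos).const_mul c).deriv.trans ?_
  simp only [id]; ring

lemma iteratedDeriv_three_sin_mul (c z : ℂ) :
    iteratedDeriv 3 (fun w => Complex.sin (c * w)) z =
      -c ^ 3 * Complex.cos (c * z) := by
  rw [iteratedDeriv_succ, funext (iteratedDeriv_two_sin_mul c)]
  refine ((((hasDerivAt_id z).const_mul c).csin).const_mul (-c ^ 2)).deriv.trans ?_
  simp only [id]; ring

lemma sin_three_mul_pi_div_four : Complex.sin (3 * (π / 4)) = (Real.sqrt 2 : ℂ) / 2 := by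
  rw [show (3 : ℂ) * (π / 4) = π - π / 4 by ring, Complex.sin_pi_sub, sin_pi_div_four_complex]

lemma cos_three_mul_pi_div_four : Complex.cos (3 * (π / 4)) = -((Real.sqrt 2 : ℂ) / 2) := by
  rw [show (3 : ℂ) * (π / 4) = π - π / 4 by ring, Complex.cos_pi_sub, cos_pi_div_four_complex]

lemma constantCoeff_thetaSeries' (k : ℕ) (z : ℂ) : constantCoeff (thetaSeries k z) =
    2 * iteratedDeriv k (fun w => Complex.sin (1 * w)) z := by
  rw [constantCoeff_thetaSeries]; simp only [one_mul]

lemma constantCoeff_thetaSeries_quarter_zero :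
    constantCoeff (thetaSeries 0 (π / 4)) = (Real.sqrt 2 : ℂ) := by
  rw [constantCoeff_thetaSeries, iteratedDeriv_zero, sin_pi_div_four_complex]; ring

lemma constantCoeff_thetaSeries_quarter_one :
    constantCoeff (thetaSeries 1 (π / 4)) = (Real.sqrt 2 : ℂ) := by
  rw [constantCoeff_thetaSeries', iteratedDeriv_one_sin_mul, one_mul, one_mul,
    cos_pi_div_four_complex]
  ring

lemma constantCoeff_thetaSeries_quarter_two :
    constantCoeff (thetaSeries 2 (π / 4)) = -(Real.sqrt 2 : ℂ) := by
  rw [constantCoeff_thetaSeries', iteratedDeriv_two_sin_mul, one_mul, sin_pi_div_four_complex]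
  ring

lemma constantCoeff_thetaSeries_quarter_three :
    constantCoeff (thetaSeries 3 (π / 4)) = -(Real.sqrt 2 : ℂ) := by
  rw [constantCoeff_thetaSeries', iteratedDeriv_three_sin_mul, one_mul, cos_pi_div_four_complex]
  ring

lemma constantCoeff_thetaSeries_origin_one : constantCoeff (thetaSeries 1 0) = 2 := by
  rw [constantCoeff_thetaSeries', iteratedDeriv_one_sin_mul, mul_zero, Complex.cos_zero]
  ring

lemma constantCoeff_thetaSeries_origin_three : constantCoeff (thetaSeries 3 0) = -2 := by
  rw [constantCoeff_thetaSeries', iteratedDeriv_three_sin_mul, mul_zero, Complex.cos_zero]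
  ring

lemma coeff_one_thetaSeries_quarter_zero :
    coeff 1 (thetaSeries 0 (π / 4)) = -(Real.sqrt 2 : ℂ) := by
  rw [coeff_one_thetaSeries, iteratedDeriv_zero, sin_three_mul_pi_div_four]; ring

lemma coeff_one_thetaSeries_quarter_one :
    coeff 1 (thetaSeries 1 (π / 4)) = 3 * (Real.sqrt 2 : ℂ) := by
  rw [coeff_one_thetaSeries, iteratedDeriv_one_sin_mul, cos_three_mul_pi_div_four]; ring

lemma coeff_one_thetaSeries_quarter_two :
    coeff 1 (thetaSeries 2 (π / 4)) = 9 * (Real.sqrt 2 : ℂ) := by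
  rw [coeff_one_thetaSeries, iteratedDeriv_two_sin_mul, sin_three_mul_pi_div_four]; ring

lemma coeff_one_thetaSeries_quarter_three :
    coeff 1 (thetaSeries 3 (π / 4)) = -(27 * (Real.sqrt 2 : ℂ)) := by
  rw [coeff_one_thetaSeries, iteratedDeriv_three_sin_mul, cos_three_mul_pi_div_four]; ring

lemma coeff_one_thetaSeries_origin_one : coeff 1 (thetaSeries 1 0) = -6 := by
  rw [coeff_one_thetaSeries, iteratedDeriv_one_sin_mul, mul_zero, Complex.cos_zero]; ring

lemma coeff_one_thetaSeries_origin_three : coeff 1 (thetaSeries 3 0) = 54 := by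
  rw [coeff_one_thetaSeries, iteratedDeriv_three_sin_mul, mul_zero, Complex.cos_zero]; ring

lemma coeff_one_mul_eq (p p' : PowerSeries ℂ) : coeff 1 (p * p') =
    constantCoeff p * coeff 1 p' + coeff 1 p * constantCoeff p' := by
  rw [coeff_mul, Finset.Nat.antidiagonal_succ]
  simp

/-- Clearing denominators lets the first two coefficients be compared without expanding an inverse
series. -/
lemma tSeries_mul : tSeries (π / 4) * (thetaSeries 1 (π / 4) * thetaSeries 1 (π / 4)) =
    C (1 / 32) * (-(thetaSeries 0 (π / 4) * thetaSeries 3 (π / 4)) +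
      thetaSeries 2 (π / 4) * thetaSeries 1 (π / 4)) := by
  have h : thetaSeries 1 (π / 4) * (thetaSeries 1 (π / 4))⁻¹ = 1 :=
    PowerSeries.mul_inv_cancel _ (by
      rw [constantCoeff_thetaSeries_quarter_one]; exact sqrt_two_ne_zero)
  rw [tSeries, coeff_t]
  linear_combination C (1 / 32) * (-(thetaSeries 0 (π / 4) * thetaSeries 3 (π / 4)) *
    (thetaSeries 1 (π / 4) * (thetaSeries 1 (π / 4))⁻¹ + 1) +
      thetaSeries 2 (π / 4) * thetaSeries 1 (π / 4)) * h

lemma RSeries_mul : RSeries (π / 4) *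
    ((thetaSeries 1 (π / 4) * thetaSeries 1 (π / 4)) * (thetaSeries 1 (π / 4) * thetaSeries 1 0)) =
    C (1 / 48) * ((thetaSeries 0 (π / 4) * thetaSeries 0 (π / 4)) *
      (-(thetaSeries 3 (π / 4) * thetaSeries 1 0) + thetaSeries 3 0 * thetaSeries 1 (π / 4))) := by
  have h : thetaSeries 1 (π / 4) * (thetaSeries 1 (π / 4))⁻¹ = 1 :=
    PowerSeries.mul_inv_cancel _ (by
      rw [constantCoeff_thetaSeries_quarter_one]; exact sqrt_two_ne_zero)
  have h' : thetaSeries 1 0 * (thetaSeries 1 0)⁻¹ = 1 :=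
    PowerSeries.mul_inv_cancel _ (by rw [constantCoeff_thetaSeries_origin_one]; exact two_ne_zero)
  rw [RSeries, coeff_R]
  generalize thetaSeries 1 (π / 4) = a at *
  generalize a⁻¹ = b at *
  generalize thetaSeries 1 0 = c at *
  generalize c⁻¹ = d at *
  have e : (C (1 / 48) * (thetaSeries 0 (π / 4) ^ 2 * b ^ 2) *
      (-(thetaSeries 3 (π / 4) * b) + thetaSeries 3 0 * d)) * ((a * a) * (a * c)) =
      C (1 / 48) * thetaSeries 0 (π / 4) ^ 2 * (a * b) ^ 2 *
        (-(thetaSeries 3 (π / 4) * c * (a * b)) + thetaSeries 3 0 * a * (c * d)) := by ring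
  rw [e, h, h']
  ring

lemma constantCoeff_tSeries : constantCoeff (tSeries (π / 4)) = 0 := by
  have h := congrArg constantCoeff tSeries_mul
  simp only [map_mul, map_add, map_neg, constantCoeff_C, constantCoeff_thetaSeries_quarter_zero,
    constantCoeff_thetaSeries_quarter_one, constantCoeff_thetaSeries_quarter_two,
    constantCoeff_thetaSeries_quarter_three] at h
  refine mul_right_cancel₀ (mul_ne_zero sqrt_two_ne_zero sqrt_two_ne_zero) ?_
  linear_combination h

lemma constantCoeff_RSeries : constantCoeff (RSeries (π / 4)) = 0 := by
  have h := congrArg constantCoeff RSeries_mul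
  simp only [map_mul, map_add, map_neg, constantCoeff_C, constantCoeff_thetaSeries_quarter_zero,
    constantCoeff_thetaSeries_quarter_one, constantCoeff_thetaSeries_origin_one,
    constantCoeff_thetaSeries_quarter_three, constantCoeff_thetaSeries_origin_three] at h
  refine mul_right_cancel₀ (mul_ne_zero (mul_ne_zero sqrt_two_ne_zero sqrt_two_ne_zero)
    (mul_ne_zero sqrt_two_ne_zero two_ne_zero)) ?_
  linear_combination h

lemma coeff_one_tSeries : coeff 1 (tSeries (π / 4)) = 1 := by
  have h := congrArg (coeff 1) tSeries_mul
  simp only [coeff_one_mul_eq, map_mul, map_add, map_neg, constantCoeff_C, coeff_C,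
    constantCoeff_thetaSeries_quarter_zero, constantCoeff_tSeries,
    constantCoeff_thetaSeries_quarter_one, constantCoeff_thetaSeries_quarter_two,
    constantCoeff_thetaSeries_quarter_three, coeff_one_thetaSeries_quarter_zero,
    coeff_one_thetaSeries_quarter_one, coeff_one_thetaSeries_quarter_two,
    coeff_one_thetaSeries_quarter_three] at h
  norm_num at h
  refine mul_right_cancel₀ (mul_ne_zero sqrt_two_ne_zero sqrt_two_ne_zero) ?_
  linear_combination h

lemma coeff_one_RSeries : coeff 1 (RSeries (π / 4)) = 1 := by
  have h := congrArg (coeff 1) RSeries_mul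
  simp only [coeff_one_mul_eq, map_mul, map_add, map_neg, constantCoeff_C, coeff_C,
    constantCoeff_thetaSeries_quarter_zero, constantCoeff_RSeries,
    constantCoeff_thetaSeries_quarter_one, constantCoeff_thetaSeries_origin_one,
    constantCoeff_thetaSeries_quarter_three, constantCoeff_thetaSeries_origin_three,
    coeff_one_thetaSeries_quarter_zero,
    coeff_one_thetaSeries_quarter_one, coeff_one_thetaSeries_origin_one,
    coeff_one_thetaSeries_quarter_three, coeff_one_thetaSeries_origin_three] at h
  norm_num at h
  refine mul_right_cancel₀ (mul_ne_zero (mul_ne_zero sqrt_two_ne_zero sqrt_two_ne_zero)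
    (mul_ne_zero sqrt_two_ne_zero two_ne_zero)) ?_
  linear_combination h

lemma hasQExp_tSeries : HasQExp (tSeries (π / 4)) (tFun (π / 4)) := by
  have h0 := hasQExp_thetaSeries 0 (π / 4)
  have h1 := hasQExp_thetaSeries 1 (π / 4)
  have h2 := hasQExp_thetaSeries 2 (π / 4)
  have h3 := hasQExp_thetaSeries 3 (π / 4)
  have hi := h1.inv (by rw [constantCoeff_thetaSeries_quarter_one]; exact sqrt_two_ne_zero)
    fun τ hτ => mul_ne_zero (exp_ne_zero _) (thetaD_one_quarter_ne_zero hτ)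
  refine ((hasQExp_C _).mul (((h0.mul h3).mul (hi.pow 2)).neg.add (h2.mul hi))).congr ?_
  intro τ hτ
  have n1 := thetaD_one_quarter_ne_zero hτ
  have ne := exp_ne_zero (-(π * I * τ / 4))
  rw [tFun, show theta (π / 4) τ = thetaD 0 (π / 4) τ by rw [thetaD, iteratedDeriv_zero]]
  generalize cexp (-(π * I * τ / 4)) = e at *
  congr 1
  field_simp

lemma hasQExp_RSeries : HasQExp (RSeries (π / 4)) (RFun (π / 4)) := by
  have h0 := hasQExp_thetaSeries 0 (π / 4)
  have h1 := hasQExp_thetaSeries 1 (π / 4)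
  have k1 := hasQExp_thetaSeries 1 0
  have k3 := hasQExp_thetaSeries 3 0
  have h3 := hasQExp_thetaSeries 3 (π / 4)
  have hi := h1.inv (by rw [constantCoeff_thetaSeries_quarter_one]; exact sqrt_two_ne_zero)
    fun τ hτ => mul_ne_zero (exp_ne_zero _) (thetaD_one_quarter_ne_zero hτ)
  have ki := k1.inv (by rw [constantCoeff_thetaSeries_origin_one]; exact two_ne_zero)
    fun τ hτ => mul_ne_zero (exp_ne_zero _) (thetaD_one_origin_ne_zero hτ)
  refine (((hasQExp_C _).mul ((h0.pow 2).mul (hi.pow 2))).mul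
    ((h3.mul hi).neg.add (k3.mul ki))).congr ?_
  intro τ hτ
  have n1 := thetaD_one_quarter_ne_zero hτ
  have m1 := thetaD_one_origin_ne_zero hτ
  have ne := exp_ne_zero (-(π * I * τ / 4))
  rw [RFun, show theta (π / 4) τ = thetaD 0 (π / 4) τ by rw [thetaD, iteratedDeriv_zero]]
  generalize cexp (-(π * I * τ / 4)) = e at *
  congr 1
  · congr 1
    field_simp
  · field_simp

lemma hasQExp_ASeries : HasQExp (ASeries (π / 4)) (AFun (π / 4)) := by
  have h0 := hasQExp_thetaSeries 0 (π / 4)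
  have h1 := hasQExp_thetaSeries 1 (π / 4)
  have e0 (τ : ℂ) : thetaD 0 (π / 4) τ = theta (π / 4) τ := by rw [thetaD, iteratedDeriv_zero]
  have hi := h0.inv (by rw [constantCoeff_thetaSeries_quarter_zero]; exact sqrt_two_ne_zero)
    fun τ hτ => mul_ne_zero (exp_ne_zero _) (by rw [e0]; exact theta_quarter_ne_zero hτ)
  refine (h1.mul hi).congr fun τ hτ => ?_
  have n0 := theta_quarter_ne_zero hτ
  have ne := exp_ne_zero (-(π * I * τ / 4))
  rw [AFun, e0]
  generalize cexp (-(π * I * τ / 4)) = e at *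
  field_simp

lemma constantCoeff_ASeries : constantCoeff (ASeries (π / 4)) = 1 := by
  rw [ASeries, map_mul, constantCoeff_inv, constantCoeff_thetaSeries_quarter_zero,
    constantCoeff_thetaSeries_quarter_one, mul_inv_cancel₀ sqrt_two_ne_zero]

/-- This and the next two statements move the closed system from functions of τ to power series, by
uniqueness of q-expansions. -/
lemma X_mul_derivative_tSeries : X * d⁄dX ℂ (tSeries (π / 4)) =
    ASeries (π / 4) ^ 3 * RSeries (π / 4) * (1 - C 16 * RSeries (π / 4)) :=
  hasQExp_tSeries.qD.unique ((((hasQExp_ASeries.pow 3).mul hasQExp_RSeries).mul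
    ((hasQExp_C 1).sub ((hasQExp_C 16).mul hasQExp_RSeries))).congr fun _ hτ =>
      (qD_eq_of_hasDerivAt (hasDerivAt_tFun hτ)).symm)

lemma X_mul_derivative_RSeries : X * d⁄dX ℂ (RSeries (π / 4)) =
    ASeries (π / 4) ^ 2 * RSeries (π / 4) * (1 - C 16 * RSeries (π / 4)) :=
  hasQExp_RSeries.qD.unique ((((hasQExp_ASeries.pow 2).mul hasQExp_RSeries).mul
    ((hasQExp_C 1).sub ((hasQExp_C 16).mul hasQExp_RSeries))).congr fun _ hτ =>
      (qD_RFun hτ).symm)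

lemma X_mul_derivative_ASeries : X * d⁄dX ℂ (ASeries (π / 4)) =
    C 4 * tSeries (π / 4) * ASeries (π / 4) ^ 2 :=
  hasQExp_ASeries.qD.unique ((((hasQExp_C 4).mul hasQExp_tSeries).mul
    (hasQExp_ASeries.pow 2)).congr fun _ hτ =>
      (qD_eq_of_hasDerivAt (hasDerivAt_AFun hτ)).symm)

end SixVertex

/-! ### Hypergeometric series and composition of power series -/

namespace SixVertex

open Complex Filter Topology PowerSeries

lemma coeff_hypSeries_zero (a b c : ℂ) : coeff 0 (hypSeries a b c) = 1 := by
  rw [hypSeries, coeff_mk, ordinaryHypergeometricCoefficient]; simp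

lemma constantCoeff_hypSeries (a b c : ℂ) : constantCoeff (hypSeries a b c) = 1 := by
  rw [← coeff_zero_eq_constantCoeff_apply, coeff_hypSeries_zero]

lemma coeff_hypSeries_succ (a b c : ℂ) (n : ℕ) : coeff (n + 1) (hypSeries a b c) =
    coeff n (hypSeries a b c) * ((a + n) * (b + n) / ((n + 1) * (c + n))) := by
  simp only [hypSeries, coeff_mk, ordinaryHypergeometricCoefficient, ascPochhammer_succ_eval,
    Nat.factorial_succ, Nat.cast_mul,
    Nat.cast_succ, mul_inv, div_eq_mul_inv]
  ring

lemma coeff_hypSeries_two (n : ℕ) : coeff n (hypSeries (1 / 2) (1 / 2) 1) =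
    (n + 1) * coeff n (hypSeries (1 / 2) (1 / 2) 2) := by
  induction n with
  | zero => simp [coeff_hypSeries_zero]
  | succ n ih =>
    have h1 : (n : ℂ) + 1 ≠ 0 := Nat.cast_add_one_ne_zero n
    have h2 : (2 : ℂ) + n ≠ 0 := by
      have := Nat.cast_add_one_ne_zero (R := ℂ) (n + 1)
      rwa [Nat.cast_succ, add_assoc, add_comm, one_add_one_eq_two] at this
    rw [coeff_hypSeries_succ, coeff_hypSeries_succ, ih, add_comm (1 : ℂ) n]
    push_cast
    field_simp
    ring

/-- With the next lemma: the functions x ₂F₁(1/2, 1/2; 2; x) and ₂F₁(1/2, 1/2; 1; x) satisfy the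
system of 16t and A in the variable x = 16R. -/
lemma derivative_X_mul_hypSeries : d⁄dX ℂ (X * hypSeries (1 / 2) (1 / 2) 2) =
    hypSeries (1 / 2) (1 / 2) 1 := by
  ext n
  rw [coeff_derivative, coeff_succ_X_mul, coeff_hypSeries_two, mul_comm]

lemma derivative_hypSeries : C 4 * (X * (1 - X)) * d⁄dX ℂ (hypSeries (1 / 2) (1 / 2) 1) =
    X * hypSeries (1 / 2) (1 / 2) 2 := by
  have e : C 4 * (X * (1 - X)) * d⁄dX ℂ (hypSeries (1 / 2) (1 / 2) 1) =
    X * (C 4 * (d⁄dX ℂ (hypSeries (1 / 2) (1 / 2) 1) -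
      X * d⁄dX ℂ (hypSeries (1 / 2) (1 / 2) 1))) := by ring
  rw [e]
  congr 1
  ext n
  have h2 := coeff_hypSeries_two n
  have h1 : (n : ℂ) + 1 ≠ 0 := Nat.cast_add_one_ne_zero n
  have hs := coeff_hypSeries_succ (1 / 2) (1 / 2) 1 n
  rw [add_comm (1 : ℂ) n] at hs
  have hx : coeff n (X * d⁄dX ℂ (hypSeries (1 / 2) (1 / 2) 1)) =
      n * coeff n (hypSeries (1 / 2) (1 / 2) 1) := by
    cases n with
    | zero => simp
    | succ m => rw [coeff_succ_X_mul, coeff_derivative]; push_cast; ring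
  rw [coeff_C_mul, map_sub, hx, coeff_derivative, hs, h2]
  field_simp
  ring

lemma eq_C_of_derivative_eq_zero {p : PowerSeries ℂ} (h : d⁄dX ℂ p = 0) :
    p = C (constantCoeff p) :=
  derivative.ext (by rw [h, derivative_C]) (by simp)

/-! ### Composition and compositional inverses -/

lemma hasSubst_of_constantCoeff {p : PowerSeries ℂ} (h : constantCoeff p = 0) : HasSubst p :=
  HasSubst.of_constantCoeff_zero' h

lemma constantCoeff_comp_of_eq_zero {f g : PowerSeries ℂ} (hg : constantCoeff g = 0) :
    constantCoeff (comp f g) = constantCoeff f := by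
  have h := constantCoeff_subst_eq_zero (R := ℂ) (S := ℂ) hg (f - C (constantCoeff f)) (by simp)
  rw [subst_sub (hasSubst_of_constantCoeff hg), subst_C] at h
  have h' : constantCoeff (comp f g - C (constantCoeff f)) = 0 := h
  rw [map_sub, constantCoeff_C, sub_eq_zero] at h'
  exact h'

section comp

variable {f f' g k : PowerSeries ℂ}

lemma comp_mul (hg : constantCoeff g = 0) : comp (f * f') g = comp f g * comp f' g :=
  subst_mul (hasSubst_of_constantCoeff hg) f f'

lemma comp_sub (hg : constantCoeff g = 0) : comp (f - f') g = comp f g - comp f' g :=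
  subst_sub (hasSubst_of_constantCoeff hg) f f'

lemma comp_X_left (hg : constantCoeff g = 0) : comp X g = g :=
  subst_X (hasSubst_of_constantCoeff hg)

lemma comp_C (c : ℂ) : comp (C c) g = C c := subst_C c

lemma comp_one : comp 1 g = 1 := comp_C 1

lemma comp_assoc (hg : constantCoeff g = 0) (hk : constantCoeff k = 0) :
    comp (comp f g) k = comp f (comp g k) :=
  subst_comp_subst_apply (hasSubst_of_constantCoeff hg) (hasSubst_of_constantCoeff hk) f

lemma derivative_comp (hg : constantCoeff g = 0) :
    d⁄dX ℂ (comp f g) = comp (d⁄dX ℂ f) g * d⁄dX ℂ g :=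
  derivative_subst (hasSubst_of_constantCoeff hg)

/-- A power series without constant term and with linear coefficient `1` has a two-sided
compositional inverse. -/
lemma exists_comp_inverse (h0 : constantCoeff f = 0) (h1 : coeff 1 f = 1) :
    ∃ u, constantCoeff u = 0 ∧ comp f u = X ∧ comp u f = X := by
  have hu : IsUnit (coeff 1 f) := h1 ▸ isUnit_one
  exact ⟨substInvOfIsUnit f hu, constantCoeff_substInvOfIsUnit f hu,
    subst_substInvOfIsUnit_right f h0 hu, subst_substInvOfIsUnit_left f h0 hu⟩

lemma comp_right_inverse_unique (h0 : constantCoeff f = 0) (h1 : coeff 1 f = 1)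
    (hg : constantCoeff g = 0) (hk : constantCoeff k = 0) (eg : comp f g = X)
    (ek : comp f k = X) : g = k := by
  obtain ⟨u, _, _, hu⟩ := exists_comp_inverse h0 h1
  rw [← comp_X_left hg, ← comp_X_left hk, ← hu, comp_assoc h0 hg, comp_assoc h0 hk, eg, ek]

end comp

lemma constantCoeff_sixteen_RSeries : constantCoeff (C 16 * RSeries (π / 4)) = 0 := by
  rw [map_mul, constantCoeff_RSeries, mul_zero]

lemma eq_of_X_mul_eq_zero {p : PowerSeries ℂ} (h : X * p = 0) : p = 0 :=
  (mul_eq_zero.mp h).resolve_left X_ne_zero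

/-- The Wronskian argument: `A = ₂F₁(1/2, 1/2; 1; 16 R)` and `t = R ₂F₁(1/2, 1/2; 2; 16 R)`. -/
lemma ASeries_eq_and_tSeries_eq :
    ASeries (π / 4) = comp (hypSeries (1 / 2) (1 / 2) 1) (C 16 * RSeries (π / 4)) ∧
    C 16 * tSeries (π / 4) =
      comp (X * hypSeries (1 / 2) (1 / 2) 2) (C 16 * RSeries (π / 4)) := by
  have hr0 := constantCoeff_sixteen_RSeries
  have hA := X_mul_derivative_ASeries
  have ht := X_mul_derivative_tSeries
  have hr : X * d⁄dX ℂ (C 16 * RSeries (π / 4)) = ASeries (π / 4) ^ 2 *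
      (C 16 * RSeries (π / 4)) * (1 - C 16 * RSeries (π / 4)) := by
    rw [Derivation.leibniz, derivative_C, smul_zero, add_zero, smul_eq_mul, mul_left_comm,
      X_mul_derivative_RSeries]
    ring
  have hs : X * d⁄dX ℂ (C 16 * tSeries (π / 4)) = ASeries (π / 4) ^ 3 *
      (C 16 * RSeries (π / 4)) * (1 - C 16 * RSeries (π / 4)) := by
    rw [Derivation.leibniz, derivative_C, smul_zero, add_zero, smul_eq_mul, mul_left_comm,
      X_mul_derivative_tSeries]
    ring
  have hA' : C 4 * (X * d⁄dX ℂ (ASeries (π / 4))) =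
      (C 16 * tSeries (π / 4)) * ASeries (π / 4) ^ 2 := by
    rw [hA, show (C 16 : PowerSeries ℂ) = C 4 * C 4 by
      rw [← map_mul, show (4 : ℂ) * 4 = 16 by norm_num]]
    ring
  have hz := derivative_comp (f := X * hypSeries (1 / 2) (1 / 2) 2) hr0
  have hg := derivative_comp (f := hypSeries (1 / 2) (1 / 2) 1) hr0
  have hg' := congrArg (fun p => comp p (C 16 * RSeries (π / 4))) derivative_hypSeries
  simp only [comp_mul hr0, comp_C, comp_X_left hr0, comp_sub hr0, comp_one] at hg'
  rw [derivative_X_mul_hypSeries] at hz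
  have z0 := constantCoeff_comp_of_eq_zero (f := X * hypSeries (1 / 2) (1 / 2) 2) hr0
  have g0 := constantCoeff_comp_of_eq_zero (f := hypSeries (1 / 2) (1 / 2) 1) hr0
  have s0 : constantCoeff (C 16 * tSeries (π / 4)) = 0 := by
    rw [map_mul, constantCoeff_tSeries, mul_zero]
  have A0 := constantCoeff_ASeries
  rw [map_mul, constantCoeff_X, zero_mul] at z0
  rw [constantCoeff_hypSeries] at g0
  have hzr : comp (X * hypSeries (1 / 2) (1 / 2) 2) (C 16 * RSeries (π / 4)) =
      (C 16 * RSeries (π / 4)) * comp (hypSeries (1 / 2) (1 / 2) 2) (C 16 * RSeries (π / 4)) := by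
    rw [comp_mul hr0, comp_X_left hr0]
  rw [← hzr] at hg'
  clear hzr
  generalize comp (X * hypSeries (1 / 2) (1 / 2) 2) (C 16 * RSeries (π / 4)) = z at *
  generalize comp (hypSeries (1 / 2) (1 / 2) 1) (C 16 * RSeries (π / 4)) = g at *
  generalize comp (d⁄dX ℂ (hypSeries (1 / 2) (1 / 2) 1)) (C 16 * RSeries (π / 4)) = g' at *
  generalize C 16 * RSeries (π / 4) = r at *
  generalize C 16 * tSeries (π / 4) = s at *
  generalize ASeries (π / 4) = A at *
  have hC4 : (C 4 : PowerSeries ℂ) ≠ 0 := by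
    rw [Ne, map_eq_zero_iff _ C_injective]; norm_num
  have hz' : X * d⁄dX ℂ z = g * (A ^ 2 * r * (1 - r)) := by
    rw [hz, mul_left_comm, hr]
  have hg'' : C 4 * (X * d⁄dX ℂ g) = z * A ^ 2 := by
    rw [hg, mul_left_comm X, hr]
    linear_combination A ^ 2 * hg'
  -- Both pairs (z, g) and (s, A) solve the same linear system, so their Wronskian is constant. It
  -- is zero because z and s have no constant term.
  have hW : z * A - s * g = 0 := by
    have hd : d⁄dX ℂ (z * A - s * g) = 0 := by
      apply eq_of_X_mul_eq_zero
      apply mul_left_cancel₀ hC4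
      rw [map_sub, Derivation.leibniz, Derivation.leibniz]
      simp only [smul_eq_mul]
      linear_combination C 4 * A * hz' + z * hA' - C 4 * g * hs - s * hg''
    rw [eq_C_of_derivative_eq_zero hd, map_sub, map_mul, map_mul, z0, s0]
    simp
  have hAne : constantCoeff A ≠ 0 := by rw [A0]; exact one_ne_zero
  have hinv := PowerSeries.mul_inv_cancel A hAne
  -- The derivative of g/A is proportional to the Wronskian, hence zero; both constant terms are 1.
  have hgA : g * A⁻¹ = 1 := by
    have hd : d⁄dX ℂ (g * A⁻¹) = 0 := by
      apply eq_of_X_mul_eq_zero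
      apply mul_left_cancel₀ hC4
      rw [Derivation.leibniz, derivative_inv']
      simp only [smul_eq_mul]
      linear_combination A⁻¹ * hg'' - g * A⁻¹ ^ 2 * hA' +
        A ^ 2 * A⁻¹ ^ 2 * hW - z * A * (A * A⁻¹) * hinv
    rw [eq_C_of_derivative_eq_zero hd, map_mul, constantCoeff_inv, g0, A0]
    simp
  have hgA' : A = g := by linear_combination g * hinv - A * hgA
  refine ⟨hgA', ?_⟩
  subst hgA'
  have hA0 : A ≠ 0 := fun h => hAne (by rw [h, map_zero])
  apply mul_right_cancel₀ hA0
  linear_combination -hW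

lemma ASeries_eq :
    ASeries (π / 4) = comp (hypSeries (1 / 2) (1 / 2) 1) (C 16 * RSeries (π / 4)) :=
  ASeries_eq_and_tSeries_eq.1

lemma tSeries_eq : tSeries (π / 4) =
    RSeries (π / 4) * comp (hypSeries (1 / 2) (1 / 2) 2) (C 16 * RSeries (π / 4)) := by
  have h := ASeries_eq_and_tSeries_eq.2
  have hr0 := constantCoeff_sixteen_RSeries
  rw [comp_mul hr0, comp_X_left hr0, mul_assoc] at h
  have hC : (C 16 : PowerSeries ℂ) ≠ 0 := by
    rw [Ne, map_eq_zero_iff _ C_injective]; norm_num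
  exact mul_left_cancel₀ hC h

/-! ### R as a power series in t -/

/-- The power series `X ₂F₁(1/2, 1/2; 2; 16 X)`. -/
noncomputable def tOfRSeries : PowerSeries ℂ :=
  X * comp (hypSeries (1 / 2) (1 / 2) 2) (C 16 * X)

lemma constantCoeff_sixteen_mul {ρ : PowerSeries ℂ} (h : constantCoeff ρ = 0) :
    constantCoeff (C 16 * ρ) = 0 := by rw [map_mul, h, mul_zero]

lemma constantCoeff_tOfRSeries : constantCoeff tOfRSeries = 0 := by
  rw [tOfRSeries, map_mul, constantCoeff_X, zero_mul]

lemma coeff_one_tOfRSeries : coeff 1 tOfRSeries = 1 := by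
  rw [tOfRSeries, coeff_succ_X_mul, coeff_zero_eq_constantCoeff_apply,
    constantCoeff_comp_of_eq_zero (constantCoeff_sixteen_mul constantCoeff_X),
    constantCoeff_hypSeries]

lemma comp_tOfRSeries {ρ : PowerSeries ℂ} (h : constantCoeff ρ = 0) :
    comp tOfRSeries ρ = ρ * comp (hypSeries (1 / 2) (1 / 2) 2) (C 16 * ρ) := by
  rw [tOfRSeries, comp_mul h, comp_X_left h,
    comp_assoc (constantCoeff_sixteen_mul constantCoeff_X) h, comp_mul h, comp_C, comp_X_left h]

lemma coeff_hypSeries_two_eq_choose (n : ℕ) :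
    16 ^ n * coeff n (hypSeries (1 / 2) (1 / 2) 2) =
      ((2 * n).choose n : ℂ) ^ 2 / ((n : ℂ) + 1) := by
  rw [← Nat.centralBinom_eq_two_mul_choose]
  induction n with
  | zero => simp [coeff_hypSeries_zero]
  | succ n ih =>
    have h := congrArg (Nat.cast (R := ℂ)) (Nat.succ_mul_centralBinom_succ n)
    push_cast at h
    have h1 : (n : ℂ) + 1 ≠ 0 := Nat.cast_add_one_ne_zero n
    have h2 : (n : ℂ) + 1 + 1 ≠ 0 := by exact_mod_cast Nat.cast_add_one_ne_zero (R := ℂ) (n + 1)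
    have h3 : (Nat.centralBinom (n + 1) : ℂ) = 2 * (2 * n + 1) * Nat.centralBinom n / (n + 1) := by
      rw [eq_div_iff h1]; linear_combination h
    rw [coeff_hypSeries_succ, pow_succ, mul_mul_mul_comm, ih, h3, show (2 : ℂ) + n = n + 1 + 1 by
      ring]
    push_cast
    field_simp
    ring

lemma comp_hypSeries_sixteen_X : comp (hypSeries (1 / 2) (1 / 2) 2) (C 16 * X) =
    PowerSeries.mk fun n : ℕ => ((2 * n).choose n : ℂ) ^ 2 / ((n : ℂ) + 1) := by
  have h := rescale_eq_subst (16 : ℂ) (hypSeries (1 / 2) (1 / 2) 2)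
  rw [smul_eq_C_mul] at h
  rw [comp, ← h]
  ext n
  rw [coeff_rescale, coeff_mk, coeff_hypSeries_two_eq_choose]

lemma comp_tOfRSeries_RSeries : comp tOfRSeries (RSeries (π / 4)) = tSeries (π / 4) := by
  rw [comp_tOfRSeries constantCoeff_RSeries, ← tSeries_eq]

lemma existsUnique_isQOfT : ∃! u : PowerSeries ℂ, IsQOfT (π / 4) u := by
  obtain ⟨u, h0, h1, _⟩ := exists_comp_inverse constantCoeff_tSeries coeff_one_tSeries
  exact ⟨u, ⟨h0, h1⟩, fun v hv => comp_right_inverse_unique constantCoeff_tSeries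
    coeff_one_tSeries hv.1 h0 hv.2 h1⟩

/-- Since t is `tOfRSeries` evaluated at R, the series R(q(t)) is a right inverse of `tOfRSeries`
under composition, and such an inverse is unique. -/
lemma eq_comp_RSeries_iff {u ρ : PowerSeries ℂ} (hu : IsQOfT (π / 4) u) :
    ρ = comp (RSeries (π / 4)) u ↔ constantCoeff ρ = 0 ∧
      X = ρ * comp (hypSeries (1 / 2) (1 / 2) 2) (C 16 * ρ) := by
  have h0 : constantCoeff (comp (RSeries (π / 4)) u) = 0 := by
    rw [constantCoeff_comp_of_eq_zero hu.1, constantCoeff_RSeries]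
  have h1 : comp tOfRSeries (comp (RSeries (π / 4)) u) = X := by
    rw [← comp_assoc constantCoeff_RSeries hu.1, comp_tOfRSeries_RSeries, hu.2]
  constructor
  · rintro rfl
    exact ⟨h0, by rw [← comp_tOfRSeries h0, h1]⟩
  · rintro ⟨hρ, h⟩
    rw [← comp_tOfRSeries hρ] at h
    exact comp_right_inverse_unique constantCoeff_tOfRSeries coeff_one_tOfRSeries hρ h0 h.symm h1

lemma eq_comp_RSeries_iff_choose {u ρ : PowerSeries ℂ} (hu : IsQOfT (π / 4) u) :
    ρ = comp (RSeries (π / 4)) u ↔ constantCoeff ρ = 0 ∧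
      X = ρ * comp (PowerSeries.mk fun n : ℕ => ((2 * n).choose n : ℂ) ^ 2 / ((n : ℂ) + 1)) ρ := by
  rw [eq_comp_RSeries_iff hu]
  refine and_congr_right fun h => ?_
  rw [← comp_hypSeries_sixteen_X, comp_assoc (constantCoeff_sixteen_mul constantCoeff_X) h,
    comp_mul h, comp_C, comp_X_left h]

end SixVertex

/-! ### Hypergeometric functions of `16 R` -/

namespace SixVertex

open Complex Filter Topology PowerSeries

lemma isDiscSum_hypSeries {a b c : ℂ} (ha : 0 < a.re) (hb : 0 < b.re) (hc : 0 < c.re) :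
    IsDiscSum (hypSeries a b c) (₂F₁ a b c) := by
  -- Positive real parts keep the parameters away from the non-positive integers, so the series
  -- neither terminates nor degenerates and has radius exactly 1.
  have hne : ∀ (x : ℂ), 0 < x.re → ∀ n : ℕ, (n : ℂ) ≠ -x := by
    intro x hx n h
    have h' := congrArg Complex.re h
    rw [natCast_re, neg_re] at h'
    have : (0 : ℝ) ≤ n := n.cast_nonneg
    linarith
  have hr := ordinaryHypergeometricSeries_radius_eq_one (𝔸 := ℂ) a b c
    fun n => ⟨hne a ha n, hne b hb n, hne c hc n⟩
  intro q hq
  have h := (ordinaryHypergeometricSeries ℂ a b c).hasSum (x := q) (by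
    rw [hr, ← ENNReal.ofReal_one, Metric.eball_ofReal]; simpa using hq)
  refine (hasSum_fun_congr fun n => ?_).mp h
  rw [ordinaryHypergeometricSeries_apply_eq, smul_eq_mul, hypSeries, coeff_mk]

lemma isDiscSum_hypOne : IsDiscSum (hypSeries (1 / 2) (1 / 2) 1) (₂F₁ (1 / 2 : ℂ) (1 / 2) 1) :=
  isDiscSum_hypSeries (by norm_num) (by norm_num) (by norm_num)

lemma isDiscSum_hypTwo : IsDiscSum (hypSeries (1 / 2) (1 / 2) 2) (₂F₁ (1 / 2 : ℂ) (1 / 2) 2) :=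
  isDiscSum_hypSeries (by norm_num) (by norm_num) (by norm_num)

lemma IsDiscSum.hasDerivAt {p : PowerSeries ℂ} {F : ℂ → ℂ} (h : IsDiscSum p F) {x : ℂ}
    (hx : ‖x‖ < 1) : HasDerivAt F (_root_.deriv F x) x :=
  (h.differentiableOn.differentiableAt
    (Metric.isOpen_ball.mem_nhds (by simpa using hx))).hasDerivAt

lemma hasDerivAt_mul_hypTwo {x : ℂ} (hx : ‖x‖ < 1) :
    HasDerivAt (fun x => x * ₂F₁ (1 / 2 : ℂ) (1 / 2) 2 x) (₂F₁ (1 / 2 : ℂ) (1 / 2) 1 x) x := by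
  have h := isDiscSum_X.mul isDiscSum_hypTwo
  have h' := h.deriv
  rw [derivative_X_mul_hypSeries] at h'
  rw [(isDiscSum_hypOne x hx).unique (h' x hx)]
  exact h.hasDerivAt hx

lemma hypOne_ode {x : ℂ} (hx : ‖x‖ < 1) :
    4 * (x * (1 - x)) * deriv (₂F₁ (1 / 2 : ℂ) (1 / 2) 1) x =
      x * ₂F₁ (1 / 2 : ℂ) (1 / 2) 2 x := by
  have hX : IsDiscSum (C 1 - X) fun x => 1 - x := fun q hq =>
    (hasSum_fun_congr fun n => by rw [map_sub, sub_mul]).mpr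
      ((isDiscSum_C 1 q hq).sub (isDiscSum_X q hq))
  have h := ((isDiscSum_C 4).mul (isDiscSum_X.mul hX)).mul isDiscSum_hypOne.deriv
  rw [map_one, derivative_hypSeries] at h
  exact (h x hx).unique ((isDiscSum_X.mul isDiscSum_hypTwo) x hx)

/-! ### Values on the imaginary axis -/

/-- The condition `h0` removes the phase exp(2πisz), the only possibly non-real factor left once
`hz` holds. -/
lemma exists_ofReal_gaussSum {z : ℂ} (hz : ∀ n : ℤ, ∃ x : ℝ, cexp (2 * π * I * (n * z)) = x)
    (s : ℝ) (h0 : s = 0 ∨ z = 0) (y : ℝ) : ∃ x : ℝ, gaussSum 0 z s (y * I) = x := by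
  choose x hx using hz
  refine ⟨∑' n : ℤ, x n * Real.exp (-(2 * π * y * (n + s) ^ 2)), ?_⟩
  rw [gaussSum, ofReal_tsum]
  refine tsum_congr fun n => ?_
  have hz' : ((n : ℂ) + s) * z = n * z := by rcases h0 with rfl | rfl <;> simp
  rw [gaussTerm, pow_zero, one_mul, hz', mul_add, exp_add, hx, ofReal_mul, ofReal_exp, mul_comm]
  congr 2
  push_cast
  linear_combination 2 * π * y * ((n : ℂ) + s) ^ 2 * I_sq

lemma exists_ofReal_thetaThree (y : ℝ) : ∃ x : ℝ, thetaThree 0 (y * I) = x :=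
  exists_ofReal_gaussSum (fun n => ⟨1, by simp⟩) 0 (Or.inl rfl) y

lemma exists_ofReal_thetaTwo (y : ℝ) : ∃ x : ℝ, thetaTwo 0 (y * I) = x :=
  exists_ofReal_gaussSum (fun n => ⟨1, by simp⟩) _ (Or.inr rfl) y

lemma exists_ofReal_thetaFour (y : ℝ) : ∃ x : ℝ, thetaFour 0 (y * I) = x := by
  refine exists_ofReal_gaussSum (fun n => ⟨(-1) ^ n, ?_⟩) 0 (Or.inl rfl) y
  rw [show 2 * (π : ℂ) * I * (n * (1 / 2)) = n * (π * I) by ring, exp_int_mul, exp_pi_mul_I]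
  push_cast; rfl

/-- Both 16R and 1 - 16R are quotients of fourth powers of non-zero real numbers, hence positive. -/
lemma exists_RFun_imaginary_axis {y : ℝ} (hy : 0 < y) :
    ∃ x : ℝ, 0 < x ∧ x < 1 ∧ 16 * RFun (π / 4) (y * I) = (x : ℂ) := by
  have hτ : 0 < ((y : ℂ) * I).im := by simpa using hy
  obtain ⟨a, ha⟩ := exists_ofReal_thetaTwo y
  obtain ⟨b, hb⟩ := exists_ofReal_thetaThree y
  obtain ⟨c, hc⟩ := exists_ofReal_thetaFour y
  have ha0 : a ≠ 0 := fun h => thetaTwo_ne_zero hτ (by rw [ha, h, ofReal_zero])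
  have hb0 : b ≠ 0 := fun h => thetaThree_ne_zero hτ (by rw [hb, h, ofReal_zero])
  have hc0 : c ≠ 0 := fun h => thetaFour_ne_zero hτ (by rw [hc, h, ofReal_zero])
  have h1 : 16 * RFun (π / 4) (y * I) = ((a ^ 4 / b ^ 4 : ℝ) : ℂ) := by
    rw [RFun_eq hτ, ha, hb]; push_cast
    have hb1 : (b : ℂ) ≠ 0 := ofReal_ne_zero.mpr hb0
    field_simp
  have h2 : 1 - 16 * RFun (π / 4) (y * I) = ((c ^ 4 / b ^ 4 : ℝ) : ℂ) := by
    rw [one_sub_RFun_eq hτ, hc, hb]; push_cast; rfl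
  have h3 : 1 - a ^ 4 / b ^ 4 = c ^ 4 / b ^ 4 := by
    rw [h1] at h2; exact_mod_cast h2
  have p4 {x : ℝ} (hx : x ≠ 0) : 0 < x ^ 4 := Even.pow_pos (by decide) hx
  refine ⟨a ^ 4 / b ^ 4, div_pos (p4 ha0) (p4 hb0), ?_, h1⟩
  have := div_pos (p4 hc0) (p4 hb0)
  linarith

/-! ### Limits at `i ∞` -/

lemma tendsto_mul_I_atTop : Tendsto (fun y : ℝ => (y : ℂ) * I) atTop (comap im atTop) := by
  rw [tendsto_comap_iff]
  refine tendsto_id.congr fun y => ?_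
  simp

lemma tendsto_RFun : Tendsto (fun y : ℝ => RFun (π / 4) (y * I)) atTop (𝓝 0) := by
  have h : Tendsto (fun τ => thetaTwo 0 τ ^ 4 / (16 * thetaThree 0 τ ^ 4)) (comap im atTop)
      (𝓝 (0 ^ 4 / (16 * 1 ^ 4))) :=
    ((tendsto_thetaTwo 0).pow 4).div ((tendsto_thetaThree_zero.pow 4).const_mul 16) (by norm_num)
  rw [show (0 : ℂ) ^ 4 / (16 * 1 ^ 4) = 0 by norm_num] at h
  refine (h.comp tendsto_mul_I_atTop).congr' ?_
  filter_upwards [eventually_gt_atTop 0] with y hy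
  exact (RFun_eq (by simpa using hy)).symm

lemma tendsto_AFun : Tendsto (fun y : ℝ => AFun (π / 4) (y * I)) atTop (𝓝 1) := by
  have h := tendsto_thetaThree_zero.pow 2
  rw [one_pow] at h
  refine (h.comp tendsto_mul_I_atTop).congr' ?_
  filter_upwards [eventually_gt_atTop 0] with y hy
  exact (AFun_eq (by simpa using hy)).symm

lemma tendsto_tFun : Tendsto (fun y : ℝ => tFun (π / 4) (y * I)) atTop (𝓝 0) := by
  have h : Tendsto (fun τ => thetaThree 2 τ / (2 * thetaThree 0 τ ^ 3)) (comap im atTop)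
      (𝓝 (0 / (2 * 1 ^ 3))) :=
    (tendsto_thetaThree two_ne_zero).div ((tendsto_thetaThree_zero.pow 3).const_mul 2)
      (by norm_num)
  rw [zero_div] at h
  refine (h.comp tendsto_mul_I_atTop).congr' ?_
  filter_upwards [eventually_gt_atTop 0] with y hy
  exact (tFun_eq (by simpa using hy)).symm

/-! ### The hypergeometric expressions for `t` and `A` -/

/-- The part of the upper half-plane where the hypergeometric series in `16 R` converge. -/
def convergenceSet : Set ℂ := {τ | 0 < τ.im ∧ ‖16 * RFun (π / 4) τ‖ < 1}

lemma isOpen_convergenceSet : IsOpen convergenceSet := by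
  have hc : ContinuousOn (fun τ => ‖16 * RFun (π / 4) τ‖) upperHalf := fun τ hτ =>
    ((hasDerivAt_RFun hτ).const_mul 16).continuousAt.norm.continuousWithinAt
  exact hc.isOpen_inter_preimage isOpen_upperHalf isOpen_Iio

lemma imaginary_axis_subset : (fun y : ℝ => (y : ℂ) * I) '' Set.Ioi 0 ⊆ convergenceSet := by
  rintro _ ⟨y, hy, rfl⟩
  obtain ⟨x, h0, h1, h⟩ := exists_RFun_imaginary_axis hy
  refine ⟨by simpa using hy, ?_⟩
  simp only [h, norm_real, Real.norm_eq_abs]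
  rwa [abs_of_pos h0]

lemma isPreconnected_imaginary_axis :
    IsPreconnected ((fun y : ℝ => (y : ℂ) * I) '' Set.Ioi 0) :=
  isPreconnected_Ioi.image _ (by fun_prop)

/-- The component of i contains the whole positive imaginary axis, so the constant value can be read
off as a limit at i∞. -/
lemma eqOn_of_deriv_eq_zero {F : ℂ → ℂ} {c : ℂ}
    (hd : ∀ τ ∈ connectedComponentIn convergenceSet I, HasDerivAt F 0 τ)
    (hl : Tendsto (fun y : ℝ => F (y * I)) atTop (𝓝 c)) :
    ∀ τ ∈ connectedComponentIn convergenceSet I, F τ = c := by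
  have hI : I ∈ convergenceSet := imaginary_axis_subset ⟨1, by simp, by simp⟩
  have hax : (fun y : ℝ => (y : ℂ) * I) '' Set.Ioi 0 ⊆ connectedComponentIn convergenceSet I :=
    isPreconnected_imaginary_axis.subset_connectedComponentIn ⟨1, by simp, by simp⟩
      imaginary_axis_subset
  obtain ⟨d, hd'⟩ := isOpen_convergenceSet.connectedComponentIn.exists_is_const_of_deriv_eq_zero
    isPreconnected_connectedComponentIn
    (fun τ hτ => (hd τ hτ).differentiableAt.differentiableWithinAt) (fun τ hτ => (hd τ hτ).deriv)
  have : c = d := by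
    refine tendsto_nhds_unique hl (tendsto_const_nhds.congr' ?_)
    filter_upwards [eventually_gt_atTop 0] with y hy
    exact (hd' _ (hax ⟨y, hy, rfl⟩)).symm
  rw [this]
  exact hd'

/-- The formal Wronskian argument repeated for functions of τ, with the constant terms at q = 0
replaced by limits along the imaginary axis. -/
lemma AFun_tFun_eq_on_component : ∀ τ ∈ connectedComponentIn convergenceSet I,
    tFun (π / 4) τ = RFun (π / 4) τ * ₂F₁ (1 / 2 : ℂ) (1 / 2) 2 (16 * RFun (π / 4) τ) ∧
    AFun (π / 4) τ = ₂F₁ (1 / 2 : ℂ) (1 / 2) 1 (16 * RFun (π / 4) τ) := by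
  set g : ℂ → ℂ := ₂F₁ (1 / 2 : ℂ) (1 / 2) 1 with hgdef
  set z : ℂ → ℂ := fun x => x * ₂F₁ (1 / 2 : ℂ) (1 / 2) 2 x with hzdef
  have hsub := connectedComponentIn_subset convergenceSet I
  have dz : ∀ τ ∈ convergenceSet, HasDerivAt (fun σ => z (16 * RFun (π / 4) σ))
      (2 * π * I * (16 * (AFun (π / 4) τ ^ 2 * RFun (π / 4) τ * (1 - 16 * RFun (π / 4) τ)) *
        g (16 * RFun (π / 4) τ))) τ := by
    intro τ hτ
    exact (HasDerivAt.comp τ (hasDerivAt_mul_hypTwo hτ.2)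
      ((hasDerivAt_RFun hτ.1).const_mul 16)).congr_deriv (by ring)
  have dg : ∀ τ ∈ convergenceSet, HasDerivAt (fun σ => g (16 * RFun (π / 4) σ))
      (2 * π * I * (AFun (π / 4) τ ^ 2 * z (16 * RFun (π / 4) τ) / 4)) τ := by
    intro τ hτ
    refine (HasDerivAt.comp τ (isDiscSum_hypOne.hasDerivAt hτ.2)
      ((hasDerivAt_RFun hτ.1).const_mul 16)).congr_deriv ?_
    have h := hypOne_ode hτ.2
    simp only [hzdef]
    rw [← h]
    ring
  have lR := tendsto_RFun.const_mul 16
  rw [mul_zero] at lR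
  have g0 : g 0 = 1 := isDiscSum_hypOne.apply_zero.trans (constantCoeff_hypSeries _ _ _)
  have lg := isDiscSum_hypOne.continuousAt_zero.tendsto.comp lR
  have lz := (isDiscSum_X.mul isDiscSum_hypTwo).continuousAt_zero.tendsto.comp lR
  rw [← hgdef, g0] at lg
  rw [zero_mul] at lz
  have hW : ∀ τ ∈ connectedComponentIn convergenceSet I, z (16 * RFun (π / 4) τ) * AFun (π / 4) τ -
      16 * tFun (π / 4) τ * g (16 * RFun (π / 4) τ) = 0 := by
    refine eqOn_of_deriv_eq_zero (fun τ hτ => ?_) ?_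
    · have hτ' := hsub hτ
      refine (((dz τ hτ').fun_mul (hasDerivAt_AFun hτ'.1)).fun_sub
        (((hasDerivAt_tFun hτ'.1).const_mul 16).fun_mul (dg τ hτ'))).congr_deriv ?_
      ring
    · have := (lz.mul tendsto_AFun).sub ((tendsto_tFun.const_mul 16).mul lg)
      rwa [zero_mul, mul_zero, zero_mul, sub_zero] at this
  have hA : ∀ τ ∈ connectedComponentIn convergenceSet I,
      g (16 * RFun (π / 4) τ) / AFun (π / 4) τ = 1 := by
    refine eqOn_of_deriv_eq_zero (fun τ hτ => ?_) ?_
    · have hτ' := hsub hτ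
      have hA0 := AFun_ne_zero hτ'.1
      refine ((dg τ hτ').fun_div (hasDerivAt_AFun hτ'.1) hA0).congr_deriv ?_
      rw [div_eq_zero_iff]
      left
      linear_combination 2 * π * I * AFun (π / 4) τ ^ 2 / 4 * hW τ hτ
    · have := lg.div tendsto_AFun one_ne_zero
      rwa [div_one] at this
  intro τ hτ
  have hA0 := AFun_ne_zero (hsub hτ).1
  have e : AFun (π / 4) τ = g (16 * RFun (π / 4) τ) := ((div_eq_one_iff_eq hA0).mp (hA τ hτ)).symm
  refine ⟨?_, e⟩
  have h := hW τ hτ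
  rw [← e] at h
  apply mul_right_cancel₀ hA0
  simp only [hzdef] at h
  linear_combination -h / 16

lemma AFun_tFun_eq_of_isPreconnected {U : Set ℂ} (hU : U ⊆ upperHalf) (hc : IsPreconnected U)
    (hm : ∃ τ ∈ U, τ.re = 0) (hR : ∀ τ ∈ U, ‖16 * RFun (π / 4) τ‖ < 1) {τ : ℂ} (hτ : τ ∈ U) :
    tFun (π / 4) τ = RFun (π / 4) τ * ₂F₁ (1 / 2 : ℂ) (1 / 2) 2 (16 * RFun (π / 4) τ) ∧
    AFun (π / 4) τ = ₂F₁ (1 / 2 : ℂ) (1 / 2) 1 (16 * RFun (π / 4) τ) := by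
  obtain ⟨σ, hσ, h0⟩ := hm
  have hσ' : σ ∈ (fun y : ℝ => (y : ℂ) * I) '' Set.Ioi 0 :=
    ⟨σ.im, hU hσ, by apply Complex.ext <;> simp [h0]⟩
  -- Since U meets the axis, its union with the axis is preconnected and lies in the component of i.
  have hpre := hc.union σ hσ hσ' isPreconnected_imaginary_axis
  have hI : I ∈ (fun y : ℝ => (y : ℂ) * I) '' Set.Ioi 0 := ⟨1, by simp, by simp⟩
  have hsub : U ∪ (fun y : ℝ => (y : ℂ) * I) '' Set.Ioi 0 ⊆ convergenceSet :=
    Set.union_subset (fun ρ hρ => ⟨hU hρ, hR ρ hρ⟩) imaginary_axis_subset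
  exact AFun_tFun_eq_on_component τ
    (hpre.subset_connectedComponentIn (Or.inr hI) hsub (Or.inl hτ))

/-! ### The transformation `τ ↦ -1 / (4 τ)` -/

lemma thetaThree_eq_jacobiTheta₂ (τ : ℂ) : thetaThree 0 τ = jacobiTheta₂ 0 (2 * τ) := by
  rw [thetaThree, gaussSum, jacobiTheta₂]
  refine tsum_congr fun n => ?_
  rw [gaussTerm, pow_zero, one_mul, jacobiTheta₂_term]
  congr 1; push_cast; ring

lemma thetaFour_eq_jacobiTheta₂ (τ : ℂ) : thetaFour 0 τ = jacobiTheta₂ (1 / 2) (2 * τ) := by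
  rw [thetaFour, gaussSum, jacobiTheta₂]
  refine tsum_congr fun n => ?_
  rw [gaussTerm, pow_zero, one_mul, jacobiTheta₂_term]
  congr 1; push_cast; ring

lemma thetaTwo_eq_jacobiTheta₂ (τ : ℂ) :
    thetaTwo 0 τ = cexp (π * I * τ / 2) * jacobiTheta₂ τ (2 * τ) := by
  rw [thetaTwo, gaussSum, jacobiTheta₂, ← tsum_mul_left]
  refine tsum_congr fun n => ?_
  rw [gaussTerm, pow_zero, one_mul, jacobiTheta₂_term, ← exp_add]
  congr 1; push_cast; ring

variable {τ : ℂ}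

lemma ne_zero_of_im_pos (hτ : 0 < τ.im) : τ ≠ 0 := by
  rintro rfl; simp at hτ

lemma im_neg_one_div_pos (hτ : 0 < τ.im) : 0 < (-1 / (4 * τ)).im := by
  have h4 : 0 < (4 * τ).im := by simpa using hτ
  have hn := Complex.normSq_pos.mpr (ne_zero_of_im_pos h4)
  rw [neg_div, neg_im, one_div, inv_im, neg_div, neg_neg]
  exact div_pos h4 hn

lemma neg_one_div_two_mul (hτ : 0 < τ.im) : -1 / (2 * τ) = 2 * (-1 / (4 * τ)) := by
  have := ne_zero_of_im_pos hτ
  field_simp; norm_num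

lemma thetaThree_inversion (hτ : 0 < τ.im) :
    thetaThree 0 τ = 1 / (-I * (2 * τ)) ^ (1 / 2 : ℂ) * thetaThree 0 (-1 / (4 * τ)) := by
  rw [thetaThree_eq_jacobiTheta₂, jacobiTheta₂_functional_equation, neg_one_div_two_mul hτ,
    thetaThree_eq_jacobiTheta₂]
  simp

lemma thetaTwo_inversion (hτ : 0 < τ.im) :
    thetaTwo 0 τ = 1 / (-I * (2 * τ)) ^ (1 / 2 : ℂ) * thetaFour 0 (-1 / (4 * τ)) := by
  have h0 := ne_zero_of_im_pos hτ
  rw [thetaTwo_eq_jacobiTheta₂, jacobiTheta₂_functional_equation, neg_one_div_two_mul hτ,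
    thetaFour_eq_jacobiTheta₂, show τ / (2 * τ) = 1 / 2 by field_simp]
  have e : cexp (π * I * τ / 2) * cexp (-π * I * τ ^ 2 / (2 * τ)) = 1 := by
    rw [← exp_add, show π * I * τ / 2 + -π * I * τ ^ 2 / (2 * τ) = 0 by field_simp; ring,
      exp_zero]
  linear_combination 1 / (-I * (2 * τ)) ^ (1 / 2 : ℂ) *
    jacobiTheta₂ (1 / 2) (2 * (-1 / (4 * τ))) * e

/-- A is the square of θ₃, so only the square of the factor (-2iτ)^{1/2} enters and the choice of
branch disappears. -/
lemma AFun_inversion (hτ : 0 < τ.im) :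
    AFun (π / 4) (-1 / (4 * τ)) = -2 * I * τ * AFun (π / 4) τ := by
  have hσ := im_neg_one_div_pos hτ
  have h0 := ne_zero_of_im_pos hτ
  have hx : -I * (2 * τ) ≠ 0 := by simp [h0]
  have hs : ((-I * (2 * τ)) ^ (1 / 2 : ℂ)) ^ 2 = -I * (2 * τ) := by
    rw [← cpow_nat_mul]; norm_num
  have hne : (-I * (2 * τ)) ^ (1 / 2 : ℂ) ≠ 0 := fun h => hx (by rw [← hs, h]; norm_num)
  rw [AFun_eq hσ, AFun_eq hτ, thetaThree_inversion hτ, mul_pow, div_pow, hs]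
  field_simp

/-- The inversion exchanges θ₂ and θ₄ and fixes θ₃, all with the same factor, which cancels in the
quotients defining 16R and 1 - 16R. -/
lemma RFun_inversion (hτ : 0 < τ.im) :
    16 * RFun (π / 4) (-1 / (4 * τ)) = 1 - 16 * RFun (π / 4) τ := by
  have hσ := im_neg_one_div_pos hτ
  have n3 := thetaThree_ne_zero hσ
  have n3' := thetaThree_ne_zero hτ
  have h3 := thetaThree_inversion hτ
  have h2 := thetaTwo_inversion hτ
  have hne : 1 / (-I * (2 * τ)) ^ (1 / 2 : ℂ) ≠ 0 := fun h => n3' (by rw [h3, h, zero_mul])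
  have e : 1 - 16 * RFun (π / 4) (-1 / (4 * τ)) = 16 * RFun (π / 4) τ := by
    rw [one_sub_RFun_eq hσ, RFun_eq hτ, h3, h2]
    generalize 1 / (-I * (2 * τ)) ^ (1 / 2 : ℂ) = c at *
    field_simp
  linear_combination -e

lemma second_solution_of_isPreconnected {U : Set ℂ} (hU : U ⊆ upperHalf) (hc : IsPreconnected U)
    (hm : ∃ τ ∈ U, τ.re = 0)
    (hR : ∀ τ ∈ U, ‖16 * RFun (π / 4) τ‖ < 1 ∧ ‖1 - 16 * RFun (π / 4) τ‖ < 1) (hτ : τ ∈ U) :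
    τ * AFun (π / 4) τ = I / 2 * ₂F₁ (1 / 2 : ℂ) (1 / 2) 1 (1 - 16 * RFun (π / 4) τ) ∧
    ₂F₁ (1 / 2 : ℂ) (1 / 2) 1 (16 * RFun (π / 4) τ) ≠ 0 ∧
    nome τ = cexp (-(π : ℂ) * (₂F₁ (1 / 2 : ℂ) (1 / 2) 1 (1 - 16 * RFun (π / 4) τ) /
      ₂F₁ (1 / 2 : ℂ) (1 / 2) 1 (16 * RFun (π / 4) τ))) := by
  have h1 := (AFun_tFun_eq_of_isPreconnected hU hc hm (fun σ hσ => (hR σ hσ).1) hτ).2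
  have hcont : ContinuousOn (fun σ : ℂ => -1 / (4 * σ)) U := fun σ hσ =>
    (continuousAt_const.div (continuousAt_const.mul continuousAt_id)
      (mul_ne_zero (by norm_num) (ne_zero_of_im_pos (hU hσ)))).continuousWithinAt
  -- The formula for A is applied on the image of U under τ ↦ -1/(4τ), which preserves the imaginary
  -- axis. It gives ₂F₁(1/2, 1/2; 1; 1 - 16R) = -2iτA.
  have h2 := (AFun_tFun_eq_of_isPreconnected (U := (fun σ : ℂ => -1 / (4 * σ)) '' U)
    (by rintro _ ⟨σ, hσ, rfl⟩; exact im_neg_one_div_pos (hU hσ)) (hc.image _ hcont)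
    (by
      obtain ⟨σ, hσ, h0⟩ := hm
      refine ⟨_, ⟨σ, hσ, rfl⟩, ?_⟩
      change (-1 / (4 * σ)).re = 0
      rw [neg_div, neg_re, one_div, inv_re]
      simp [h0])
    (by rintro _ ⟨σ, hσ, rfl⟩; rw [RFun_inversion (hU hσ)]; exact (hR σ hσ).2)
    ⟨τ, hτ, rfl⟩).2
  rw [RFun_inversion (hU hτ), AFun_inversion (hU hτ)] at h2
  have hA := AFun_ne_zero (hU hτ)
  refine ⟨?_, h1 ▸ hA, ?_⟩
  · linear_combination I / 2 * h2 + τ * AFun (π / 4) τ * I_sq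
  -- The quotient of the two hypergeometric values is -2iτ, so the exponent equals 2πiτ.
  · rw [← h2, ← h1, mul_div_assoc, div_self hA, mul_one, nome]
    congr 1
    ring

end SixVertex

theorem mainTheorem6 (α : ℂ) (hα : α = (Real.pi : ℂ) / 4) :
    -- identities between functions of `τ` in the upper half-plane
    (∀ τ ∈ upperHalf,
      -- the denominators that occur do not vanish
      (theta α τ ≠ 0 ∧ thetaD 1 α τ ≠ 0 ∧ thetaD 1 0 τ ≠ 0 ∧ qD (RFun α) τ ≠ 0 ∧
        hFun τ ≠ 0 ∧ 1 + 16 * hFun τ ≠ 0 ∧ RFun α τ ≠ 0 ∧ 1 - 16 * RFun α τ ≠ 0 ∧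
        sqSum 0 τ ≠ 0) ∧
      -- the theta function at `α`, and `A`
      theta α τ / (Real.sqrt 2 : ℂ) = etaK 1 τ * etaK 4 τ / etaK 2 τ ∧
      AFun α τ = 1 + 4 * ∑' n : ℕ, nome τ ^ (n + 1) / (1 + nome τ ^ (2 * (n + 1))) ∧
      AFun α τ = sqSum 0 τ ^ 2 ∧
      AFun α τ = etaK 2 τ ^ 10 / (etaK 1 τ ^ 4 * etaK 4 τ ^ 4) ∧
      -- `R`
      RFun α τ = hFun τ / (1 + 16 * hFun τ) ∧
      RFun α τ = etaK 1 τ ^ 8 * etaK 4 τ ^ 16 / etaK 2 τ ^ 24 ∧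
      RFun α τ = 1 / 16 * (sqSum (1 / 2) τ / sqSum 0 τ) ^ 4 ∧
      -- `S`
      SFun α τ / 4 = (1 + 16 * hFun τ) ^ 2 / hFun τ ∧
      SFun α τ / 4 = 1 / (RFun α τ * (1 - 16 * RFun α τ)) ∧
      SFun α τ / 4 = (etaK 2 τ ^ 2 / (etaK 1 τ * etaK 4 τ)) ^ 24 ∧
      -- the differential equations satisfied by `t`, `A` and `τ A`
      derivR α (derivR α (tFun α)) τ -
        4 / (RFun α τ * (1 - 16 * RFun α τ)) * tFun α τ = 0 ∧
      (∀ f : ℂ → ℂ, (f = AFun α ∨ f = fun σ => σ * AFun α σ) →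
        derivR α (derivR α f) τ +
          (1 - 32 * RFun α τ) / (RFun α τ * (1 - 16 * RFun α τ)) * derivR α f τ -
          4 / (RFun α τ * (1 - 16 * RFun α τ)) * f τ = 0) ∧
      -- `t`, `R`, `A` are the sums of their power series in `q`
      HasSum (fun n : ℕ => PowerSeries.coeff n (tSeries α) * nome τ ^ n) (tFun α τ) ∧
      HasSum (fun n : ℕ => PowerSeries.coeff n (RSeries α) * nome τ ^ n) (RFun α τ) ∧
      HasSum (fun n : ℕ => PowerSeries.coeff n (ASeries α) * nome τ ^ n) (AFun α τ)) ∧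
    -- `A` and `τ A` are linearly independent
    (∀ c d : ℂ, (∀ τ ∈ upperHalf, c * AFun α τ + d * (τ * AFun α τ) = 0) → c = 0 ∧ d = 0) ∧
    -- identities between formal power series in `q`
    (PowerSeries.constantCoeff (tSeries α) = 0 ∧ PowerSeries.coeff 1 (tSeries α) = 1 ∧
      PowerSeries.constantCoeff (RSeries α) = 0 ∧ PowerSeries.coeff 1 (RSeries α) = 1 ∧
      tSeries α =
        RSeries α * comp (hypSeries (1 / 2) (1 / 2) 2) (PowerSeries.C 16 * RSeries α) ∧
      ASeries α = comp (hypSeries (1 / 2) (1 / 2) 1) (PowerSeries.C 16 * RSeries α)) ∧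
    -- the power series `q(t)`, and `R` as the power series `ρ = R(q(t))` in `t`
    (∃! u : PowerSeries ℂ, IsQOfT α u) ∧
    (∀ u : PowerSeries ℂ, IsQOfT α u → ∀ ρ : PowerSeries ℂ,
      (ρ = comp (RSeries α) u ↔
        PowerSeries.constantCoeff ρ = 0 ∧
        PowerSeries.X =
          ρ * comp (hypSeries (1 / 2) (1 / 2) 2) (PowerSeries.C 16 * ρ)) ∧
      (ρ = comp (RSeries α) u ↔
        PowerSeries.constantCoeff ρ = 0 ∧
        PowerSeries.X =
          ρ * comp (PowerSeries.mk fun n : ℕ =>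
            ((2 * n).choose n : ℂ) ^ 2 / ((n : ℂ) + 1)) ρ)) ∧
    -- on the imaginary axis `16 R` takes values in `(0, 1)`
    (∀ y : ℝ, 0 < y →
      ∃ x : ℝ, 0 < x ∧ x < 1 ∧ 16 * RFun α ((y : ℂ) * Complex.I) = (x : ℂ)) ∧
    -- hypergeometric expressions for `t` and `A`, for `τ` in any connected set that meets the
    -- imaginary axis and on which the series converge
    (∀ U : Set ℂ, U ⊆ upperHalf → IsPreconnected U → (∃ τ ∈ U, τ.re = 0) →
      (∀ τ ∈ U, ‖16 * RFun α τ‖ < 1) → ∀ τ ∈ U,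
        tFun α τ = RFun α τ * ₂F₁ (1 / 2 : ℂ) (1 / 2) 2 (16 * RFun α τ) ∧
        AFun α τ = ₂F₁ (1 / 2 : ℂ) (1 / 2) 1 (16 * RFun α τ)) ∧
    -- the second solution `τ A`, and Ramanujan's identity
    (∀ U : Set ℂ, U ⊆ upperHalf → IsPreconnected U → (∃ τ ∈ U, τ.re = 0) →
      (∀ τ ∈ U, ‖16 * RFun α τ‖ < 1 ∧ ‖1 - 16 * RFun α τ‖ < 1) → ∀ τ ∈ U,
        τ * AFun α τ = Complex.I / 2 * ₂F₁ (1 / 2 : ℂ) (1 / 2) 1 (1 - 16 * RFun α τ) ∧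
        ₂F₁ (1 / 2 : ℂ) (1 / 2) 1 (16 * RFun α τ) ≠ 0 ∧
        nome τ = Complex.exp (-(Real.pi : ℂ) *
          (₂F₁ (1 / 2 : ℂ) (1 / 2) 1 (1 - 16 * RFun α τ) /
            ₂F₁ (1 / 2 : ℂ) (1 / 2) 1 (16 * RFun α τ)))) := by
  subst hα
  refine ⟨fun τ hτ => ⟨⟨theta_quarter_ne_zero hτ, thetaD_one_quarter_ne_zero hτ,
    thetaD_one_origin_ne_zero hτ, qD_RFun_ne_zero hτ, hFun_ne_zero hτ, one_add_hFun_ne_zero hτ,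
    RFun_ne_zero hτ, one_sub_RFun_ne_zero hτ, sqSum_zero τ ▸ thetaThree_ne_zero hτ⟩,
    theta_quarter_eq_eta hτ, AFun_eq_lambert hτ, ?_, AFun_eq_eta hτ, RFun_eq_hFun hτ,
    RFun_eq_eta hτ, ?_, SFun_div_four_eq_hFun hτ, SFun_div_four_eq hτ, SFun_div_four_eq_eta hτ,
    tFun_ode hτ, ?_, hasQExp_tSeries τ hτ, hasQExp_RSeries τ hτ, hasQExp_ASeries τ hτ⟩,
    fun c d h => AFun_mul_AFun_linearIndependent h,
    ⟨constantCoeff_tSeries, coeff_one_tSeries, constantCoeff_RSeries, coeff_one_RSeries,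
      tSeries_eq, ASeries_eq⟩, existsUnique_isQOfT,
    fun u hu ρ => ⟨eq_comp_RSeries_iff hu, eq_comp_RSeries_iff_choose hu⟩,
    fun y hy => exists_RFun_imaginary_axis hy,
    fun U hU hc hm hR τ hτ => AFun_tFun_eq_of_isPreconnected hU hc hm hR hτ,
    fun U hU hc hm hR τ hτ => second_solution_of_isPreconnected hU hc hm hR hτ⟩
  · rw [sqSum_zero, AFun_eq hτ]
  · rw [sqSum_half, sqSum_zero, RFun_eq hτ, div_pow]
    ring
  · rintro f (rfl | rfl)
    · exact AFun_ode hτ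
    · exact mul_AFun_ode hτ
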